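/- \textbf{Setting.} Let $\lambda(x)=\sum_{i\ge1}\lambda_i x^{i-1}$ and $\rho(x)=\sum_{j\ge1}\rho_j x^{j-1}$ be polynomials with nonnegative rational coefficients and $\lambda(1)=\rho(1)=1$. Put $L_i=\frac{\lambda_i/i}{\sum_k\lambda_k/k}$ and $L(x)=\sum_iL_ix^i$. A block length $n$ is admissible if $nL_i$ and $nL'(1)\rho_j/j$ are integers for all $i,j$; $n\to\infty$ is always along admissible block lengths. The standard $(\lambda,\rho)$-irregular LDPC ensemble of block length $n$ has $nL_i$ variable nodes of degree $i$ and $nL'(1)\rho_j/j$ check nodes of degree $j$; its Tanner graph is given by a uniformly random bijection between the $E=nL'(1)$ variable sockets and the $E$ check sockets (parallel edges are allowed). Let $\epsilon\in[0,1]$ and $t\ge 0$. Every bit is sent over the erasure channel $\mathrm{BEC}(\epsilon)$ and decoded by $t$ iterations of belief propagation (BP), in which initially all messages into variable nodes are erasures. Let $\mathrm{P_b}(n,\epsilon,t)$ be the probability that a uniformly random bit is erased after $t$ iterations. The neighborhood graph of depth $t$ of a variable node consists of all nodes at distance at most $2t$ from it and the edges between them; for such a graph $G$ let $\mathbb P_n(G)$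 be the probability that it is the neighborhood graph of a uniformly random variable node, and $\mathrm{P_b}(\epsilon,G)$ the probability that its root is erased after $t$ iterations. Let $\mathcal T_t$ be the set of cycle-free neighborhood graphs of depth $t$, and define $$\mathrm{P_b}(\infty,\epsilon,t)=\lim_{n\to\infty}\mathrm{P_b}(n,\epsilon,t),\qquad \beta(\epsilon,t)=\lim_{n\to\infty}n\Bigl(\sum_{G\in\mathcal T_t}\mathbb P_n(G)\mathrm{P_b}(\epsilon,G)-\mathrm{P_b}(\infty,\epsilon,t)\Bigr).$$ Let $\mathbb E_t$ be the expectation over the tree ensemble of depth $t$ (random trees with $t$ levels of check nodes whose root is a variable node of degree $i$ with probability $L_i$, whose other variable nodes have degree $i$ with probability $\lambda_i$ and whose check nodes have degree $j$ with probability $\rho_j$, independently; the edges below the variable nodes of the last level do not belong to the tree). For such a tree let $K$ be the number of edges, $V_i$ and $C_j$ the numbers of variable nodes of degree $i$ and of check nodes of degree $j$, and $P$ the erasure probability of the root after $t$ BP iterations. \textbf{Theorem.} Both limits exist, and $$\beta(\epsilon,t)=\frac1{2L'(1)}\Bigl[\mathbb E_t[K(K-1)P]-\sum_{i:\lambda_i\ne0}\frac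 i{\lambda_i}\mathbb E_t[V_i(V_i-1)P]-\sum_{j:\rho_j\ne0}\frac j{\rho_j}\mathbb E_t[C_j(C_j-1)P]\Bigr].$$ Moreover, let $P_\epsilon(0)=1$, and for $t\ge1$ let $Q_\epsilon(t)=\epsilon\lambda(P_\epsilon(t-1))$ and $P_\epsilon(t)=1-\rho(1-Q_\epsilon(t))$. Abbreviate $p=P_\epsilon(t)$, $p_-=P_\epsilon(t-1)$, $\bar q=1-Q_\epsilon(t)$. Then for all $i,j\ge1$ $$\mathbb E_t[K(K-1)P]=\epsilon L''(p)F'(t)^2+\epsilon L'(p)F''(t),$$ $$\mathbb E_t[V_i(V_i-1)P]=\epsilon L''(p)F_v'(t,i)^2+\epsilon L'(p)F_v''(t,i)+2\epsilon L_i\,i\,p^{i-1}F_v'(t,i),$$ $$\mathbb E_t[C_j(C_j-1)P]=\epsilon L''(p)F_c'(t,j)^2+\epsilon L'(p)F_c''(t,j),$$ where all of $f',F',f'',F'',f_v',F_v',f_v'',F_v'',f_c',F_c',f_c'',F_c''$ vanish at $t=0$ and, for $t\ge1$ (the arguments $i$ and $j$ being suppressed, and terms with a factor $i-1=0$ or $j-1=0$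 being zero), $$\begin{aligned} g'(t)&=1+\lambda'(1)f'(t-1),\qquad f'(t)=1+\rho'(1)g'(t),\\ G'(t)&=g'(t)-\epsilon\lambda(p_-)-\epsilon\lambda'(p_-)F'(t-1),\\ F'(t)&=f'(t)-\rho(\bar q)-\rho'(\bar q)G'(t),\\ g''(t)&=2\lambda'(1)f'(t-1)+\lambda''(1)f'(t-1)^2+\lambda'(1)f''(t-1),\\ f''(t)&=2\rho'(1)g'(t)+\rho''(1)g'(t)^2+\rho'(1)g''(t),\\ G''(t)&=g''(t)-2\epsilon\lambda'(p_-)F'(t-1)-\epsilon\lambda''(p_-)F'(t-1)^2-\epsilon\lambda'(p_-)F''(t-1),\\ F''(t)&=f''(t)-2\rho'(\bar q)G'(t)-\rho''(\bar q)G'(t)^2-\rho'(\bar q)G''(t),\\[1ex] g_v'(t)&=\lambda'(1)f_v'(t-1)+\lambda_i,\qquad f_v'(t)=\rho'(1)g_v'(t),\\ G_v'(t)&=g_v'(t)-\epsilon\lambda'(p_-)F_v'(t-1)-\epsilon\lambda_ip_-^{i-1},\\ F_v'(t)&=f_v'(t)-\rho'(\bar q)G_v'(t),\\ g_v''(t)&=\lambda''(1)f_v'(t-1)^2+\lambda'(1)f_v''(t-1)+2\lambda_i(i-1)f_v'(t-1),\\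 f_v''(t)&=\rho''(1)g_v'(t)^2+\rho'(1)g_v''(t),\\ G_v''(t)&=g_v''(t)-\epsilon\lambda''(p_-)F_v'(t-1)^2-\epsilon\lambda'(p_-)F_v''(t-1)-2\epsilon\lambda_i(i-1)p_-^{i-2}F_v'(t-1),\\ F_v''(t)&=f_v''(t)-\rho''(\bar q)G_v'(t)^2-\rho'(\bar q)G_v''(t),\\[1ex] g_c'(t)&=\lambda'(1)f_c'(t-1),\qquad f_c'(t)=\rho'(1)g_c'(t)+\rho_j,\\ G_c'(t)&=g_c'(t)-\epsilon\lambda'(p_-)F_c'(t-1),\\ F_c'(t)&=f_c'(t)-\rho'(\bar q)G_c'(t)-\rho_j\bar q^{\,j-1},\\ g_c''(t)&=\lambda''(1)f_c'(t-1)^2+\lambda'(1)f_c''(t-1),\\ f_c''(t)&=\rho''(1)g_c'(t)^2+\rho'(1)g_c''(t)+2\rho_j(j-1)g_c'(t),\\ G_c''(t)&=g_c''(t)-\epsilon\lambda''(p_-)F_c'(t-1)^2-\epsilon\lambda'(p_-)F_c''(t-1),\\ F_c''(t)&=f_c''(t)-\rho''(\bar q)G_c'(t)^2-\rho'(\bar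 q)G_c''(t)-2\rho_j(j-1)\bar q^{\,j-2}G_c'(t). \end{aligned}$$ -/

import Mathlib

open Filter Topology Polynomial
open scoped Classical

noncomputable section

namespace LDPC

/-! ### Degree distributions

`lam = ∑ λ_i x^(i-1)` and `rho = ∑ ρ_j x^(j-1)` are polynomials (edge perspective). -/

/-- An edge-perspective degree distribution: nonnegative coefficients which sum to one.
The coefficients are rational, so that there are block lengths at which the prescribed fractions of
nodes are attained exactly. -/
structure IsDegreeDist (p : ℝ[X]) : Prop where
  nonneg : ∀ k, 0 ≤ p.coeff k
  sum_one : p.eval 1 = 1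
  rational : ∀ k, ∃ q : ℚ, p.coeff k = (q : ℝ)

/-- `λ_i`, the fraction of the edges that are attached to nodes of degree `i ≥ 1`. -/
def edgeFrac (p : ℝ[X]) (i : ℕ) : ℝ := p.coeff (i - 1)

/-- `L_i = (λ_i / i) / ∑_k (λ_k / k)`, the fraction of the nodes that have degree `i ≥ 1`. -/
def nodeFrac (p : ℝ[X]) (i : ℕ) : ℝ :=
  (edgeFrac p i / i) / ∑ k ∈ Finset.Icc 1 (p.natDegree + 1), edgeFrac p k / k

/-- `L(x) = ∑_i L_i x^i`. -/
def nodePoly (p : ℝ[X]) : ℝ[X] :=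
  ∑ i ∈ Finset.Icc 1 (p.natDegree + 1), C (nodeFrac p i) * X ^ i

/-- First derivative of a polynomial at a point. -/
def d1 (p : ℝ[X]) (x : ℝ) : ℝ := (derivative p).eval x

/-- Second derivative of a polynomial at a point. -/
def d2 (p : ℝ[X]) (x : ℝ) : ℝ := (derivative (derivative p)).eval x

/-! ### Tanner graphs and belief propagation on the erasure channel

The nodes of one side have sockets; a Tanner multigraph is a bijection from the variable sockets to
the check sockets, and its edges are identified with the variable sockets. -/

/-- Sockets of a family of nodes with degrees `d`. -/
abbrev Socket {N : Type} (d : N → ℕ) : Type := Σ x : N, Fin (d x)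

section Graph

variable {V K : Type} {dV : V → ℕ} {dC : K → ℕ}

/-- The Tanner multigraph, with every edge subdivided by a midpoint (so that parallel edges
form a cycle), as a simple graph on variable nodes, check nodes and edges. -/
def tannerGraph (π : Socket dV ≃ Socket dC) : SimpleGraph (V ⊕ K ⊕ Socket dV) :=
  SimpleGraph.fromRel fun x y =>
    match x, y with
    | .inl v, .inr (.inr s) => s.1 = v
    | .inr (.inl c), .inr (.inr s) => (π s).1 = c
    | _, _ => False

/-- The neighborhood of depth `t` of a variable node: everything that is reached by a path of at
most `2 t` edges, that is of at most `4 t` steps in the subdivided graph. -/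
def neighborhood (π : Socket dV ≃ Socket dC) (t : ℕ) (v : V) : Set (V ⊕ K ⊕ Socket dV) :=
  {x | ∃ p : (tannerGraph π).Walk (.inl v) x, p.length ≤ 4 * t}

/-- The neighborhood graph of depth `t` of the variable node `v` has no cycle. -/
def CycleFree (π : Socket dV ≃ Socket dC) (t : ℕ) (v : V) : Prop :=
  ((tannerGraph π).induce (neighborhood π t v)).IsAcyclic

/-- Messages into check nodes: the message along an edge is erased iff the channel output of its
variable node is erased and the incoming messages `m` along all its other edges are erased. -/
def varUpdate (e : V → Bool) (m : Socket dV → Prop) (s : Socket dV) : Prop :=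
  e s.1 = true ∧ ∀ s' : Socket dV, s'.1 = s.1 → s' ≠ s → m s'

/-- Messages into variable nodes: the message along an edge is erased iff the incoming message `m`
along some other edge of its check node is erased. -/
def checkUpdate (π : Socket dV ≃ Socket dC) (m : Socket dV → Prop) (s : Socket dV) : Prop :=
  ∃ s' : Socket dV, (π s').1 = (π s).1 ∧ s' ≠ s ∧ m s'

/-- The message into the variable node along an edge is erased in iteration `t`; initially all
messages are erased. -/
def checkMsg (π : Socket dV ≃ Socket dC) (e : V → Bool) : ℕ → Socket dV → Prop
  | 0 => fun _ => True
  | t + 1 => checkUpdate π (varUpdate e (checkMsg π e t))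

/-- The bit at `v` is still erased after `t` iterations. -/
def BitErased (π : Socket dV ≃ Socket dC) (e : V → Bool) (t : ℕ) (v : V) : Prop :=
  e v = true ∧ ∀ s : Socket dV, s.1 = v → checkMsg π e t s

end Graph

/-- Probability of the erasure pattern `e` when symbols are erased independently with
probability `ε`. -/
def patternProb {N : Type} [Fintype N] (ε : ℝ) (e : N → Bool) : ℝ :=
  ∏ x, if e x then ε else 1 - ε

/-- Error probability of the bit `v` after `t` iterations for a fixed Tanner graph. -/
def graphErrorProb {V K : Type} [Fintype V] {dV : V → ℕ} {dC : K → ℕ}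
    (π : Socket dV ≃ Socket dC) (ε : ℝ) (t : ℕ) (v : V) : ℝ :=
  ∑ e : V → Bool, patternProb ε e * if BitErased π e t v then 1 else 0

/-! ### The standard irregular ensemble -/

/-- The number `n L_i` of variable nodes of degree `i`. -/
def numVarNodes (lam : ℝ[X]) (n i : ℕ) : ℝ := n * nodeFrac lam i

/-- The number `E ρ_j / j` of check nodes of degree `j`, where `E = n L'(1)` is the number of
edges. -/
def numCheckNodes (lam rho : ℝ[X]) (n j : ℕ) : ℝ :=
  n * d1 (nodePoly lam) 1 * edgeFrac rho j / j

/-- The block length `n` is admissible when all the prescribed numbers of nodes are integers. -/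
def Admissible (lam rho : ℝ[X]) (n : ℕ) : Prop :=
  (∀ i ∈ Finset.Icc 1 (lam.natDegree + 1), ∃ m : ℕ, numVarNodes lam n i = m) ∧
  ∀ j ∈ Finset.Icc 1 (rho.natDegree + 1), ∃ m : ℕ, numCheckNodes lam rho n j = m

/-- `n → ∞` along the admissible block lengths. -/
def blocklengths (lam rho : ℝ[X]) : Filter ℕ := atTop ⊓ 𝓟 {n | Admissible lam rho n}

/-- The variable nodes; `⟨a, _⟩` has degree `a + 1`. (The floor has no effect at admissible `n`.) -/
abbrev VarNode (lam : ℝ[X]) (n : ℕ) : Type :=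
  Σ a : Fin (lam.natDegree + 1), Fin ⌊numVarNodes lam n (a + 1)⌋₊

/-- The check nodes; `⟨b, _⟩` has degree `b + 1`. (The floor has no effect at admissible `n`.) -/
abbrev CheckNode (lam rho : ℝ[X]) (n : ℕ) : Type :=
  Σ b : Fin (rho.natDegree + 1), Fin ⌊numCheckNodes lam rho n (b + 1)⌋₊

/-- Degrees of variable nodes. -/
def varDeg (lam : ℝ[X]) (n : ℕ) (v : VarNode lam n) : ℕ := v.1 + 1

/-- Degrees of check nodes. -/
def checkDeg (lam rho : ℝ[X]) (n : ℕ) (c : CheckNode lam rho n) : ℕ := c.1 + 1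

/-- The Tanner graphs of the ensemble of block length `n`; all are equally likely. -/
abbrev Ensemble (lam rho : ℝ[X]) (n : ℕ) : Type :=
  Socket (varDeg lam n) ≃ Socket (checkDeg lam rho n)

/-- Expectation over a uniformly random Tanner graph and a uniformly random variable node. -/
def ensembleExp (lam rho : ℝ[X]) (n : ℕ) (Y : Ensemble lam rho n → VarNode lam n → ℝ) : ℝ :=
  (∑ π : Ensemble lam rho n, ∑ v : VarNode lam n, Y π v) /
    (Fintype.card (Ensemble lam rho n) * n)

/-- `P_b(n, ε, t)`, the bit error probability of the ensemble. -/
def bitErrorProb (lam rho : ℝ[X]) (ε : ℝ) (t n : ℕ) : ℝ :=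
  ensembleExp lam rho n fun π v => graphErrorProb π ε t v

/-- `∑_G ℙ_n(G) P_b(ε, G)` over the cycle-free neighborhood graphs `G` of depth `t`: the part of
the bit error probability that comes from roots with a cycle-free neighborhood graph. -/
def cycleFreeErrorProb (lam rho : ℝ[X]) (ε : ℝ) (t n : ℕ) : ℝ :=
  ensembleExp lam rho n fun π v => if CycleFree π t v then graphErrorProb π ε t v else 0

/-- `P_b(∞, ε, t) = lim P_b(n, ε, t)`. -/
def limBitErrorProb (lam rho : ℝ[X]) (ε : ℝ) (t : ℕ) : ℝ :=
  limUnder (blocklengths lam rho) fun n => bitErrorProb lam rho ε t n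

/-- The quantity whose limit is `β(ε, t)`. -/
def betaSeq (lam rho : ℝ[X]) (ε : ℝ) (t n : ℕ) : ℝ :=
  n * (cycleFreeErrorProb lam rho ε t n - limBitErrorProb lam rho ε t)

/-- `β(ε, t)`, the contribution of the cycle-free neighborhood graphs to the coefficient
of `1 / n`. -/
def beta (lam rho : ℝ[X]) (ε : ℝ) (t : ℕ) : ℝ :=
  limUnder (blocklengths lam rho) fun n => betaSeq lam rho ε t n

/-! ### The tree ensemble -/

/-- Trees of depth `t` (`t` levels of check nodes) whose top is a variable node. A variable node
with label `a : Fin p` has degree `a + 1`, a check node with label `b : Fin q` has degree `b + 1`.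
The top has `a + r` children: `r = 1` for a whole tree, and `r = 0` for a subtree, whose top has one
more edge to its parent. The variable nodes of the last level have a degree, but their edges to
further check nodes do not belong to the tree. -/
def PlaneTree (p q : ℕ) : ℕ → ℕ → Type
  | 0, _ => Fin p
  | t + 1, r => Σ a : Fin p, (Fin (a + r) → Σ b : Fin q, (Fin b → PlaneTree p q t 0))

instance instFintypeTree (p q : ℕ) : ∀ t r : ℕ, Fintype (PlaneTree p q t r)
  | 0, _ => inferInstanceAs (Fintype (Fin p))
  | t + 1, r =>
    haveI := instFintypeTree p q t 0
    inferInstanceAs (Fintype (Σ a : Fin p, (Fin (a + r) → Σ b : Fin q, (Fin b → PlaneTree p q t 0))))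

variable {p q : ℕ}

/-- The probability of a tree: the top has degree `i` with probability `w i`, all other variable
nodes with probability `λ_i`, and check nodes have degree `j` with probability `ρ_j`,
independently. -/
def treeProb (lam rho : ℝ[X]) : ∀ t r : ℕ, (ℕ → ℝ) → PlaneTree p q t r → ℝ
  | 0, _, w, a => w ((show Fin p from a) + 1)
  | t + 1, _, w, ⟨a, c⟩ => w (a + 1) * ∏ k, (edgeFrac rho ((c k).1 + 1) *
      ∏ l, treeProb lam rho t 0 (edgeFrac lam) ((c k).2 l))

/-- Number of edges. -/
def numEdges : ∀ t r : ℕ, PlaneTree p q t r → ℕ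
  | 0, _, _ => 0
  | t + 1, _, ⟨_, c⟩ => ∑ k, (1 + ∑ l, (1 + numEdges t 0 ((c k).2 l)))

/-- Number of variable nodes of degree `i`. -/
def numVar (i : ℕ) : ∀ t r : ℕ, PlaneTree p q t r → ℕ
  | 0, _, a => if (show Fin p from a) + 1 = i then 1 else 0
  | t + 1, _, ⟨a, c⟩ => (if (a : ℕ) + 1 = i then 1 else 0) + ∑ k, ∑ l, numVar i t 0 ((c k).2 l)

/-- Number of check nodes of degree `j`. -/
def numCheck (j : ℕ) : ∀ t r : ℕ, PlaneTree p q t r → ℕ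
  | 0, _, _ => 0
  | t + 1, _, ⟨_, c⟩ =>
    ∑ k, ((if ((c k).1 : ℕ) + 1 = j then 1 else 0) + ∑ l, numCheck j t 0 ((c k).2 l))

/-- The variable nodes of a tree; `none` is the top. -/
def TreeVar : ∀ t r : ℕ, PlaneTree p q t r → Type
  | 0, _, _ => Unit
  | t + 1, r, ⟨a, c⟩ => Option (Σ k : Fin (a + r), Σ l : Fin (c k).1, TreeVar t 0 ((c k).2 l))

instance instFintypeTreeVar : ∀ (t r : ℕ) (T : PlaneTree p q t r), Fintype (TreeVar t r T)
  | 0, _, _ => inferInstanceAs (Fintype Unit)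
  | t + 1, r, ⟨a, c⟩ =>
    haveI := fun T : PlaneTree p q t 0 => instFintypeTreeVar t 0 T
    inferInstanceAs (Fintype (Option (Σ k : Fin (a + r), Σ l : Fin (c k).1,
      TreeVar t 0 ((c k).2 l))))

/-- Belief propagation towards the top: the top stays erased after `t` iterations under the erasure
pattern `e` iff its channel output is erased and all the messages from its child check nodes are
erased, where such a message is erased iff the message of some child of the check node is. -/
def TreeErased : ∀ (t r : ℕ) (T : PlaneTree p q t r), (TreeVar t r T → Bool) → Prop
  | 0, _, _, e => e () = true
  | t + 1, _, ⟨_, c⟩, e => e none = true ∧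
      ∀ k, ∃ l, TreeErased t 0 ((c k).2 l) fun x => e (some ⟨k, l, x⟩)

/-- `P`, the erasure probability of the root of a tree of depth `t` after `t` iterations. -/
def treeErrorProb (ε : ℝ) (t r : ℕ) (T : PlaneTree p q t r) : ℝ :=
  ∑ e : TreeVar t r T → Bool, patternProb ε e * if TreeErased t r T e then 1 else 0

/-- Trees with the degrees of the ensemble. -/
abbrev EnsembleTree (lam rho : ℝ[X]) (t : ℕ) : Type :=
  PlaneTree (lam.natDegree + 1) (rho.natDegree + 1) t 1

/-- `𝔼_t`, the expectation over the tree ensemble of depth `t` from the node perspective. -/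
def treeExp (lam rho : ℝ[X]) (t : ℕ) (Y : EnsembleTree lam rho t → ℝ) : ℝ :=
  ∑ T : EnsembleTree lam rho t, treeProb lam rho t 1 (nodeFrac lam) T * Y T

/-- `𝔼_t[K (K - 1) P]`. -/
def expK (lam rho : ℝ[X]) (ε : ℝ) (t : ℕ) : ℝ :=
  treeExp lam rho t fun T =>
    (numEdges t 1 T : ℝ) * ((numEdges t 1 T : ℝ) - 1) * treeErrorProb ε t 1 T

/-- `𝔼_t[V_i (V_i - 1) P]`. -/
def expV (lam rho : ℝ[X]) (ε : ℝ) (t i : ℕ) : ℝ :=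
  treeExp lam rho t fun T =>
    (numVar i t 1 T : ℝ) * ((numVar i t 1 T : ℝ) - 1) * treeErrorProb ε t 1 T

/-- `𝔼_t[C_j (C_j - 1) P]`. -/
def expC (lam rho : ℝ[X]) (ε : ℝ) (t j : ℕ) : ℝ :=
  treeExp lam rho t fun T =>
    (numCheck j t 1 T : ℝ) * ((numCheck j t 1 T : ℝ) - 1) * treeErrorProb ε t 1 T

/-! ### The recursions

A name such as `fK1`, `fK2` stands for the first and the second derivative. The functions `g` and
`G` are used only at arguments `t ≥ 1`. -/

/-- Density evolution `P_ε(t)`. -/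
def deP (lam rho : ℝ[X]) (ε : ℝ) : ℕ → ℝ
  | 0 => 1
  | t + 1 => 1 - rho.eval (1 - ε * lam.eval (deP lam rho ε t))

/-- Density evolution `Q_ε(t)`. -/
def deQ (lam rho : ℝ[X]) (ε : ℝ) (t : ℕ) : ℝ := ε * lam.eval (deP lam rho ε (t - 1))

/-- `f'(t)`. -/
def fK1 (lam rho : ℝ[X]) : ℕ → ℝ
  | 0 => 0
  | t + 1 =>
    let g := 1 + d1 lam 1 * fK1 lam rho t
    1 + d1 rho 1 * g

/-- `g'(t)`. -/
def gK1 (lam rho : ℝ[X]) (t : ℕ) : ℝ := 1 + d1 lam 1 * fK1 lam rho (t - 1)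

/-- `F'(t)`. -/
def FK1 (lam rho : ℝ[X]) (ε : ℝ) : ℕ → ℝ
  | 0 => 0
  | t + 1 =>
    let G := gK1 lam rho (t + 1) - ε * lam.eval (deP lam rho ε t)
      - ε * d1 lam (deP lam rho ε t) * FK1 lam rho ε t
    fK1 lam rho (t + 1) - rho.eval (1 - deQ lam rho ε (t + 1))
      - d1 rho (1 - deQ lam rho ε (t + 1)) * G

/-- `G'(t)`. -/
def GK1 (lam rho : ℝ[X]) (ε : ℝ) (t : ℕ) : ℝ :=
  gK1 lam rho t - ε * lam.eval (deP lam rho ε (t - 1))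
    - ε * d1 lam (deP lam rho ε (t - 1)) * FK1 lam rho ε (t - 1)

/-- `f''(t)`. -/
def fK2 (lam rho : ℝ[X]) : ℕ → ℝ
  | 0 => 0
  | t + 1 =>
    let g := 2 * d1 lam 1 * fK1 lam rho t + d2 lam 1 * fK1 lam rho t ^ 2
      + d1 lam 1 * fK2 lam rho t
    2 * d1 rho 1 * gK1 lam rho (t + 1) + d2 rho 1 * gK1 lam rho (t + 1) ^ 2 + d1 rho 1 * g

/-- `g''(t)`. -/
def gK2 (lam rho : ℝ[X]) (t : ℕ) : ℝ :=
  2 * d1 lam 1 * fK1 lam rho (t - 1) + d2 lam 1 * fK1 lam rho (t - 1) ^ 2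
    + d1 lam 1 * fK2 lam rho (t - 1)

/-- `F''(t)`; the local `G` is `G''(t)`. -/
def FK2 (lam rho : ℝ[X]) (ε : ℝ) : ℕ → ℝ
  | 0 => 0
  | t + 1 =>
    let G := gK2 lam rho (t + 1) - 2 * ε * d1 lam (deP lam rho ε t) * FK1 lam rho ε t
      - ε * d2 lam (deP lam rho ε t) * FK1 lam rho ε t ^ 2
      - ε * d1 lam (deP lam rho ε t) * FK2 lam rho ε t
    fK2 lam rho (t + 1)
      - 2 * d1 rho (1 - deQ lam rho ε (t + 1)) * GK1 lam rho ε (t + 1)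
      - d2 rho (1 - deQ lam rho ε (t + 1)) * GK1 lam rho ε (t + 1) ^ 2
      - d1 rho (1 - deQ lam rho ε (t + 1)) * G

/-- `f_v'(t, i)`. -/
def fV1 (lam rho : ℝ[X]) (i : ℕ) : ℕ → ℝ
  | 0 => 0
  | t + 1 =>
    let g := d1 lam 1 * fV1 lam rho i t + edgeFrac lam i
    d1 rho 1 * g

/-- `g_v'(t, i)`. -/
def gV1 (lam rho : ℝ[X]) (i t : ℕ) : ℝ := d1 lam 1 * fV1 lam rho i (t - 1) + edgeFrac lam i

/-- `F_v'(t, i)`. -/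
def FV1 (lam rho : ℝ[X]) (ε : ℝ) (i : ℕ) : ℕ → ℝ
  | 0 => 0
  | t + 1 =>
    let G := gV1 lam rho i (t + 1) - ε * d1 lam (deP lam rho ε t) * FV1 lam rho ε i t
      - ε * edgeFrac lam i * deP lam rho ε t ^ (i - 1)
    fV1 lam rho i (t + 1) - d1 rho (1 - deQ lam rho ε (t + 1)) * G

/-- `G_v'(t, i)`. -/
def GV1 (lam rho : ℝ[X]) (ε : ℝ) (i t : ℕ) : ℝ :=
  gV1 lam rho i t - ε * d1 lam (deP lam rho ε (t - 1)) * FV1 lam rho ε i (t - 1)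
    - ε * edgeFrac lam i * deP lam rho ε (t - 1) ^ (i - 1)

/-- `f_v''(t, i)`. -/
def fV2 (lam rho : ℝ[X]) (i : ℕ) : ℕ → ℝ
  | 0 => 0
  | t + 1 =>
    let g := d2 lam 1 * fV1 lam rho i t ^ 2 + d1 lam 1 * fV2 lam rho i t
      + 2 * edgeFrac lam i * ((i : ℝ) - 1) * fV1 lam rho i t
    d2 rho 1 * gV1 lam rho i (t + 1) ^ 2 + d1 rho 1 * g

/-- `g_v''(t, i)`. -/
def gV2 (lam rho : ℝ[X]) (i t : ℕ) : ℝ :=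
  d2 lam 1 * fV1 lam rho i (t - 1) ^ 2 + d1 lam 1 * fV2 lam rho i (t - 1)
    + 2 * edgeFrac lam i * ((i : ℝ) - 1) * fV1 lam rho i (t - 1)

/-- `F_v''(t, i)`; the local `G` is `G_v''(t, i)`. -/
def FV2 (lam rho : ℝ[X]) (ε : ℝ) (i : ℕ) : ℕ → ℝ
  | 0 => 0
  | t + 1 =>
    let G := gV2 lam rho i (t + 1) - ε * d2 lam (deP lam rho ε t) * FV1 lam rho ε i t ^ 2
      - ε * d1 lam (deP lam rho ε t) * FV2 lam rho ε i t
      - 2 * ε * edgeFrac lam i * ((i : ℝ) - 1) * deP lam rho ε t ^ (i - 2) * FV1 lam rho ε i t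
    fV2 lam rho i (t + 1)
      - d2 rho (1 - deQ lam rho ε (t + 1)) * GV1 lam rho ε i (t + 1) ^ 2
      - d1 rho (1 - deQ lam rho ε (t + 1)) * G

/-- `f_c'(t, j)`. -/
def fC1 (lam rho : ℝ[X]) (j : ℕ) : ℕ → ℝ
  | 0 => 0
  | t + 1 =>
    let g := d1 lam 1 * fC1 lam rho j t
    d1 rho 1 * g + edgeFrac rho j

/-- `g_c'(t, j)`. -/
def gC1 (lam rho : ℝ[X]) (j t : ℕ) : ℝ := d1 lam 1 * fC1 lam rho j (t - 1)

/-- `F_c'(t, j)`. -/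
def FC1 (lam rho : ℝ[X]) (ε : ℝ) (j : ℕ) : ℕ → ℝ
  | 0 => 0
  | t + 1 =>
    let G := gC1 lam rho j (t + 1) - ε * d1 lam (deP lam rho ε t) * FC1 lam rho ε j t
    fC1 lam rho j (t + 1) - d1 rho (1 - deQ lam rho ε (t + 1)) * G
      - edgeFrac rho j * (1 - deQ lam rho ε (t + 1)) ^ (j - 1)

/-- `G_c'(t, j)`. -/
def GC1 (lam rho : ℝ[X]) (ε : ℝ) (j t : ℕ) : ℝ :=
  gC1 lam rho j t - ε * d1 lam (deP lam rho ε (t - 1)) * FC1 lam rho ε j (t - 1)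

/-- `f_c''(t, j)`. -/
def fC2 (lam rho : ℝ[X]) (j : ℕ) : ℕ → ℝ
  | 0 => 0
  | t + 1 =>
    let g := d2 lam 1 * fC1 lam rho j t ^ 2 + d1 lam 1 * fC2 lam rho j t
    d2 rho 1 * gC1 lam rho j (t + 1) ^ 2 + d1 rho 1 * g
      + 2 * edgeFrac rho j * ((j : ℝ) - 1) * gC1 lam rho j (t + 1)

/-- `g_c''(t, j)`. -/
def gC2 (lam rho : ℝ[X]) (j t : ℕ) : ℝ :=
  d2 lam 1 * fC1 lam rho j (t - 1) ^ 2 + d1 lam 1 * fC2 lam rho j (t - 1)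

/-- `F_c''(t, j)`; the local `G` is `G_c''(t, j)`. -/
def FC2 (lam rho : ℝ[X]) (ε : ℝ) (j : ℕ) : ℕ → ℝ
  | 0 => 0
  | t + 1 =>
    let G := gC2 lam rho j (t + 1) - ε * d2 lam (deP lam rho ε t) * FC1 lam rho ε j t ^ 2
      - ε * d1 lam (deP lam rho ε t) * FC2 lam rho ε j t
    fC2 lam rho j (t + 1)
      - d2 rho (1 - deQ lam rho ε (t + 1)) * GC1 lam rho ε j (t + 1) ^ 2
      - d1 rho (1 - deQ lam rho ε (t + 1)) * G
      - 2 * edgeFrac rho j * ((j : ℝ) - 1) * (1 - deQ lam rho ε (t + 1)) ^ (j - 2)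
        * GC1 lam rho ε j (t + 1)

end LDPC

end

open LDPC

/-! A Tanner graph together with a root socket determines a computation tree whose nodes are labeled
by sockets of the graph, and belief propagation reaches the same decision at the root of the graph
and at the top of the tree (`Consistent.bitErased_iff`). The labels define a map from the subdivided
tree to the subdivided Tanner graph. It is injective around every vertex and surjective around every
vertex of depth less than `4 t`. Hence the neighborhood is cycle-free exactly when no node occurs
twice in the tree (`isAcyclic_ball_iff_injective`, `Consistent.cycleFree_iff`). In that case the
erasures at the nodes of the tree are independent, and the root has the error probability of the
tree (`Consistent.graphErrorProb_eq`).

Since sockets are ordered, plane trees can be counted without symmetry factors. Let a tree have `K`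
edges, `V_i` variable nodes of degree `i` and `C_j` check nodes of degree `j`, and let the ensemble
have `E` edges, with `N_i i = E λ_i` and `M_j j = E ρ_j`. The labelings by distinct nodes are
counted by the falling factorials of `N_i` and `M_j` times `i ^ V_i` and `j ^ C_j`, and each of them
extends to `(E - K)!` Tanner graphs (`card_compTree_eq`). A tree has `K + 1` nodes, so division by
`n E!` and by the root degree gives the tree probability times `∏_i ∏_{k<V_i} (1 - k i h / λ_i) *
∏_j ∏_{k<C_j} (1 - k j h / ρ_j) / ∏_{k<K} (1 - k h)` at `h = 1 / E`. This is the exact formula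
`ensembleExp_cycleFree`. The factor `treeCorr` is `1` at `h = 0`, and its derivative there is half
of `K (K - 1)` minus the weighted sums of `V_i (V_i - 1)` and `C_j (C_j - 1)`.

There are finitely many trees, so limits can be taken termwise. The values at zero show that cycles
have vanishing probability and that the error probability tends to `𝔼_t[P]`
(`tendsto_bitErrorProb`). The derivatives give `β`, because `n h = 1 / L'(1)`
(`tendsto_mul_cycleFreeErrorProb_sub`).

The factorial moments are second derivatives at `1` of generating functions of a weight over the
erased trees (`sum_treeProb_weight_error`, `treeExp_weight`). Independence of branches makes these
functions compositions; a check node sends an erasure unless none of its children does, which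
accounts for the subtractions. The product and chain rules then give the recursions. -/

noncomputable section

namespace LDPC

/-! ### Typed nodes, and the nodes and edges of a plane tree -/

section Trees

variable {p q : ℕ}

/-- Node `⟨a, _⟩` has degree `a + 1`. -/
abbrev typedDeg (N : Fin p → ℕ) (v : Σ a : Fin p, Fin (N a)) : ℕ := v.1 + 1

/-- The socket with index `z.2` of the `z.1`-th node of type `a`. -/
abbrev mkSocket (N : Fin p → ℕ) (a : Fin p) (z : Fin (N a) × Fin (a + 1)) : Socket (typedDeg N) :=
  ⟨⟨a, z.1⟩, z.2⟩

/-- The socket of the `k`-th child: for `r = 0` the socket `j` towards the parent is left out. -/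
def childSocket {a : ℕ} : ∀ r : ℕ, Fin (a + 1) → Fin (a + r) → Fin (a + 1)
  | 0, j, k => j.succAbove k
  | 1, _, k => k
  | _ + 2, _, _ => 0

/-- The type of a variable node. -/
def varType : ∀ (t r : ℕ) (T : PlaneTree p q t r), TreeVar t r T → Fin p
  | 0, _, a, _ => a
  | _ + 1, _, ⟨a, _⟩, none => a
  | t + 1, _, ⟨_, c⟩, some ⟨k, l, x⟩ => varType t 0 ((c k).2 l) x

/-- The top of a tree. -/
def treeRoot : ∀ (t r : ℕ) (T : PlaneTree p q t r), TreeVar t r T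
  | 0, _, _ => ()
  | _ + 1, _, ⟨_, _⟩ => none

/-- The check nodes of a tree. -/
def TreeCheck : ∀ t r : ℕ, PlaneTree p q t r → Type
  | 0, _, _ => Empty
  | t + 1, r, ⟨a, c⟩ => Σ k : Fin (a + r), Option (Σ l : Fin (c k).1, TreeCheck t 0 ((c k).2 l))

/-- The type of a check node. -/
def checkType : ∀ (t r : ℕ) (T : PlaneTree p q t r), TreeCheck t r T → Fin q
  | 0, _, _, y => y.elim
  | _ + 1, _, ⟨_, c⟩, ⟨k, none⟩ => (c k).1
  | t + 1, _, ⟨_, c⟩, ⟨k, some ⟨l, y⟩⟩ => checkType t 0 ((c k).2 l) y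

/-- The edges of a tree. -/
def TreeEdge : ∀ t r : ℕ, PlaneTree p q t r → Type
  | 0, _, _ => Empty
  | t + 1, r, ⟨a, c⟩ =>
    Σ k : Fin (a + r), Option (Σ l : Fin (c k).1, Option (TreeEdge t 0 ((c k).2 l)))

instance instFintypeTreeCheck : ∀ (t r : ℕ) (T : PlaneTree p q t r), Fintype (TreeCheck t r T)
  | 0, _, _ => inferInstanceAs (Fintype Empty)
  | t + 1, r, ⟨a, c⟩ =>
    haveI := fun T : PlaneTree p q t 0 => instFintypeTreeCheck t 0 T
    inferInstanceAs (Fintype (Σ k : Fin (a + r), Option (Σ l : Fin (c k).1,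
      TreeCheck t 0 ((c k).2 l))))

instance instFintypeTreeEdge : ∀ (t r : ℕ) (T : PlaneTree p q t r), Fintype (TreeEdge t r T)
  | 0, _, _ => inferInstanceAs (Fintype Empty)
  | t + 1, r, ⟨a, c⟩ =>
    haveI := fun T : PlaneTree p q t 0 => instFintypeTreeEdge t 0 T
    inferInstanceAs (Fintype (Σ k : Fin (a + r), Option (Σ l : Fin (c k).1,
      Option (TreeEdge t 0 ((c k).2 l)))))

/-- The variable node of an edge. -/
def edgeVar : ∀ (t r : ℕ) (T : PlaneTree p q t r), TreeEdge t r T → TreeVar t r T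
  | 0, _, _, e => e.elim
  | _ + 1, _, ⟨_, _⟩, ⟨_, none⟩ => none
  | t + 1, _, ⟨_, c⟩, ⟨k, some ⟨l, none⟩⟩ => some ⟨k, l, treeRoot t 0 ((c k).2 l)⟩
  | t + 1, _, ⟨_, c⟩, ⟨k, some ⟨l, some e⟩⟩ => some ⟨k, l, edgeVar t 0 ((c k).2 l) e⟩

/-- The check node of an edge. -/
def edgeCheck : ∀ (t r : ℕ) (T : PlaneTree p q t r), TreeEdge t r T → TreeCheck t r T
  | 0, _, _, e => e.elim
  | _ + 1, _, ⟨_, _⟩, ⟨k, none⟩ => ⟨k, none⟩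
  | _ + 1, _, ⟨_, _⟩, ⟨k, some ⟨_, none⟩⟩ => ⟨k, none⟩
  | t + 1, _, ⟨_, c⟩, ⟨k, some ⟨l, some e⟩⟩ => ⟨k, some ⟨l, edgeCheck t 0 ((c k).2 l) e⟩⟩

/-- The distance of a variable node from the top, in the subdivided tree. -/
def depthVar : ∀ (t r : ℕ) (T : PlaneTree p q t r), TreeVar t r T → ℕ
  | 0, _, _, _ => 0
  | _ + 1, _, ⟨_, _⟩, none => 0
  | t + 1, _, ⟨_, c⟩, some ⟨k, l, x⟩ => depthVar t 0 ((c k).2 l) x + 4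

/-- The distance of a check node from the top, in the subdivided tree. -/
def depthCheck : ∀ (t r : ℕ) (T : PlaneTree p q t r), TreeCheck t r T → ℕ
  | 0, _, _, y => y.elim
  | _ + 1, _, ⟨_, _⟩, ⟨_, none⟩ => 2
  | t + 1, _, ⟨_, c⟩, ⟨k, some ⟨l, y⟩⟩ => depthCheck t 0 ((c k).2 l) y + 4

/-- The distance of the midpoint of an edge from the top, in the subdivided tree. -/
def depthEdge : ∀ (t r : ℕ) (T : PlaneTree p q t r), TreeEdge t r T → ℕ
  | 0, _, _, e => e.elim
  | _ + 1, _, ⟨_, _⟩, ⟨_, none⟩ => 1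
  | _ + 1, _, ⟨_, _⟩, ⟨_, some ⟨_, none⟩⟩ => 3
  | t + 1, _, ⟨_, c⟩, ⟨k, some ⟨l, some e⟩⟩ => depthEdge t 0 ((c k).2 l) e + 4

/-- Labelings of the variable nodes by sockets of the right type; the socket is the one
towards the parent. -/
abbrev VarLabel (N : Fin p → ℕ) (t r : ℕ) (T : PlaneTree p q t r) : Type :=
  ∀ x : TreeVar t r T, Fin (N (varType t r T x)) × Fin (varType t r T x + 1)

/-- Labelings of the check nodes by sockets of the right type; the socket is the one
towards the parent. -/
abbrev CheckLabel (M : Fin q → ℕ) (t r : ℕ) (T : PlaneTree p q t r) : Type :=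
  ∀ y : TreeCheck t r T, Fin (M (checkType t r T y)) × Fin (checkType t r T y + 1)

variable {N : Fin p → ℕ} {M : Fin q → ℕ}

/-- The socket that labels a variable node. -/
def varSocket {t r : ℕ} {T : PlaneTree p q t r} (X : VarLabel N t r T) (x : TreeVar t r T) :
    Socket (typedDeg N) := mkSocket N (varType t r T x) (X x)

/-- The socket that labels a check node. -/
def checkSocket {t r : ℕ} {T : PlaneTree p q t r} (Y : CheckLabel M t r T) (y : TreeCheck t r T) :
    Socket (typedDeg M) := mkSocket M (checkType t r T y) (Y y)

/-- The variable socket of an edge of a labeled tree. -/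
def edgeVarSocket : ∀ (t r : ℕ) (T : PlaneTree p q t r), VarLabel N t r T → TreeEdge t r T →
    Socket (typedDeg N)
  | 0, _, _, _, e => e.elim
  | _ + 1, r, ⟨a, _⟩, X, ⟨k, none⟩ => ⟨⟨a, (X none).1⟩, childSocket r (X none).2 k⟩
  | t + 1, _, ⟨_, c⟩, X, ⟨k, some ⟨l, none⟩⟩ =>
    varSocket (T := (c k).2 l) (fun x => X (some ⟨k, l, x⟩)) (treeRoot t 0 ((c k).2 l))
  | t + 1, _, ⟨_, c⟩, X, ⟨k, some ⟨l, some e⟩⟩ =>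
    edgeVarSocket t 0 ((c k).2 l) (fun x => X (some ⟨k, l, x⟩)) e

/-- The check socket of an edge of a labeled tree. -/
def edgeCheckSocket : ∀ (t r : ℕ) (T : PlaneTree p q t r), CheckLabel M t r T → TreeEdge t r T →
    Socket (typedDeg M)
  | 0, _, _, _, e => e.elim
  | _ + 1, _, ⟨_, c⟩, Y, ⟨k, none⟩ => mkSocket M (c k).1 (Y ⟨k, none⟩)
  | _ + 1, _, ⟨_, c⟩, Y, ⟨k, some ⟨l, none⟩⟩ =>
    ⟨⟨(c k).1, (Y ⟨k, none⟩).1⟩, (Y ⟨k, none⟩).2.succAbove l⟩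
  | t + 1, _, ⟨_, c⟩, Y, ⟨k, some ⟨l, some e⟩⟩ =>
    edgeCheckSocket t 0 ((c k).2 l) (fun y => Y ⟨k, some ⟨l, y⟩⟩) e

/-! ### Combinatorics of the edges of a labeled tree -/

/-- The bound on `r` excludes the constant default value of `childSocket` for `r ≥ 2`. -/
lemma childSocket_injective {a r : ℕ} (hr : r ≤ 1) (j : Fin (a + 1)) :
    Function.Injective (childSocket r j) := by
  interval_cases r
  · exact Fin.succAbove_right_injective
  · exact Function.injective_id

lemma depthVar_root : ∀ (t r : ℕ) (T : PlaneTree p q t r), depthVar t r T (treeRoot t r T) = 0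
  | 0, _, _ => rfl
  | _ + 1, _, ⟨_, _⟩ => rfl

lemma eq_treeRoot_of_depthVar_eq_zero : ∀ (t r : ℕ) (T : PlaneTree p q t r) (x : TreeVar t r T),
    depthVar t r T x = 0 → x = treeRoot t r T
  | 0, _, _, _, _ => rfl
  | _ + 1, _, ⟨_, _⟩, none, _ => rfl
  | t + 1, _, ⟨_, c⟩, some ⟨k, l, x⟩, h => by simp [depthVar] at h

lemma depthVar_le (t : ℕ) : ∀ (r : ℕ) (T : PlaneTree p q t r) (x : TreeVar t r T),
    depthVar t r T x ≤ 4 * t := by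
  induction t with
  | zero => intro r T x; simp [depthVar]
  | succ t ih =>
    rintro r ⟨a, c⟩ (_ | ⟨k, l, x⟩)
    · exact Nat.zero_le _
    · have := ih 0 _ x
      simp only [depthVar]; omega

/-- Strictness, here and for edges, means that only variable nodes can lie on the boundary of the
ball of radius `4 t`. -/
lemma depthCheck_lt (t : ℕ) : ∀ (r : ℕ) (T : PlaneTree p q t r) (y : TreeCheck t r T),
    depthCheck t r T y < 4 * t := by
  induction t with
  | zero => rintro r T ⟨⟩
  | succ t ih =>
    rintro r ⟨a, c⟩ ⟨k, _ | ⟨l, y⟩⟩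
    · simp only [depthCheck]; omega
    · have := ih 0 _ y
      simp only [depthCheck]; omega

lemma depthEdge_lt (t : ℕ) : ∀ (r : ℕ) (T : PlaneTree p q t r) (e : TreeEdge t r T),
    depthEdge t r T e < 4 * t := by
  induction t with
  | zero => rintro r T ⟨⟩
  | succ t ih =>
    rintro r ⟨a, c⟩ ⟨k, _ | ⟨l, _ | e⟩⟩
    · simp only [depthEdge]; omega
    · simp only [depthEdge]; omega
    · have := ih 0 _ e
      simp only [depthEdge]; omega

/-- One end of an edge is one step closer to the top than its midpoint, the other one step
further away. -/
lemma depth_edge_ends (t : ℕ) : ∀ (r : ℕ) (T : PlaneTree p q t r) (e : TreeEdge t r T),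
    (depthVar t r T (edgeVar t r T e) + 1 = depthEdge t r T e ∧
      depthCheck t r T (edgeCheck t r T e) = depthEdge t r T e + 1) ∨
    (depthVar t r T (edgeVar t r T e) = depthEdge t r T e + 1 ∧
      depthCheck t r T (edgeCheck t r T e) + 1 = depthEdge t r T e) := by
  induction t with
  | zero => rintro r T ⟨⟩
  | succ t ih =>
    rintro r ⟨a, c⟩ ⟨k, _ | ⟨l, _ | e⟩⟩
    · left; constructor <;> rfl
    · right; simp [depthEdge, depthVar, depthCheck, edgeVar, edgeCheck, depthVar_root]
    · have := ih 0 _ e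
      simp only [depthEdge, depthVar, depthCheck, edgeVar, edgeCheck]; omega

/-- A variable node other than the top has an edge to its parent. -/
lemma exists_parent_edge_var (t : ℕ) : ∀ (r : ℕ) (T : PlaneTree p q t r) (x : TreeVar t r T),
    x ≠ treeRoot t r T → ∃ e, edgeVar t r T e = x ∧ depthEdge t r T e + 1 = depthVar t r T x := by
  induction t with
  | zero => rintro r T x h; exact absurd rfl h
  | succ t ih =>
    rintro r ⟨a, c⟩ (_ | ⟨k, l, x⟩) h
    · exact absurd rfl h
    · by_cases hx : x = treeRoot t 0 _
      · subst hx
        exact ⟨⟨k, some ⟨l, none⟩⟩, rfl, by simp [depthEdge, depthVar, depthVar_root]⟩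
      · obtain ⟨e, rfl, h2⟩ := ih 0 _ x hx
        exact ⟨⟨k, some ⟨l, some e⟩⟩, rfl, by simp only [depthEdge, depthVar]; omega⟩

lemma exists_parent_edge_check (t : ℕ) : ∀ (r : ℕ) (T : PlaneTree p q t r) (y : TreeCheck t r T),
    ∃ e, edgeCheck t r T e = y ∧ depthEdge t r T e + 1 = depthCheck t r T y := by
  induction t with
  | zero => rintro r T ⟨⟩
  | succ t ih =>
    rintro r ⟨a, c⟩ ⟨k, _ | ⟨l, y⟩⟩
    · exact ⟨⟨k, none⟩, rfl, rfl⟩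
    · obtain ⟨e, rfl, h2⟩ := ih 0 _ y
      exact ⟨⟨k, some ⟨l, some e⟩⟩, rfl, by simp only [depthEdge, depthCheck]; omega⟩

/-- The edge from a variable node to its parent is unique. -/
lemma parent_edge_var_unique (t : ℕ) : ∀ (r : ℕ) (T : PlaneTree p q t r) (e e' : TreeEdge t r T),
    edgeVar t r T e = edgeVar t r T e' → depthEdge t r T e < depthVar t r T (edgeVar t r T e) →
    depthEdge t r T e' < depthVar t r T (edgeVar t r T e') → e = e' := by
  induction t with
  | zero => rintro r T ⟨⟩
  | succ t ih =>
    rintro r ⟨a, c⟩ ⟨k, _ | ⟨l, _ | e⟩⟩ ⟨k', _ | ⟨l', _ | e'⟩⟩ h h1 h2 <;>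
      simp only [edgeVar, depthEdge, depthVar, reduceCtorEq, not_lt_zero] at h h1 h2
    · obtain ⟨rfl, h⟩ := Sigma.mk.inj (Option.some.inj h)
      obtain ⟨rfl, h⟩ := Sigma.mk.inj (eq_of_heq h)
      rfl
    · obtain ⟨rfl, h⟩ := Sigma.mk.inj (Option.some.inj h)
      obtain ⟨rfl, h⟩ := Sigma.mk.inj (eq_of_heq h)
      rw [← eq_of_heq h, depthVar_root] at h2
      omega
    · obtain ⟨rfl, h⟩ := Sigma.mk.inj (Option.some.inj h)
      obtain ⟨rfl, h⟩ := Sigma.mk.inj (eq_of_heq h)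
      rw [eq_of_heq h, depthVar_root] at h1
      omega
    · obtain ⟨rfl, h⟩ := Sigma.mk.inj (Option.some.inj h)
      obtain ⟨rfl, h⟩ := Sigma.mk.inj (eq_of_heq h)
      rw [ih 0 _ e e' (eq_of_heq h) (by omega) (by omega)]

lemma parent_edge_check_unique (t : ℕ) : ∀ (r : ℕ) (T : PlaneTree p q t r) (e e' : TreeEdge t r T),
    edgeCheck t r T e = edgeCheck t r T e' →
    depthEdge t r T e < depthCheck t r T (edgeCheck t r T e) →
    depthEdge t r T e' < depthCheck t r T (edgeCheck t r T e') → e = e' := by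
  induction t with
  | zero => rintro r T ⟨⟩
  | succ t ih =>
    rintro r ⟨a, c⟩ ⟨k, _ | ⟨l, _ | e⟩⟩ ⟨k', _ | ⟨l', _ | e'⟩⟩ h h1 h2 <;>
      simp only [edgeCheck, depthEdge, depthCheck] at h h1 h2 <;>
      obtain ⟨rfl, h⟩ := Sigma.mk.inj h <;> first | omega | skip
    · rfl
    · cases eq_of_heq h
    · cases eq_of_heq h
    · obtain ⟨rfl, h⟩ := Sigma.mk.inj (Option.some.inj (eq_of_heq h))
      rw [ih 0 _ e e' (eq_of_heq h) (by omega) (by omega)]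

lemma edgeVarSocket_fst (t : ℕ) : ∀ (r : ℕ) (T : PlaneTree p q t r) (X : VarLabel N t r T)
    (e : TreeEdge t r T),
    (edgeVarSocket t r T X e).1 = (varSocket X (edgeVar t r T e)).1 := by
  induction t with
  | zero => rintro r T X ⟨⟩
  | succ t ih =>
    rintro r ⟨a, c⟩ X ⟨k, _ | ⟨l, _ | e⟩⟩
    · rfl
    · rfl
    · exact ih 0 _ _ e

lemma edgeCheckSocket_fst (t : ℕ) : ∀ (r : ℕ) (T : PlaneTree p q t r) (Y : CheckLabel M t r T)
    (e : TreeEdge t r T),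
    (edgeCheckSocket t r T Y e).1 = (checkSocket Y (edgeCheck t r T e)).1 := by
  induction t with
  | zero => rintro r T X ⟨⟩
  | succ t ih =>
    rintro r ⟨a, c⟩ Y ⟨k, _ | ⟨l, _ | e⟩⟩
    · rfl
    · rfl
    · exact ih 0 _ _ e

/-- In a subtree no edge uses the socket of the top towards its parent. -/
lemma edgeVarSocket_ne_root (t : ℕ) (T : PlaneTree p q t 0) (X : VarLabel N t 0 T)
    (e : TreeEdge t 0 T) (h : edgeVar t 0 T e = treeRoot t 0 T) :
    edgeVarSocket t 0 T X e ≠ varSocket X (treeRoot t 0 T) := by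
  match t, T, X, e, h with
  | t + 1, ⟨a, c⟩, X, ⟨k, none⟩, h =>
    intro h'
    have h' : (⟨⟨a, (X none).1⟩, (X none).2.succAbove k⟩ : Socket (typedDeg N)) =
      ⟨⟨a, (X none).1⟩, (X none).2⟩ := h'
    exact Fin.succAbove_ne _ _ (eq_of_heq (Sigma.mk.inj h').2)
  | t + 1, ⟨a, c⟩, X, ⟨k, some ⟨l, none⟩⟩, h => cases h
  | t + 1, ⟨a, c⟩, X, ⟨k, some ⟨l, some e⟩⟩, h => cases h

/-- Distinct edges at a variable node have distinct sockets. -/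
lemma edgeVarSocket_locally_injective (t : ℕ) : ∀ (r : ℕ) (_ : r ≤ 1) (T : PlaneTree p q t r)
    (X : VarLabel N t r T) (e e' : TreeEdge t r T), edgeVar t r T e = edgeVar t r T e' →
    edgeVarSocket t r T X e = edgeVarSocket t r T X e' → e = e' := by
  induction t with
  | zero => rintro r _ T X ⟨⟩
  | succ t ih =>
    rintro r hr ⟨a, c⟩ X ⟨k, _ | ⟨l, _ | e⟩⟩ ⟨k', _ | ⟨l', _ | e'⟩⟩ h h1 <;>
      simp only [edgeVar, reduceCtorEq] at h
    · simp only [edgeVarSocket, Sigma.mk.injEq, heq_eq_eq, true_and] at h1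
      rw [childSocket_injective hr _ h1]
    · obtain ⟨rfl, h⟩ := Sigma.mk.inj (Option.some.inj h)
      obtain ⟨rfl, h⟩ := Sigma.mk.inj (eq_of_heq h)
      rfl
    · obtain ⟨rfl, h⟩ := Sigma.mk.inj (Option.some.inj h)
      obtain ⟨rfl, h⟩ := Sigma.mk.inj (eq_of_heq h)
      exact absurd h1.symm (edgeVarSocket_ne_root t _ _ e' (eq_of_heq h).symm)
    · obtain ⟨rfl, h⟩ := Sigma.mk.inj (Option.some.inj h)
      obtain ⟨rfl, h⟩ := Sigma.mk.inj (eq_of_heq h)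
      exact absurd h1 (edgeVarSocket_ne_root t _ _ e (eq_of_heq h))
    · obtain ⟨rfl, h⟩ := Sigma.mk.inj (Option.some.inj h)
      obtain ⟨rfl, h⟩ := Sigma.mk.inj (eq_of_heq h)
      rw [ih 0 zero_le_one _ _ e e' (eq_of_heq h) h1]

/-- Distinct edges at a check node have distinct sockets. -/
lemma edgeCheckSocket_locally_injective (t : ℕ) : ∀ (r : ℕ) (T : PlaneTree p q t r)
    (Y : CheckLabel M t r T) (e e' : TreeEdge t r T), edgeCheck t r T e = edgeCheck t r T e' →
    edgeCheckSocket t r T Y e = edgeCheckSocket t r T Y e' → e = e' := by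
  induction t with
  | zero => rintro r T X ⟨⟩
  | succ t ih =>
    rintro r ⟨a, c⟩ Y ⟨k, _ | ⟨l, _ | e⟩⟩ ⟨k', _ | ⟨l', _ | e'⟩⟩ h h1 <;>
      simp only [edgeCheck] at h <;>
      obtain ⟨rfl, h⟩ := Sigma.mk.inj h
    · rfl
    · simp only [edgeCheckSocket] at h1
      replace h1 := eq_of_heq (Sigma.mk.inj h1).2
      exact absurd h1.symm (Fin.succAbove_ne _ _)
    · cases eq_of_heq h
    · simp only [edgeCheckSocket] at h1
      replace h1 := eq_of_heq (Sigma.mk.inj h1).2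
      exact absurd h1 (Fin.succAbove_ne _ _)
    · simp only [edgeCheckSocket] at h1
      replace h1 := eq_of_heq (Sigma.mk.inj h1).2
      rw [Fin.succAbove_right_injective h1]
    · cases eq_of_heq h
    · cases eq_of_heq h
    · cases eq_of_heq h
    · obtain ⟨rfl, h⟩ := Sigma.mk.inj (Option.some.inj (eq_of_heq h))
      rw [ih 0 _ _ e e' (eq_of_heq h) h1]

/-- Every socket of a variable node above the last level is the socket of an edge, except for the
socket of the top of a subtree towards its parent. -/
lemma exists_edge_of_varSocket (t : ℕ) : ∀ (r : ℕ) (_ : r ≤ 1) (T : PlaneTree p q t r)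
    (X : VarLabel N t r T) (x : TreeVar t r T), depthVar t r T x < 4 * t →
    ∀ s : Socket (typedDeg N), s.1 = (varSocket X x).1 →
      (∃ e, edgeVar t r T e = x ∧ edgeVarSocket t r T X e = s) ∨
        (r = 0 ∧ x = treeRoot t r T ∧ s = varSocket X x) := by
  induction t with
  | zero => rintro r _ T X x h; simp at h
  | succ t ih =>
    rintro r hr ⟨a, c⟩ X (_ | ⟨k, l, x⟩) h ⟨v, j⟩ (rfl : v = _)
    · change Fin (a + 1) at j
      interval_cases r
      · by_cases hj : j = (X none).2
        · right; exact ⟨rfl, rfl, by subst hj; rfl⟩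
        · left
          obtain ⟨k, hk⟩ := Fin.exists_succAbove_eq hj
          exact ⟨⟨k, none⟩, rfl, by subst hk; rfl⟩
      · exact .inl ⟨⟨j, none⟩, rfl, rfl⟩
    · left
      rcases ih 0 zero_le_one _ (fun x => X (some ⟨k, l, x⟩)) x
        (by simp only [depthVar] at h; omega) ⟨_, j⟩ rfl with ⟨e, rfl, h2⟩ | ⟨-, rfl, h2⟩
      · exact ⟨⟨k, some ⟨l, some e⟩⟩, rfl, h2⟩
      · exact ⟨⟨k, some ⟨l, none⟩⟩, rfl, h2.symm⟩

/-- No exception occurs, unlike for the top of a subtree: a check node always has its parent edge in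
the tree, and its remaining sockets are enumerated by its children. -/
lemma exists_edge_of_checkSocket (t : ℕ) : ∀ (r : ℕ) (T : PlaneTree p q t r)
    (Y : CheckLabel M t r T) (y : TreeCheck t r T) (u : Socket (typedDeg M)),
    u.1 = (checkSocket Y y).1 →
      ∃ e, edgeCheck t r T e = y ∧ edgeCheckSocket t r T Y e = u := by
  induction t with
  | zero => rintro r T Y ⟨⟩
  | succ t ih =>
    rintro r ⟨a, c⟩ Y ⟨k, _ | ⟨l, y⟩⟩ ⟨v, j⟩ (rfl : v = _)
    · change Fin ((c k).1 + 1) at j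
      by_cases hj : j = (Y ⟨k, none⟩).2
      · exact ⟨⟨k, none⟩, rfl, by subst hj; rfl⟩
      · obtain ⟨l, hl⟩ := Fin.exists_succAbove_eq hj
        exact ⟨⟨k, some ⟨l, none⟩⟩, rfl, by subst hl; rfl⟩
    · obtain ⟨e, rfl, h2⟩ := ih 0 _ (fun y => Y ⟨k, some ⟨l, y⟩⟩) y ⟨_, j⟩ rfl
      exact ⟨⟨k, some ⟨l, some e⟩⟩, rfl, h2⟩

end Trees

/-! ### Computation trees, their labelings by sockets, and belief propagation on them. -/

section Labelings

variable {p q : ℕ} {N : Fin p → ℕ} {M : Fin q → ℕ}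

/-- The computation tree of the node of the socket `s`; for `r = 0` without the branch of `s`. -/
def compTree (π : Socket (typedDeg N) ≃ Socket (typedDeg M)) :
    ∀ t r : ℕ, Socket (typedDeg N) → PlaneTree p q t r
  | 0, _, s => s.1.1
  | t + 1, r, s => ⟨s.1.1, fun k =>
      ⟨(π ⟨s.1, childSocket r s.2 k⟩).1.1, fun l => compTree π t 0
        (π.symm ⟨(π ⟨s.1, childSocket r s.2 k⟩).1,
          (π ⟨s.1, childSocket r s.2 k⟩).2.succAbove l⟩)⟩⟩

/-- The edges of the labeled tree are edges of the Tanner graph. -/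
def Consistent (π : Socket (typedDeg N) ≃ Socket (typedDeg M)) {t r : ℕ} {T : PlaneTree p q t r}
    (X : VarLabel N t r T) (Y : CheckLabel M t r T) : Prop :=
  ∀ e, π (edgeVarSocket t r T X e) = edgeCheckSocket t r T Y e

variable {π : Socket (typedDeg N) ≃ Socket (typedDeg M)}

/-- The socket of the child `k` of the top. -/
lemma Consistent.check {t r : ℕ} {a : Fin p}
    {c : Fin (a + r) → Σ b : Fin q, (Fin b → PlaneTree p q t 0)}
    {X : VarLabel N (t + 1) r ⟨a, c⟩} {Y : CheckLabel M (t + 1) r ⟨a, c⟩}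
    (h : Consistent π X Y) (k : Fin (a + r)) :
    π ⟨⟨a, (X none).1⟩, childSocket r (X none).2 k⟩ = mkSocket M (c k).1 (Y ⟨k, none⟩) :=
  h ⟨k, none⟩

/-- The socket of the grandchild `l` below the child `k` of the top. -/
lemma Consistent.var {t r : ℕ} {a : Fin p}
    {c : Fin (a + r) → Σ b : Fin q, (Fin b → PlaneTree p q t 0)}
    {X : VarLabel N (t + 1) r ⟨a, c⟩} {Y : CheckLabel M (t + 1) r ⟨a, c⟩}
    (h : Consistent π X Y) (k : Fin (a + r)) (l : Fin (c k).1) :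
    π (varSocket (T := (c k).2 l) (fun x => X (some ⟨k, l, x⟩)) (treeRoot t 0 ((c k).2 l))) =
      ⟨⟨(c k).1, (Y ⟨k, none⟩).1⟩, (Y ⟨k, none⟩).2.succAbove l⟩ :=
  h ⟨k, some ⟨l, none⟩⟩

lemma Consistent.sub {t r : ℕ} {a : Fin p}
    {c : Fin (a + r) → Σ b : Fin q, (Fin b → PlaneTree p q t 0)}
    {X : VarLabel N (t + 1) r ⟨a, c⟩} {Y : CheckLabel M (t + 1) r ⟨a, c⟩}
    (h : Consistent π X Y) (k : Fin (a + r)) (l : Fin (c k).1) :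
    Consistent (T := (c k).2 l) π (fun x => X (some ⟨k, l, x⟩)) (fun y => Y ⟨k, some ⟨l, y⟩⟩) :=
  fun e => h ⟨k, some ⟨l, some e⟩⟩

/-- A consistently labeled tree is the computation tree of its top. -/
lemma Consistent.compTree_eq (t : ℕ) : ∀ {r : ℕ} {T : PlaneTree p q t r} {X : VarLabel N t r T}
    {Y : CheckLabel M t r T}, Consistent π X Y →
    compTree π t r (varSocket X (treeRoot t r T)) = T := by
  induction t with
  | zero => intros; rfl
  | succ t ih =>
    rintro r ⟨a, c⟩ X Y h
    change (⟨a, fun k => _⟩ : Σ a : Fin p, (Fin (a + r) → Σ b : Fin q, (Fin b → PlaneTree p q t 0)))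
      = ⟨a, c⟩
    congr 1
    funext k
    have hk := h.check k
    change (⟨(π ⟨⟨a, (X none).1⟩, childSocket r (X none).2 k⟩).1.1, fun l => compTree π t 0
        (π.symm ⟨(π ⟨⟨a, (X none).1⟩, childSocket r (X none).2 k⟩).1,
          (π ⟨⟨a, (X none).1⟩, childSocket r (X none).2 k⟩).2.succAbove l⟩)⟩ :
          Σ b : Fin q, (Fin b → PlaneTree p q t 0)) = c k
    rw [hk]
    change (⟨(c k).1, _⟩ : Σ b : Fin q, (Fin b → PlaneTree p q t 0)) = ⟨(c k).1, (c k).2⟩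
    congr 1
    funext l
    exact (congrArg (compTree π t 0) (π.symm_apply_eq.2 (h.var k l).symm)).trans (ih (h.sub k l))

/-- The labels of a tree are determined by the label of the top. -/
lemma Consistent.unique (t : ℕ) : ∀ {r : ℕ} {T : PlaneTree p q t r} {X X' : VarLabel N t r T}
    {Y Y' : CheckLabel M t r T}, Consistent π X Y → Consistent π X' Y' →
    X (treeRoot t r T) = X' (treeRoot t r T) → X = X' ∧ Y = Y' := by
  induction t with
  | zero => 
    intro r T X X' Y Y' h h' hr
    exact ⟨funext fun x => hr, funext fun y => y.elim⟩
  | succ t ih =>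
    rintro r ⟨a, c⟩ X X' Y Y' h h' hr
    change X none = X' none at hr
    have h0 : ∀ k, Y ⟨k, none⟩ = Y' ⟨k, none⟩ := by
      intro k
      have h1 := h.check k
      rw [hr, h'.check k] at h1
      simp only [Sigma.mk.injEq, heq_eq_eq, true_and] at h1
      exact Prod.ext h1.1.symm h1.2.symm
    have hs : ∀ k l, (fun x => X (some ⟨k, l, x⟩)) = (fun x => X' (some ⟨k, l, x⟩)) ∧
        (fun y => Y ⟨k, some ⟨l, y⟩⟩) = (fun y => Y' ⟨k, some ⟨l, y⟩⟩) := by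
      intro k l
      refine ih (h.sub k l) (h'.sub k l) ?_
      have h1 := h.var k l
      rw [h0 k, ← h'.var k l, π.apply_eq_iff_eq] at h1
      obtain ⟨h2, h3⟩ := Sigma.mk.inj h1
      exact Prod.ext (eq_of_heq (Sigma.mk.inj h2).2) (eq_of_heq h3)
    constructor
    · funext x
      rcases x with _ | ⟨k, l, x⟩
      · exact hr
      · exact congrFun (hs k l).1 x
    · funext y
      rcases y with ⟨k, _ | ⟨l, y⟩⟩
      · exact h0 k
      · exact congrFun (hs k l).2 y

/-- The computation tree is labeled. -/
lemma exists_consistent (π : Socket (typedDeg N) ≃ Socket (typedDeg M)) (t : ℕ) : ∀ (r : ℕ)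
    (s : Socket (typedDeg N)), ∃ (X : VarLabel N t r (compTree π t r s))
      (Y : CheckLabel M t r (compTree π t r s)), Consistent π X Y ∧
        varSocket X (treeRoot t r (compTree π t r s)) = s := by
  induction t with
  | zero => exact fun r s => ⟨fun _ => (s.1.2, s.2), fun y => y.elim, fun e => e.elim, rfl⟩
  | succ t ih =>
    intro r s
    choose X Y h hr using fun (k : Fin (s.1.1 + r))
      (l : Fin (π ⟨s.1, childSocket r s.2 k⟩).1.1) => ih 0 (π.symm ⟨_,
          (π ⟨s.1, childSocket r s.2 k⟩).2.succAbove l⟩)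
    refine ⟨fun x => match x with
      | none => (s.1.2, s.2)
      | some ⟨k, l, x⟩ => X k l x, fun y => match y with
      | ⟨k, none⟩ => ((π ⟨s.1, childSocket r s.2 k⟩).1.2, (π ⟨s.1, childSocket r s.2 k⟩).2)
      | ⟨k, some ⟨l, y⟩⟩ => Y k l y, ?_, rfl⟩
    rintro ⟨k, _ | ⟨l, _ | e⟩⟩
    · rfl
    · exact (congrArg π (hr k l)).trans (π.apply_symm_apply _)
    · exact h k l e

/-- Belief propagation in the Tanner graph is belief propagation in the computation tree. -/
lemma Consistent.treeErased_iff (e : (Σ a : Fin p, Fin (N a)) → Bool) (t : ℕ) :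
    ∀ {r : ℕ} {T : PlaneTree p q t r} {X : VarLabel N t r T}
    {Y : CheckLabel M t r T}, Consistent π X Y →
    (TreeErased t r T (fun x => e (varSocket X x).1) ↔
      e (varSocket X (treeRoot t r T)).1 = true ∧
      ∀ k, checkMsg π e t ⟨(varSocket X (treeRoot t r T)).1,
        childSocket r (varSocket X (treeRoot t r T)).2 k⟩) := by
  induction t with
  | zero => 
    intro r T X Y h
    exact ⟨fun h => ⟨h, fun _ => trivial⟩, fun h => h.1⟩
  | succ t ih =>
    rintro r ⟨a, c⟩ X Y h
    change (_ ∧ _) ↔ (_ ∧ _)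
    refine and_congr Iff.rfl (forall_congr' fun k => ?_)
    have hk := h.check k
    change _ ↔ ∃ s', (π s').1 = (π ⟨⟨a, (X none).1⟩, childSocket r (X none).2 k⟩).1 ∧
      s' ≠ ⟨⟨a, (X none).1⟩, childSocket r (X none).2 k⟩ ∧ varUpdate e (checkMsg π e t) s'
    -- A grandchild sends along its parent socket, and its own children sit at all the other sockets
    -- of its node; these are the sockets that `varUpdate` inspects.
    have key : ∀ l, TreeErased t 0 ((c k).2 l) (fun x => e (varSocket X (some ⟨k, l, x⟩)).1) ↔
        varUpdate e (checkMsg π e t) (π.symm ⟨⟨(c k).1, (Y ⟨k, none⟩).1⟩,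
          (Y ⟨k, none⟩).2.succAbove l⟩) := by
      intro l
      rw [← h.var k l, Equiv.symm_apply_apply]
      refine (ih (h.sub k l)).trans (and_congr Iff.rfl ?_)
      generalize varSocket (T := (c k).2 l) (fun x => X (some ⟨k, l, x⟩))
        (treeRoot t 0 ((c k).2 l)) = s
      obtain ⟨v, j⟩ := s
      constructor
      · rintro h ⟨v', j'⟩ (rfl : v' = v) hj
        obtain ⟨k, rfl⟩ := Fin.exists_succAbove_eq (x := j') (y := j) (by
          rintro rfl; exact hj rfl)
        exact h k
      · intro h k
        exact h ⟨v, j.succAbove k⟩ rfl fun h' =>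
          Fin.succAbove_ne _ _ (eq_of_heq (Sigma.mk.inj h').2)
    constructor
    · rintro ⟨l, hl⟩
      refine ⟨_, ?_, ?_, (key l).1 hl⟩
      · rw [hk, Equiv.apply_symm_apply]
      · rw [Ne, Equiv.symm_apply_eq, hk]
        exact fun h' => Fin.succAbove_ne _ _ (eq_of_heq (Sigma.mk.inj h').2)
    · rintro ⟨s', h1, h2, h3⟩
      obtain ⟨u, rfl⟩ := π.symm.surjective s'
      rw [Equiv.apply_symm_apply, hk] at h1
      rw [Ne, Equiv.symm_apply_eq, hk] at h2
      obtain ⟨v, j⟩ := u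
      obtain rfl : v = _ := h1
      obtain ⟨l, rfl⟩ := Fin.exists_succAbove_eq (y := (Y ⟨k, none⟩).2) (x := j) (by
          rintro rfl; exact h2 rfl)
      exact ⟨l, (key l).2 h3⟩

/-- For `r = 1` the children of the top occupy all sockets of its node. Repeated nodes do no harm,
since the pattern on the tree is pulled back from the graph. -/
lemma Consistent.bitErased_iff (e : (Σ a : Fin p, Fin (N a)) → Bool) {t : ℕ}
    {T : PlaneTree p q t 1} {X : VarLabel N t 1 T} {Y : CheckLabel M t 1 T}
    (h : Consistent π X Y) :
    BitErased π e t (varSocket X (treeRoot t 1 T)).1 ↔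
      TreeErased t 1 T (fun x => e (varSocket X x).1) := by
  rw [h.treeErased_iff]
  refine and_congr Iff.rfl ?_
  generalize (varSocket X (treeRoot t 1 T)) = s
  obtain ⟨v, j⟩ := s
  constructor
  · intro h k
    exact h _ rfl
  · rintro h ⟨v', j'⟩ (rfl : v' = v)
    exact h j'

end Labelings

/-! ### Locally injective maps from rooted trees, and acyclic balls. -/

section Covering

open SimpleGraph

/-- A graph with a depth function is acyclic if adjacent vertices have different depths and every
vertex has at most one neighbor of smaller depth. -/
lemma isAcyclic_of_depth {W : Type*} {H : SimpleGraph W} (dep : W → ℕ)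
    (hadj : ∀ x y, H.Adj x y → dep x = dep y + 1 ∨ dep y = dep x + 1)
    (huniq : ∀ x y y', H.Adj x y → H.Adj x y' → dep y + 1 = dep x → dep y' + 1 = dep x → y = y') :
    H.IsAcyclic := by
  intro v c hc
  -- At a vertex of maximal depth on the cycle both neighbors along the cycle have smaller depth. By
  -- `huniq` they coincide, which is impossible on a cycle.
  obtain ⟨w, hw, hmax⟩ := c.support.toFinset.exists_max_image dep ⟨v, by simp⟩
  simp only [List.mem_toFinset] at hw hmax
  have hc' := hc.rotate hw
  set c' := c.rotate w hw with hc'_def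
  have hmem : ∀ z ∈ c'.support, dep z ≤ dep w := fun z hz =>
    hmax z (by simpa [hc'_def] using hz)
  have h1 : H.Adj w c'.snd := c'.adj_snd hc'.not_nil
  have h2 : H.Adj w c'.penultimate := (c'.adj_penultimate hc'.not_nil).symm
  have h3 := hmem _ (c'.getVert_mem_support 1)
  have h4 := hmem _ (c'.getVert_mem_support (c'.length - 1))
  refine hc'.snd_ne_penultimate (huniq w _ _ h1 h2 ?_ ?_)
  · rcases hadj _ _ h1 with h | h
    · exact h.symm
    · change dep c'.snd ≤ _ at h3; omega
  · rcases hadj _ _ h2 with h | h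
    · exact h.symm
    · change dep c'.penultimate ≤ _ at h4; omega

/-- A locally injective homomorphism maps a path to a walk without backtracking. -/
lemma isChain_edges_map {W U : Type*} {H : SimpleGraph W} {G : SimpleGraph U} (Φ : H →g G)
    (hinj : ∀ x y y', H.Adj x y → H.Adj x y' → Φ y = Φ y' → y = y') {x y : W}
    (p : H.Walk x y) (hp : p.IsPath) : List.IsChain (· ≠ ·) (p.map Φ).edges := by
  induction p with
  | nil => simp
  | @cons x z y h p ih =>
    have ih := ih hp.of_cons
    cases p with
    | nil => simp
    | @cons _ w _ h' p =>
      simp only [Walk.map_cons, Walk.edges_cons] at ih ⊢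
      refine List.isChain_cons_cons.2 ⟨?_, ih⟩
      intro he
      rw [Sym2.eq_iff] at he
      -- Two consecutive edges with the same image either contain a collapsed edge, or fold back; in
      -- the latter case local injectivity makes the path itself return.
      rcases he with ⟨h1, _⟩ | ⟨h1, _⟩
      · exact (Φ.map_adj h).ne h1
      · have := hinj z x w h.symm h' h1
        subst this
        simp [Walk.cons_isPath_iff] at hp

/-- A locally injective homomorphism from a connected graph to an acyclic graph is injective. -/
lemma injective_of_locally_injective {W U : Type*} {H : SimpleGraph W} {G : SimpleGraph U}
    (Φ : H →g G) (hinj : ∀ x y y', H.Adj x y → H.Adj x y' → Φ y = Φ y' → y = y')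
    (hH : H.Preconnected) (hG : G.IsAcyclic) : Function.Injective Φ := by
  intro x y hxy
  obtain ⟨p, hp⟩ := (hH x y).exists_isPath
  -- In an acyclic graph a walk without backtracking is a path, and a path with equal ends has
  -- length zero.
  have hq := (hG.isPath_iff_isChain (p.map Φ)).2 (isChain_edges_map Φ hinj p hp)
  have h0 := hq.getVert_injOn (x₁ := 0) (x₂ := (p.map Φ).length) (by simp) (by simp)
    (by simpa using hxy)
  rw [Walk.length_map] at h0
  exact Walk.eq_of_length_eq_zero h0.symm

/-- A rooted tree of height at most `R` that locally covers the ball of radius `R` of a graph embeds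
if and only if the ball is acyclic. -/
theorem isAcyclic_ball_iff_injective {W U : Type*} {H : SimpleGraph W} {G : SimpleGraph U}
    (Φ : H →g G) (dep : W → ℕ) (root : W) (R : ℕ)
    (hroot : ∀ x, dep x = 0 → x = root) (hroot0 : dep root = 0)
    (hadj : ∀ x y, H.Adj x y → dep x = dep y + 1 ∨ dep y = dep x + 1)
    (hparent : ∀ x, x ≠ root → ∃ y, H.Adj x y ∧ dep y + 1 = dep x)
    (huniq : ∀ x y y', H.Adj x y → H.Adj x y' → dep y + 1 = dep x → dep y' + 1 = dep x → y = y')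
    (hle : ∀ x, dep x ≤ R)
    (hinj : ∀ x y y', H.Adj x y → H.Adj x y' → Φ y = Φ y' → y = y')
    (hsurj : ∀ x u, dep x < R → G.Adj (Φ x) u → ∃ y, H.Adj x y ∧ Φ y = u)
    (hlast : ∀ x y, G.Adj (Φ x) (Φ y) → dep x < R ∨ dep y < R) :
    (G.induce {u | ∃ p : G.Walk (Φ root) u, p.length ≤ R}).IsAcyclic ↔ Function.Injective Φ := by
  have hwalk : ∀ n x, dep x = n → ∃ p : H.Walk root x, p.length = n := by
    intro n
    induction n with
    | zero => rintro x hx; obtain rfl := hroot x hx; exact ⟨.nil, rfl⟩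
    | succ n ih =>
      intro x hx
      obtain ⟨y, hy, hd⟩ := hparent x (by rintro rfl; omega)
      obtain ⟨p, hp⟩ := ih y (by omega)
      exact ⟨p.concat hy.symm, by simp [hp]⟩
  -- Walks lift step by step. The depth grows by at most one per step, so the lift stays where
  -- `hsurj` applies.
  have hcov : ∀ (v u : U) (p : G.Walk v u) (x : W), Φ x = v → dep x + p.length ≤ R →
      ∃ y, Φ y = u := by
    intro v u p
    induction p with
    | nil => exact fun x hx _ => ⟨x, hx⟩
    | cons h p ih =>
      rintro x rfl hx
      rw [Walk.length_cons] at hx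
      obtain ⟨y, hy, hyu⟩ := hsurj x _ (by omega) h
      exact ih y hyu (by have := hadj _ _ hy; omega)
  constructor
  · intro hac
    -- The tree has height at most `R`, so its image lies in the ball and only the ball has to be
    -- acyclic.
    let Ψ : H →g G.induce {u | ∃ p : G.Walk (Φ root) u, p.length ≤ R} :=
      { toFun := fun x => ⟨Φ x, by
          obtain ⟨p, hp⟩ := hwalk _ x rfl
          exact ⟨p.map Φ, by rw [Walk.length_map, hp]; exact hle x⟩⟩
        map_rel' := fun h => Φ.map_adj h }
    have := injective_of_locally_injective Ψ
      (fun x y y' h h' he => hinj x y y' h h' (congrArg Subtype.val he))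
      (fun x y => by
        obtain ⟨p, -⟩ := hwalk _ x rfl
        obtain ⟨p', -⟩ := hwalk _ y rfl
        exact ⟨p.reverse.append p'⟩) hac
    intro x y hxy
    exact this (Subtype.ext hxy)
  · intro hΦ
    have hH : H.IsAcyclic := isAcyclic_of_depth dep hadj huniq
    have hex : ∀ u : {u | ∃ p : G.Walk (Φ root) u, p.length ≤ R}, ∃ x, Φ x = u := by
      rintro ⟨u, p, hp⟩
      exact hcov _ _ p root rfl (by omega)
    choose f hf using hex
    -- Preimages embed the ball into the tree. By `hlast` every edge of the ball has an end of depth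
    -- less than `R`, where it lifts; injectivity identifies the other end of the lift.
    refine hH.comap ⟨f, ?_⟩ ?_
    · intro u v huv
      have huv : G.Adj u v := huv
      rw [← hf u, ← hf v] at huv
      rcases hlast _ _ huv with h | h
      · obtain ⟨y, hy, he⟩ := hsurj _ _ h huv
        rwa [← hΦ he]
      · obtain ⟨y, hy, he⟩ := hsurj _ _ h huv.symm
        rw [← hΦ he]; exact hy.symm
    · intro u v huv
      exact Subtype.ext (by rw [← hf u, ← hf v]; exact congrArg Φ huv)

end Covering

/-! ### Cycle-free neighborhoods are those without a repeated node in the computation tree. -/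

section CycleFree

variable {p q : ℕ} {N : Fin p → ℕ} {M : Fin q → ℕ}

/-- The graph with midpoints of edges of a bipartite multigraph. -/
def subdivision {A B E : Type} (f : E → A) (g : E → B) : SimpleGraph (A ⊕ B ⊕ E) :=
  SimpleGraph.fromRel fun x y =>
    match x, y with
    | .inl v, .inr (.inr s) => f s = v
    | .inr (.inl c), .inr (.inr s) => g s = c
    | _, _ => False

lemma subdivision_adj {A B E : Type} (f : E → A) (g : E → B) (x y : A ⊕ B ⊕ E) :
    (subdivision f g).Adj x y ↔
      (∃ e, x = .inr (.inr e) ∧ (y = .inl (f e) ∨ y = .inr (.inl (g e)))) ∨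
      (∃ e, y = .inr (.inr e) ∧ (x = .inl (f e) ∨ x = .inr (.inl (g e)))) := by
  rcases x with x | x | x <;> rcases y with y | y | y <;>
    simp [subdivision, SimpleGraph.fromRel_adj, eq_comm]

lemma tannerGraph_adj {V K : Type} {dV : V → ℕ} {dC : K → ℕ} (π : Socket dV ≃ Socket dC)
    (x y : V ⊕ K ⊕ Socket dV) : (tannerGraph π).Adj x y ↔
      (∃ s : Socket dV, x = .inr (.inr s) ∧ (y = .inl s.1 ∨ y = .inr (.inl (π s).1))) ∨
      (∃ s : Socket dV, y = .inr (.inr s) ∧ (x = .inl s.1 ∨ x = .inr (.inl (π s).1))) := by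
  rcases x with x | x | x <;> rcases y with y | y | y <;>
    simp [tannerGraph, SimpleGraph.fromRel_adj, eq_comm]

variable {π : Socket (typedDeg N) ≃ Socket (typedDeg M)}

/-- Equal sockets belong to the same node of the graph, hence to the same node of the tree when
nothing is repeated, and there local injectivity applies. -/
lemma edgeVarSocket_injective {t r : ℕ} (hr : r ≤ 1) {T : PlaneTree p q t r} {X : VarLabel N t r T}
    (hX : Function.Injective fun x => (varSocket X x).1) :
    Function.Injective (edgeVarSocket t r T X) := by
  intro e e' h
  refine edgeVarSocket_locally_injective t r hr T X e e' (hX ?_) h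
  simp only [← edgeVarSocket_fst, h]

lemma edgeCheckSocket_injective {t r : ℕ} {T : PlaneTree p q t r} {Y : CheckLabel M t r T}
    (hY : Function.Injective fun y => (checkSocket Y y).1) :
    Function.Injective (edgeCheckSocket t r T Y) := by
  intro e e' h
  refine edgeCheckSocket_locally_injective t r T Y e e' (hY ?_) h
  simp only [← edgeCheckSocket_fst, h]

/-- The neighborhood of a variable node is cycle-free if and only if no node occurs twice in the
computation tree. -/
theorem Consistent.cycleFree_iff {t : ℕ} {T : PlaneTree p q t 1} {X : VarLabel N t 1 T}
    {Y : CheckLabel M t 1 T} (h : Consistent π X Y) :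
    CycleFree π t (varSocket X (treeRoot t 1 T)).1 ↔
      Function.Injective (fun x => (varSocket X x).1) ∧
        Function.Injective (fun y => (checkSocket Y y).1) := by
  -- `H` is the tree with midpoints on its edges, `φ` is given by the labels and names an edge by
  -- its variable socket, and `dep` is the distance from the top.
  let H := subdivision (edgeVar t 1 T) (edgeCheck t 1 T)
  let φ := Sum.map (fun x => (varSocket X x).1)
    (Sum.map (fun y => (checkSocket Y y).1) (edgeVarSocket t 1 T X))
  let dep := Sum.elim (depthVar t 1 T) (Sum.elim (depthCheck t 1 T) (depthEdge t 1 T))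
  have hC : ∀ e, (π (edgeVarSocket t 1 T X e)).1 = (checkSocket Y (edgeCheck t 1 T e)).1 := by
    intro e; rw [h e, edgeCheckSocket_fst]
  let Φ : H →g tannerGraph π := ⟨φ, by
    intro x y hxy
    rw [subdivision_adj] at hxy
    rw [tannerGraph_adj]
    rcases hxy with ⟨e, rfl, rfl | rfl⟩ | ⟨e, rfl, rfl | rfl⟩
    · exact .inl ⟨_, rfl, .inl (congrArg _ (edgeVarSocket_fst ..).symm)⟩
    · exact .inl ⟨_, rfl, .inr (congrArg (fun z => Sum.inr (Sum.inl z)) (hC e).symm)⟩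
    · exact .inr ⟨_, rfl, .inl (congrArg _ (edgeVarSocket_fst ..).symm)⟩
    · exact .inr ⟨_, rfl, .inr (congrArg (fun z => Sum.inr (Sum.inl z)) (hC e).symm)⟩⟩
  have key := isAcyclic_ball_iff_injective Φ dep (.inl (treeRoot t 1 T)) (4 * t) ?_ ?_ ?_ ?_ ?_ ?_
    ?_ ?_ ?_
  · refine Iff.trans key ⟨fun hi => ⟨fun x y hxy => ?_, fun x y hxy => ?_⟩, fun hi => ?_⟩
    · exact Sum.inl_injective (hi (a₁ := .inl x) (a₂ := .inl y) (congrArg Sum.inl hxy))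
    · exact Sum.inl_injective (Sum.inr_injective (hi (a₁ := .inr (.inl x)) (a₂ := .inr (.inl y))
        (congrArg (fun z => Sum.inr (Sum.inl z)) hxy)))
    · exact hi.1.sumMap (hi.2.sumMap (edgeVarSocket_injective le_rfl hi.1))
  · rintro (x | x | x) hx
    · rw [eq_treeRoot_of_depthVar_eq_zero _ _ _ x hx]
    · obtain ⟨e, -, he⟩ := exists_parent_edge_check t 1 T x
      change depthCheck t 1 T x = 0 at hx
      omega
    · have := depth_edge_ends t 1 T x
      change depthEdge t 1 T x = 0 at hx
      omega
  · exact depthVar_root _ _ _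
  · intro x y hxy
    rw [subdivision_adj] at hxy
    rcases hxy with ⟨e, rfl, rfl | rfl⟩ | ⟨e, rfl, rfl | rfl⟩ <;>
    · have := depth_edge_ends t 1 T e
      simp only [dep, Sum.elim_inl, Sum.elim_inr]
      omega
  · rintro (x | x | x) hx
    · obtain ⟨e, rfl, he⟩ := exists_parent_edge_var t 1 T x fun hx' => hx (by rw [hx'])
      exact ⟨.inr (.inr e), (subdivision_adj ..).2 (.inr ⟨e, rfl, .inl rfl⟩), he⟩
    · obtain ⟨e, rfl, he⟩ := exists_parent_edge_check t 1 T x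
      exact ⟨.inr (.inr e), (subdivision_adj ..).2 (.inr ⟨e, rfl, .inr rfl⟩), he⟩
    · rcases depth_edge_ends t 1 T x with hd | hd
      · exact ⟨.inl _, (subdivision_adj ..).2 (.inl ⟨x, rfl, .inl rfl⟩), hd.1⟩
      · exact ⟨.inr (.inl _), (subdivision_adj ..).2 (.inl ⟨x, rfl, .inr rfl⟩), hd.2⟩
  · intro x y y' h1 h2 hd hd'
    rw [subdivision_adj] at h1 h2
    rcases h1 with ⟨e, rfl, h1⟩ | ⟨e, rfl, h1⟩ <;> rcases h2 with ⟨e', he, h2⟩ | ⟨e', rfl, h2⟩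
    · obtain rfl : e = e' := by simpa using he
      have := depth_edge_ends t 1 T e
      rcases h1 with rfl | rfl <;> rcases h2 with rfl | rfl <;> first
        | rfl
        | (simp only [dep, Sum.elim_inl, Sum.elim_inr] at hd hd'; omega)
    · simp at h2
    · subst he; simp at h1
    · rcases h1 with rfl | rfl <;> simp only [reduceCtorEq, or_false, false_or, Sum.inl.injEq,
        Sum.inr.injEq] at h2 <;>
        simp only [dep, Sum.elim_inl, Sum.elim_inr] at hd hd'
      · rw [parent_edge_var_unique t 1 T e e' h2 (by omega) (by rw [← h2]; omega)]
      · rw [parent_edge_check_unique t 1 T e e' h2 (by omega) (by rw [← h2]; omega)]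
  · rintro (x | x | x)
    · exact depthVar_le _ _ _ _
    · exact (depthCheck_lt _ _ _ _).le
    · exact (depthEdge_lt _ _ _ _).le
  · intro x y y' h1 h2 he
    rw [subdivision_adj] at h1 h2
    rcases h1 with ⟨e, rfl, h1⟩ | ⟨e, rfl, h1⟩ <;> rcases h2 with ⟨e', he', h2⟩ | ⟨e', rfl, h2⟩
    · obtain rfl : e = e' := by simpa using he'
      rcases h1 with rfl | rfl <;> rcases h2 with rfl | rfl <;> first
        | rfl
        | simp [Φ, φ] at he
    · simp at h2
    · subst he'; simp at h1
    · have he : edgeVarSocket t 1 T X e = edgeVarSocket t 1 T X e' := by simpa [Φ, φ] using he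
      rcases h1 with rfl | rfl <;> simp only [reduceCtorEq, or_false, false_or, Sum.inl.injEq,
        Sum.inr.injEq] at h2
      · rw [edgeVarSocket_locally_injective t 1 le_rfl T X e e' h2 he]
      · rw [edgeCheckSocket_locally_injective t 1 T Y e e' h2 (by rw [← h e, ← h e', he])]
  · intro x u hx hu
    rw [tannerGraph_adj] at hu
    rcases x with x | x | x
    · rcases hu with ⟨s, hs, -⟩ | ⟨s, rfl, hs⟩
      · cases hs
      · have hs : s.1 = (varSocket X x).1 := by
          rcases hs with hs | hs
          · exact (Sum.inl_injective hs).symm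
          · cases hs
        rcases exists_edge_of_varSocket t 1 le_rfl T X x hx s hs with ⟨e, rfl, rfl⟩ | ⟨h0, -⟩
        · exact ⟨.inr (.inr e), (subdivision_adj ..).2 (.inr ⟨e, rfl, .inl rfl⟩), rfl⟩
        · cases h0
    · rcases hu with ⟨s, hs, -⟩ | ⟨s, rfl, hs⟩
      · cases hs
      · have hs : (π s).1 = (checkSocket Y x).1 := by
          rcases hs with hs | hs
          · cases hs
          · exact (Sum.inl_injective (Sum.inr_injective hs)).symm
        obtain ⟨e, rfl, he⟩ := exists_edge_of_checkSocket t 1 T Y x (π s) hs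
        refine ⟨.inr (.inr e), (subdivision_adj ..).2 (.inr ⟨e, rfl, .inr rfl⟩), ?_⟩
        rw [← h e, π.apply_eq_iff_eq] at he
        rw [← he]; rfl
    · rcases hu with ⟨s, hs, hu⟩ | ⟨s, rfl, hs⟩
      · obtain rfl := (Sum.inr_injective (Sum.inr_injective hs))
        rcases hu with rfl | rfl
        · exact ⟨.inl _, (subdivision_adj ..).2 (.inl ⟨x, rfl, .inl rfl⟩),
            congrArg _ (edgeVarSocket_fst ..).symm⟩
        · exact ⟨.inr (.inl _), (subdivision_adj ..).2 (.inl ⟨x, rfl, .inr rfl⟩),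
            congrArg (fun z => Sum.inr (Sum.inl z)) (hC x).symm⟩
      · rcases hs with hs | hs <;> cases hs
  -- Only variable nodes can have depth `4 t`, and two of them are never adjacent in the subdivided
  -- graph.
  · intro x y hxy
    rw [tannerGraph_adj] at hxy
    rcases x with x | x | x
    · rcases y with y | y | y
      · rcases hxy with ⟨s, hs, -⟩ | ⟨s, hs, -⟩ <;> cases hs
      · exact .inr (depthCheck_lt _ _ _ _)
      · exact .inr (depthEdge_lt _ _ _ _)
    · exact .inl (depthCheck_lt _ _ _ _)
    · exact .inl (depthEdge_lt _ _ _ _)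

end CycleFree

/-! ### Counting Tanner graphs with a given cycle-free computation tree. -/

section Counting

/-- The number of bijections that extend an injective partial assignment. -/
lemma card_equiv_extending {ι α β : Type} [Fintype ι] [Fintype α] [Fintype β]
    (hcard : Fintype.card α = Fintype.card β) (f : ι → α) (g : ι → β)
    (hf : Function.Injective f) (hg : Function.Injective g) :
    Fintype.card {π : α ≃ β // ∀ i, π (f i) = g i} =
      (Fintype.card α - Fintype.card ι).factorial := by
  let e₀ : Set.range f ≃ Set.range g := (Equiv.ofInjective f hf).symm.trans (Equiv.ofInjective g hg)
  have he₀ : ∀ i, (e₀ ⟨f i, i, rfl⟩ : β) = g i := by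
    intro i
    change (Equiv.ofInjective g hg ((Equiv.ofInjective f hf).symm (Equiv.ofInjective f hf i)) : β) = _
    rw [Equiv.symm_apply_apply]
    rfl
  have e₁ : {π : α ≃ β // ∀ i, π (f i) = g i} ≃ {π : α ≃ β // ∀ x : Set.range f, π x = e₀ x} :=
    Equiv.subtypeEquivRight fun π => ⟨fun h => by rintro ⟨_, i, rfl⟩; exact (h i).trans (he₀ i).symm,
      fun h i => (h ⟨f i, i, rfl⟩).trans (he₀ i)⟩
  have hα : Fintype.card ((Set.range f)ᶜ : Set α) = Fintype.card α - Fintype.card ι := by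
    rw [Fintype.card_compl_set, Set.card_range_of_injective hf]
  have hβ : Fintype.card ((Set.range g)ᶜ : Set β) = Fintype.card α - Fintype.card ι := by
    rw [Fintype.card_compl_set, Set.card_range_of_injective hg, hcard]
  have e₂ : ((Set.range f)ᶜ : Set α) ≃ ((Set.range g)ᶜ : Set β) :=
    Fintype.equivOfCardEq (hα.trans hβ.symm)
  rw [Fintype.card_congr (e₁.trans (Equiv.Set.compl e₀)), Fintype.card_equiv e₂, hα]

/-- The number of ways to label distinct nodes by distinct sockets of distinct nodes of the right
type. -/
lemma card_injective_labels {p : ℕ} {ι : Type} [Fintype ι] (N : Fin p → ℕ) (τ : ι → Fin p) :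
    Fintype.card {X : ∀ i, Fin (N (τ i)) × Fin (τ i + 1) //
        Function.Injective fun i => (⟨τ i, (X i).1⟩ : Σ a, Fin (N a))} =
      ∏ a, (N a).descFactorial (Fintype.card {i // τ i = a}) *
        (a + 1) ^ Fintype.card {i // τ i = a} := by
  let e₁ : {X : ∀ i, Fin (N (τ i)) × Fin (τ i + 1) //
      Function.Injective fun i => (⟨τ i, (X i).1⟩ : Σ a, Fin (N a))} ≃
      {m : ∀ i, Fin (N (τ i)) // Function.Injective fun i => (⟨τ i, m i⟩ : Σ a, Fin (N a))} ×
        ∀ i, Fin (τ i + 1) :=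
    { toFun := fun X => (⟨fun i => (X.1 i).1, X.2⟩, fun i => (X.1 i).2)
      invFun := fun z => ⟨fun i => (z.1.1 i, z.2 i), z.1.2⟩
      left_inv := fun _ => rfl
      right_inv := fun _ => rfl }
  -- Nodes of different types are distinct anyway, so injectivity is a condition for each type
  -- separately and the labeling is a family of embeddings.
  let e₂ : {m : ∀ i, Fin (N (τ i)) // Function.Injective fun i => (⟨τ i, m i⟩ : Σ a, Fin (N a))} ≃
      ∀ a, ({i // τ i = a} ↪ Fin (N a)) :=
    { toFun := fun m a => ⟨fun i => Fin.cast (congrArg N i.2) (m.1 i.1), by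
        rintro ⟨i, rfl⟩ ⟨j, hj⟩ h
        refine Subtype.ext (m.2 (Sigma.ext hj.symm ?_))
        exact (Fin.heq_ext_iff (congrArg N hj.symm)).2 (Fin.ext_iff.1 h)⟩
      invFun := fun f => ⟨fun i => f (τ i) ⟨i, rfl⟩, by
        intro i j h
        have key : ∀ a b (x : {i // τ i = a}) (y : {i // τ i = b}),
            (⟨a, f a x⟩ : Σ a, Fin (N a)) = ⟨b, f b y⟩ → x.1 = y.1 := by
          rintro a b x y h
          obtain ⟨rfl, h⟩ := Sigma.mk.inj h
          rw [(f a).injective (eq_of_heq h)]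
        exact key _ _ _ _ h⟩
      left_inv := fun _ => rfl
      right_inv := fun f => by
        funext a
        ext ⟨i, rfl⟩
        rfl }
  rw [Fintype.card_congr (e₁.trans (e₂.prodCongr (Equiv.refl _))), Fintype.card_prod,
    Fintype.card_pi, Fintype.card_pi, Finset.prod_mul_distrib]
  congr 1
  · refine Finset.prod_congr rfl fun a _ => ?_
    rw [Fintype.card_embedding_eq, Fintype.card_fin]
  · simp only [Fintype.card_fin]
    rw [← Finset.prod_fiberwise' Finset.univ τ (fun a : Fin p => (a : ℕ) + 1)]
    refine Finset.prod_congr rfl fun a _ => ?_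
    rw [Finset.prod_const, Fintype.card_subtype]

variable {p q : ℕ}

lemma card_varType (t : ℕ) (a : Fin p) : ∀ (r : ℕ) (T : PlaneTree p q t r),
    Fintype.card {x // varType t r T x = a} = numVar (a + 1) t r T := by
  simp only [Fintype.card_subtype, Finset.card_filter]
  induction t with
  | zero =>
    intro r (T : Fin p)
    change ∑ x : Unit, _ = _
    simp only [varType, numVar, add_left_inj]
    rw [Fintype.sum_unique]
    exact if_congr Fin.val_inj.symm rfl rfl
  | succ t ih =>
    rintro r ⟨a', c⟩
    change ∑ x : Option (Σ k : Fin (a' + r), Σ l : Fin (c k).1, TreeVar t 0 ((c k).2 l)), _ = _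
    rw [Fintype.sum_option, Fintype.sum_sigma]
    simp only [Fintype.sum_sigma, numVar, add_left_inj, Fin.val_inj, ← ih]
    rfl

lemma card_checkType (t : ℕ) (b : Fin q) : ∀ (r : ℕ) (T : PlaneTree p q t r),
    Fintype.card {y // checkType t r T y = b} = numCheck (b + 1) t r T := by
  simp only [Fintype.card_subtype, Finset.card_filter]
  induction t with
  | zero =>
    intro r T
    change ∑ x : Empty, _ = _
    simp [numCheck]
  | succ t ih =>
    rintro r ⟨a', c⟩
    change ∑ x : (Σ k : Fin (a' + r), Option (Σ l : Fin (c k).1, TreeCheck t 0 ((c k).2 l))), _ = _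
    rw [Fintype.sum_sigma]
    simp only [Fintype.sum_option, Fintype.sum_sigma, numCheck, add_left_inj, Fin.val_inj, ← ih]
    rfl

lemma card_treeEdge (t : ℕ) : ∀ (r : ℕ) (T : PlaneTree p q t r),
    Fintype.card (TreeEdge t r T) = numEdges t r T := by
  induction t with
  | zero => intro r T; exact Fintype.card_empty
  | succ t ih =>
    rintro r ⟨a', c⟩
    change Fintype.card (Σ k : Fin (a' + r),
      Option (Σ l : Fin (c k).1, Option (TreeEdge t 0 ((c k).2 l)))) = _
    simp only [Fintype.card_sigma, Fintype.card_option, ih, numEdges, add_comm]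

/-- A tree has one more node than edges. -/
lemma sum_numVar_add_sum_numCheck (t : ℕ) : ∀ (r : ℕ) (T : PlaneTree p q t r),
    ∑ a : Fin p, numVar (a + 1) t r T + ∑ b : Fin q, numCheck (b + 1) t r T =
      numEdges t r T + 1 := by
  induction t with
  | zero =>
    intro r (T : Fin p)
    have : ∀ a : Fin p, ((T : ℕ) = (a : ℕ)) = (T = a) := fun a => propext Fin.val_inj
    simp only [numVar, numCheck, numEdges, add_left_inj, this]
    simp
  | succ t ih =>
    rintro r ⟨a, c⟩
    have h1 : ∑ a' : Fin p, numVar (a' + 1) (t + 1) r (⟨a, c⟩ : PlaneTree p q (t + 1) r) =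
        1 + ∑ k, ∑ l, ∑ a' : Fin p, numVar (a' + 1) t 0 ((c k).2 l) := by
      simp only [numVar, Finset.sum_add_distrib, add_left_inj, Fin.val_inj]
      rw [Finset.sum_comm]
      congr 1
      · simp
      · exact Finset.sum_congr rfl fun k _ => Finset.sum_comm
    have h2 : ∑ b : Fin q, numCheck (b + 1) (t + 1) r (⟨a, c⟩ : PlaneTree p q (t + 1) r) =
        ∑ k, (1 + ∑ l, ∑ b : Fin q, numCheck (b + 1) t 0 ((c k).2 l)) := by
      simp only [numCheck, add_left_inj, Fin.val_inj]
      rw [Finset.sum_comm]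
      refine Finset.sum_congr rfl fun k _ => ?_
      rw [Finset.sum_add_distrib]
      congr 1
      · simp
      · exact Finset.sum_comm
    rw [h1, h2]
    simp only [numEdges]
    rw [add_assoc, ← Finset.sum_add_distrib, add_comm]
    congr 1
    refine Finset.sum_congr rfl fun k _ => ?_
    rw [add_left_comm, ← Finset.sum_add_distrib]
    congr 1
    refine Finset.sum_congr rfl fun l _ => ?_
    rw [ih, add_comm]

variable {N : Fin p → ℕ} {M : Fin q → ℕ}

/-- The number of labelings of a tree without repeated nodes. -/
def numLabels (N : Fin p → ℕ) (M : Fin q → ℕ) {t r : ℕ} (T : PlaneTree p q t r) : ℕ :=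
  (∏ a : Fin p, (N a).descFactorial (numVar (a + 1) t r T) * (a + 1) ^ numVar (a + 1) t r T) *
  ∏ b : Fin q, (M b).descFactorial (numCheck (b + 1) t r T) * (b + 1) ^ numCheck (b + 1) t r T

/-- The number of Tanner graphs and root sockets with a given cycle-free computation tree. -/
theorem card_compTree_eq
    (hcard : Fintype.card (Socket (typedDeg N)) = Fintype.card (Socket (typedDeg M)))
    {t : ℕ} (T : PlaneTree p q t 1) :
    Fintype.card {z : (Socket (typedDeg N) ≃ Socket (typedDeg M)) × Socket (typedDeg N) //
        compTree z.1 t 1 z.2 = T ∧ CycleFree z.1 t z.2.1} =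
      numLabels N M T * (Fintype.card (Socket (typedDeg N)) - numEdges t 1 T).factorial := by
  let A := {X : VarLabel N t 1 T // Function.Injective fun x => (varSocket X x).1}
  let B := {Y : CheckLabel M t 1 T // Function.Injective fun y => (checkSocket Y y).1}
  -- A Tanner graph with a root socket corresponds to labels without repetition and a bijection
  -- extending the partial assignment that they prescribe. The labels are determined by the label of
  -- the top, and the computation tree always has labels.
  let F : (Σ z : A × B, {π : Socket (typedDeg N) ≃ Socket (typedDeg M) //
      ∀ e, π (edgeVarSocket t 1 T z.1.1 e) = edgeCheckSocket t 1 T z.2.1 e}) →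
      {z : (Socket (typedDeg N) ≃ Socket (typedDeg M)) × Socket (typedDeg N) //
        compTree z.1 t 1 z.2 = T ∧ CycleFree z.1 t z.2.1} :=
    fun w => ⟨(w.2.1, varSocket w.1.1.1 (treeRoot t 1 T)),
      Consistent.compTree_eq t (Y := w.1.2.1) w.2.2,
      (Consistent.cycleFree_iff (Y := w.1.2.1) w.2.2).2 ⟨w.1.1.2, w.1.2.2⟩⟩
  have hF : Function.Bijective F := by
    constructor
    · rintro ⟨⟨⟨X, hX⟩, ⟨Y, hY⟩⟩, ⟨π, hπ⟩⟩ ⟨⟨⟨X', hX'⟩, ⟨Y', hY'⟩⟩, ⟨π', hπ'⟩⟩ h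
      obtain ⟨rfl, h2⟩ := Prod.mk.inj (Subtype.mk.inj h)
      obtain ⟨h3, h4⟩ := Sigma.mk.inj h2
      obtain ⟨rfl, rfl⟩ := Consistent.unique t (Y := Y) (Y' := Y') hπ hπ'
        (Prod.ext (eq_of_heq (Sigma.mk.inj h3).2) (eq_of_heq h4))
      rfl
    · rintro ⟨⟨π, s⟩, rfl, h⟩
      obtain ⟨X, Y, hc, hs⟩ := exists_consistent π t 1 s
      have h' := hc.cycleFree_iff.1 (by rw [hs]; exact h)
      exact ⟨⟨(⟨X, h'.1⟩, ⟨Y, h'.2⟩), ⟨π, hc⟩⟩, Subtype.ext (Prod.ext rfl hs)⟩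
  have hfib : ∀ z : A × B, Fintype.card {π : Socket (typedDeg N) ≃ Socket (typedDeg M) //
      ∀ e, π (edgeVarSocket t 1 T z.1.1 e) = edgeCheckSocket t 1 T z.2.1 e} =
      (Fintype.card (Socket (typedDeg N)) - numEdges t 1 T).factorial := by
    intro z
    have := card_equiv_extending hcard _ _ (edgeVarSocket_injective le_rfl z.1.2)
      (edgeCheckSocket_injective z.2.2)
    rw [card_treeEdge] at this
    convert this
  have hA : Fintype.card A = ∏ a : Fin p, (N a).descFactorial (numVar (a + 1) t 1 T) *
      (a + 1) ^ numVar (a + 1) t 1 T := by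
    simp only [← card_varType]
    exact card_injective_labels N (varType t 1 T)
  have hB : Fintype.card B = ∏ b : Fin q, (M b).descFactorial (numCheck (b + 1) t 1 T) *
      (b + 1) ^ numCheck (b + 1) t 1 T := by
    simp only [← card_checkType]
    exact card_injective_labels M (checkType t 1 T)
  rw [← Fintype.card_of_bijective hF, Fintype.card_sigma, Finset.sum_congr rfl fun z _ => hfib z,
    Finset.sum_const, Finset.card_univ, Fintype.card_prod, hA, hB, smul_eq_mul]
  rfl

/-- The sum over all Tanner graphs and roots with a cycle-free neighborhood of a function of the
computation tree. -/
theorem sum_cycleFree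
    (hcard : Fintype.card (Socket (typedDeg N)) = Fintype.card (Socket (typedDeg M)))
    {t : ℕ} (g : (Socket (typedDeg N) ≃ Socket (typedDeg M)) → (Σ a, Fin (N a)) → ℝ)
    (h : PlaneTree p q t 1 → ℝ)
    (hgh : ∀ π (T : PlaneTree p q t 1) (X : VarLabel N t 1 T) (Y : CheckLabel M t 1 T),
      Consistent π X Y → Function.Injective (fun x => (varSocket X x).1) →
      g π (varSocket X (treeRoot t 1 T)).1 = h T) :
    ∑ π : Socket (typedDeg N) ≃ Socket (typedDeg M), ∑ v, (if CycleFree π t v then g π v else 0) =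
      ∑ T : PlaneTree p q t 1, h T / (varType t 1 T (treeRoot t 1 T) + 1 : ℝ) *
        (numLabels N M T * (Fintype.card (Socket (typedDeg N)) - numEdges t 1 T).factorial) := by
  -- Roots are replaced by root sockets: a node of degree `i` has `i` sockets, each with weight `1 /
  -- i`.
  have h1 : ∀ π : Socket (typedDeg N) ≃ Socket (typedDeg M),
      ∑ v, (if CycleFree π t v then g π v else 0) =
      ∑ s : Socket (typedDeg N), (if CycleFree π t s.1 then g π s.1 else 0) / (s.1.1 + 1 : ℝ) := by
    intro π
    refine Eq.symm ((Fintype.sum_sigma _).trans (Finset.sum_congr rfl fun v _ => ?_))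
    simp only [Finset.sum_const, Finset.card_univ, Fintype.card_fin, nsmul_eq_mul]
    push_cast
    field_simp
  have h2 : ∀ (π : Socket (typedDeg N) ≃ Socket (typedDeg M)) (s : Socket (typedDeg N)),
      (if CycleFree π t s.1 then g π s.1 else 0) / (s.1.1 + 1 : ℝ) =
      if CycleFree π t s.1 then h (compTree π t 1 s) /
        (varType t 1 _ (treeRoot t 1 (compTree π t 1 s)) + 1 : ℝ) else 0 := by
    intro π s
    split_ifs with hc
    · obtain ⟨X, Y, hXY, hs⟩ := exists_consistent π t 1 s
      have hi := (hXY.cycleFree_iff.1 (by rw [hs]; exact hc)).1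
      have h3 := hgh π _ X Y hXY hi
      rw [hs] at h3
      rw [h3]
      have : varType t 1 _ (treeRoot t 1 (compTree π t 1 s)) = s.1.1 := by
        conv_rhs => rw [← hs]
        rfl
      rw [this]
    · simp
  simp_rw [h1, h2]
  let f : (Socket (typedDeg N) ≃ Socket (typedDeg M)) × Socket (typedDeg N) → ℝ := fun z =>
    if CycleFree z.1 t z.2.1 then h (compTree z.1 t 1 z.2) /
        (varType t 1 _ (treeRoot t 1 (compTree z.1 t 1 z.2)) + 1 : ℝ) else 0
  refine (Fintype.sum_prod_type f).symm.trans ?_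
  rw [← Finset.sum_fiberwise Finset.univ (fun z => compTree z.1 t 1 z.2) f]
  simp only [f]
  refine Finset.sum_congr rfl fun T _ => ?_
  rw [← Nat.cast_mul, ← card_compTree_eq hcard T, ← Finset.sum_filter, Finset.filter_filter,
    Fintype.card_subtype, mul_comm, ← nsmul_eq_mul, ← Finset.sum_const]
  refine Finset.sum_congr rfl fun z hz => ?_
  rw [← (Finset.mem_filter.1 hz).2.1]

end Counting

/-! ### Independence of erasures at distinct nodes. -/

section Marginals

lemma sum_patternProb {A : Type} [Fintype A] (ε : ℝ) : ∑ e : A → Bool, patternProb ε e = 1 := by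
  simp only [patternProb]
  rw [← Fintype.prod_sum (fun (_ : A) (b : Bool) => if b = true then ε else 1 - ε)]
  simp

/-- A pattern on a disjoint union is a pair of patterns, and its probability is the product. -/
lemma sum_patternProb_sum {A B : Type} [Fintype A] [Fintype B] [DecidableEq (A ⊕ B)] (ε : ℝ) (g : (A → Bool) → ℝ)
    (h : (B → Bool) → ℝ) :
    ∑ e : A ⊕ B → Bool, patternProb ε e * (g (e ∘ Sum.inl) * h (e ∘ Sum.inr)) =
      (∑ e, patternProb ε e * g e) * ∑ e, patternProb ε e * h e := by
  rw [Finset.sum_mul_sum, ← Fintype.sum_prod_type',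
    ← (Equiv.sumArrowEquivProdArrow A B Bool).symm.sum_comp]
  refine Finset.sum_congr rfl fun z _ => ?_
  have h1 : ((Equiv.sumArrowEquivProdArrow A B Bool).symm z) ∘ Sum.inl = z.1 := rfl
  have h2 : ((Equiv.sumArrowEquivProdArrow A B Bool).symm z) ∘ Sum.inr = z.2 := rfl
  have h3 : patternProb ε ((Equiv.sumArrowEquivProdArrow A B Bool).symm z) =
      patternProb ε z.1 * patternProb ε z.2 := by
    simp only [patternProb, Fintype.prod_sum_type]
    rfl
  rw [h1, h2, h3]
  ring

lemma sum_patternProb_equiv {A B : Type} [Fintype A] [Fintype B] (ε : ℝ) (φ : B ≃ A)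
    (g : (B → Bool) → ℝ) :
    ∑ e : A → Bool, patternProb ε e * g (e ∘ φ) = ∑ e, patternProb ε e * g e := by
  rw [← (Equiv.arrowCongr φ (Equiv.refl Bool)).sum_comp]
  refine Finset.sum_congr rfl fun e _ => ?_
  congr 1
  · simp only [patternProb]
    rw [← φ.prod_comp]
    simp
  · congr 1
    ext x
    simp

/-- The erasures at some of the positions have the same distribution as in isolation. -/
lemma sum_patternProb_comp {A B : Type} [Fintype A] [Fintype B] (ε : ℝ) (φ : B → A)
    (hφ : Function.Injective φ) (g : (B → Bool) → ℝ) :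
    ∑ e : A → Bool, patternProb ε e * g (e ∘ φ) = ∑ e, patternProb ε e * g e := by
  -- The positions outside the image of `φ` carry the constant function `1`, which sums to one.
  let ψ : B ⊕ {a // a ∉ Set.range φ} ≃ A :=
    (Equiv.sumCongr (Equiv.ofInjective φ hφ) (Equiv.refl _)).trans (Equiv.sumCompl (· ∈ Set.range φ))
  have h := sum_patternProb_equiv ε ψ (fun e => g (e ∘ Sum.inl) * (fun _ => 1) (e ∘ Sum.inr))
  have h' := h.trans
    (@sum_patternProb_sum _ _ _ _ (fun _ _ => Classical.propDecidable _) ε g fun _ => 1)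
  have hψ : ψ ∘ Sum.inl = φ := funext fun b => by simp [ψ]
  simpa only [mul_one, sum_patternProb, Function.comp_assoc, hψ] using h'

variable {p q : ℕ} {N : Fin p → ℕ} {M : Fin q → ℕ}

/-- The error probability of a root with a cycle-free neighborhood. -/
lemma Consistent.graphErrorProb_eq {π : Socket (typedDeg N) ≃ Socket (typedDeg M)} (ε : ℝ) {t : ℕ}
    {T : PlaneTree p q t 1} {X : VarLabel N t 1 T} {Y : CheckLabel M t 1 T}
    (h : Consistent π X Y) (hX : Function.Injective fun x => (varSocket X x).1) :
    graphErrorProb π ε t (varSocket X (treeRoot t 1 T)).1 = treeErrorProb ε t 1 T := by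
  rw [graphErrorProb, treeErrorProb, ← sum_patternProb_comp ε _ hX]
  refine Finset.sum_congr rfl fun e _ => ?_
  rw [if_congr (h.bitErased_iff e) rfl rfl]
  rfl

end Marginals

/-! ### The recursion for the erasure probability of a tree. -/

section TreeErrorProb

lemma univ_eq_univ {α : Type*} (i j : Fintype α) : @Finset.univ α i = @Finset.univ α j := by
  rw [Subsingleton.elim i j]

/-- Independence over the parts of a disjoint union. -/
lemma sum_patternProb_sigma {ι : Type} {A : ι → Type} [Fintype ι] [∀ i, Fintype (A i)]
    [DecidableEq (Σ i, A i)] (ε : ℝ) (g : ∀ i, (A i → Bool) → ℝ) :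
    ∑ e : (Σ i, A i) → Bool, patternProb ε e * ∏ i, g i (fun x => e ⟨i, x⟩) =
      ∏ i, ∑ e : A i → Bool, patternProb ε e * g i e := by
  rw [Fintype.prod_sum, ← (Equiv.piCurry fun (i : ι) (_ : A i) => Bool).sum_comp]
  refine Finset.sum_congr rfl fun e _ => ?_
  rw [Finset.prod_mul_distrib]
  congr 1
  simp only [patternProb]
  rw [Fintype.prod_sigma]
  rfl

/-- Independence of the top and the rest. -/
lemma sum_patternProb_option {A : Type} [Fintype A] [DecidableEq (Option A)] (ε : ℝ)
    (g : (A → Bool) → ℝ) :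
    ∑ e : Option A → Bool, patternProb ε e * ((if e none = true then 1 else 0) *
      g (fun x => e (some x))) = ε * ∑ e : A → Bool, patternProb ε e * g e := by
  have h1 := sum_patternProb_equiv ε (Equiv.optionEquivSumPUnit A)
    (fun e => (if e none = true then 1 else 0) * g (fun x => e (some x)))
  have h2 := @sum_patternProb_sum A PUnit _ _ (fun _ _ => Classical.propDecidable _) ε g
    (fun e => if e PUnit.unit = true then 1 else 0)
  have h3 : ∀ i : Fintype (PUnit → Bool), ∑ e ∈ @Finset.univ _ i,
      patternProb ε e * (if e PUnit.unit = true then (1 : ℝ) else 0) = ε := by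
    intro i
    rw [← (Equiv.funUnique PUnit Bool).symm.sum_comp]
    simp [patternProb]
  rw [h3, mul_comm _ ε] at h2
  rw [← h2]
  refine Eq.trans ?_ (h1.symm.trans (Finset.sum_congr ?_ fun e _ => ?_))
  · exact Finset.sum_congr (univ_eq_univ _ _) fun e _ => rfl
  · exact univ_eq_univ _ _
  · rw [mul_comm (g _)]; rfl

variable {p q : ℕ}

lemma treeErrorProb_zero (ε : ℝ) (r : ℕ) (T : PlaneTree p q 0 r) :
    treeErrorProb ε 0 r T = ε := by
  have h : ∑ e : Unit → Bool, patternProb ε e * (if e () = true then (1 : ℝ) else 0) = ε := by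
    rw [← (Equiv.funUnique Unit Bool).symm.sum_comp]
    simp [patternProb]
  refine Eq.trans ?_ h
  exact Finset.sum_congr (univ_eq_univ _ _) fun e _ => by congr!

/-- The branches involve disjoint sets of erasures. A check node sends a known bit exactly when none
of its children sends an erasure, whence the inner product of `1 - P`. -/
lemma treeErrorProb_succ (ε : ℝ) (t r : ℕ) (a : Fin p)
    (c : Fin (a + r) → Σ b : Fin q, (Fin b → PlaneTree p q t 0)) :
    treeErrorProb ε (t + 1) r ⟨a, c⟩ =
      ε * ∏ k, (1 - ∏ l, (1 - treeErrorProb ε t 0 ((c k).2 l))) := by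
  let I : ∀ k l, (TreeVar t 0 ((c k).2 l) → Bool) → ℝ := fun k l e =>
    if TreeErased t 0 ((c k).2 l) e then 1 else 0
  let g : ((Σ k : Fin (a + r), Σ l : Fin (c k).1, TreeVar t 0 ((c k).2 l)) → Bool) → ℝ :=
    fun e => ∏ k, (1 - ∏ l, (1 - I k l fun x => e ⟨k, l, x⟩))
  have h1 : treeErrorProb ε (t + 1) r (⟨a, c⟩ : PlaneTree p q (t + 1) r) =
      ∑ e : Option (Σ k : Fin (a + r), Σ l : Fin (c k).1, TreeVar t 0 ((c k).2 l)) → Bool,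
        patternProb ε e * ((if e none = true then 1 else 0) * g (fun x => e (some x))) := by
    refine Finset.sum_congr (univ_eq_univ _ _) fun e _ => ?_
    congr 1
    have hk : ∀ k, (1 - ∏ l, (1 - I k l fun x => e (some ⟨k, l, x⟩))) =
        if ∃ l, TreeErased t 0 ((c k).2 l) fun x => e (some ⟨k, l, x⟩) then 1 else 0 := by
      intro k
      split_ifs with h
      · obtain ⟨l, hl⟩ := h
        rw [Finset.prod_eq_zero (Finset.mem_univ l) (by simp [I, hl]), sub_zero]
      · push Not at h
        rw [Finset.prod_eq_one fun l _ => by simp [I, h l], sub_self]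
    simp only [g, hk]
    rw [Finset.prod_boole, ite_zero_mul_ite_zero, mul_one]
    have hT : (e none = true ∧ ∀ k ∈ Finset.univ,
        ∃ l, TreeErased t 0 ((c k).2 l) fun x => e (some ⟨k, l, x⟩)) ↔
        TreeErased (t + 1) r (⟨a, c⟩ : PlaneTree p q (t + 1) r) e := by
      simp only [Finset.mem_univ, forall_true_left]
      rfl
    by_cases h : TreeErased (t + 1) r (⟨a, c⟩ : PlaneTree p q (t + 1) r) e
    · rw [if_pos h, if_pos (hT.2 h)]
    · rw [if_neg h, if_neg (mt hT.1 h)]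
  have h2 : ∀ i : Fintype ((Σ k : Fin (a + r), Σ l : Fin (c k).1, TreeVar t 0 ((c k).2 l)) → Bool),
      ∑ e ∈ @Finset.univ _ i, patternProb ε e * g e =
      ∏ k, (1 - ∏ l, (1 - treeErrorProb ε t 0 ((c k).2 l))) := by
    intro i
    refine (Finset.sum_congr (univ_eq_univ _ _) fun e _ => rfl).trans <|
      (sum_patternProb_sigma ε fun (k : Fin (a + r))
      (e : (Σ l : Fin (c k).1, TreeVar t 0 ((c k).2 l)) → Bool) =>
        1 - ∏ l, (1 - I k l fun x => e ⟨l, x⟩)).trans (Finset.prod_congr rfl fun k _ => ?_)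
    simp only [mul_sub, mul_one, Finset.sum_sub_distrib, sum_patternProb]
    congr 1
    refine (Finset.sum_congr (univ_eq_univ _ _) fun e _ => rfl).trans ((sum_patternProb_sigma ε
      fun (l : Fin (c k).1)
      (e : TreeVar t 0 ((c k).2 l) → Bool) => 1 - I k l e).trans
        (Finset.prod_congr rfl fun l _ => ?_))
    simp only [mul_sub, mul_one, Finset.sum_sub_distrib, sum_patternProb]
    rfl
  rw [h1, sum_patternProb_option, h2]

end TreeErrorProb

/-! ### Generating functions of additive weights over all trees and over erased trees. -/

section GeneratingFunctions

variable {p q : ℕ}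

/-- The total weight of a tree: variable nodes of type `a` have weight `u a`, check nodes of type
`b` have weight `v b`, and all variable nodes below the top have additional weight `z`. -/
def treeWeight (u : Fin p → ℕ) (v : Fin q → ℕ) (z : ℕ) : ∀ t r : ℕ, PlaneTree p q t r → ℕ
  | 0, _, a => u a
  | t + 1, _, ⟨a, c⟩ => u a + ∑ k, (v (c k).1 + ∑ l, (z + treeWeight u v z t 0 ((c k).2 l)))

/-- Each edge is charged to its lower end: to a check node through `v = 1`, to a variable node below
the top through `z = 1`. -/
lemma numEdges_eq_treeWeight (t : ℕ) : ∀ (r : ℕ) (T : PlaneTree p q t r),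
    numEdges t r T = treeWeight (fun _ => 0) (fun _ => 1) 1 t r T := by
  induction t with
  | zero => intros; rfl
  | succ t ih =>
    rintro r ⟨a, c⟩
    simp only [numEdges, treeWeight, ih, zero_add]

lemma numVar_eq_treeWeight (i t : ℕ) : ∀ (r : ℕ) (T : PlaneTree p q t r),
    numVar i t r T = treeWeight (fun a => if (a : ℕ) + 1 = i then 1 else 0) (fun _ => 0) 0 t r T := by
  induction t with
  | zero => intros; rfl
  | succ t ih =>
    rintro r ⟨a, c⟩
    simp only [numVar, treeWeight, ih, zero_add]

lemma numCheck_eq_treeWeight (j t : ℕ) : ∀ (r : ℕ) (T : PlaneTree p q t r),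
    numCheck j t r T =
      treeWeight (fun _ => 0) (fun b => if (b : ℕ) + 1 = j then 1 else 0) 0 t r T := by
  induction t with
  | zero => intros; rfl
  | succ t ih =>
    rintro r ⟨a, c⟩
    simp only [numCheck, treeWeight, ih, zero_add]

/-- The generating function of the offspring of a node whose type `a` has probability `w (a + 1)`
and weight `u a`, at the generating function `f` of a child. -/
def offspring (w : ℕ → ℝ) (u : Fin p → ℕ) (r : ℕ) (f : ℝ[X]) : ℝ[X] :=
  ∑ a : Fin p, C (w (a + 1)) * X ^ u a * f ^ ((a : ℕ) + r)

variable (lam rho : ℝ[X]) (ε : ℝ) (u : Fin p → ℕ) (v : Fin q → ℕ) (z : ℕ)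

/-- The weight generating function of the branch of a check node. -/
def branchGF : ℕ → ℝ[X]
  | 0 => 1
  | t + 1 => offspring (edgeFrac rho) v 0 (X ^ z * offspring (edgeFrac lam) u 0 (branchGF t))

/-- The weight generating function of the branch of a check node that sends an erasure. -/
def erasedBranchGF : ℕ → ℝ[X]
  | 0 => 1
  | t + 1 => branchGF lam rho u v z (t + 1) - offspring (edgeFrac rho) v 0
      (X ^ z * (offspring (edgeFrac lam) u 0 (branchGF lam rho u v z t)
        - C ε * offspring (edgeFrac lam) u 0 (erasedBranchGF t)))

/-- Distributivity, used twice: a sum over all families of children is a power of the sum over one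
child, below the top as well as below each check node. -/
lemma sum_treeProb_succ (w : ℕ → ℝ) (t r : ℕ) (m : PlaneTree p q t 0 → ℝ[X]) :
    ∑ a : Fin p, ∑ c : Fin (a + r) → Σ b : Fin q, (Fin b → PlaneTree p q t 0),
      C (w (a + 1)) * X ^ u a * ∏ k, (C (edgeFrac rho ((c k).1 + 1)) * X ^ v (c k).1 *
        ∏ l, m ((c k).2 l)) =
    offspring w u r (offspring (edgeFrac rho) v 0 (∑ T, m T)) := by
  refine Finset.sum_congr rfl fun a _ => ?_
  rw [← Finset.mul_sum]
  congr 1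
  rw [← Fintype.prod_sum (fun (_ : Fin (a + r)) (c : Σ b : Fin q, (Fin b → PlaneTree p q t 0)) =>
    C (edgeFrac rho (c.1 + 1)) * X ^ v c.1 * ∏ l, m (c.2 l)), Finset.prod_const, Finset.card_univ,
    Fintype.card_fin]
  congr 1
  rw [Fintype.sum_sigma]
  refine Finset.sum_congr rfl fun b _ => ?_
  dsimp only
  rw [← Finset.mul_sum, ← Fintype.prod_sum (fun (_ : Fin b) T => m T), Finset.prod_const,
    Finset.card_univ, Fintype.card_fin, add_zero]

/-- The weight generating function of the trees. -/
lemma sum_treeProb_weight (t : ℕ) : ∀ (r : ℕ) (w : ℕ → ℝ),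
    ∑ T : PlaneTree p q t r, C (treeProb lam rho t r w T) * X ^ treeWeight u v z t r T =
      offspring w u r (branchGF lam rho u v z t) := by
  induction t with
  | zero =>
    intro r w
    simp only [offspring, branchGF, one_pow, mul_one]
    rfl
  | succ t ih =>
    intro r w
    rw [branchGF, ← ih 0 (edgeFrac lam), Finset.mul_sum, ← sum_treeProb_succ]
    refine (Fintype.sum_sigma _).trans (Finset.sum_congr rfl fun a _ =>
      Finset.sum_congr rfl fun c _ => ?_)
    simp only [treeProb, treeWeight, pow_add, C_mul, ← Finset.prod_pow_eq_pow_sum, map_prod,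
      Finset.prod_mul_distrib]
    ring

/-- The weight generating function of the trees with an erased top. -/
lemma sum_treeProb_weight_error (t : ℕ) : ∀ (r : ℕ) (w : ℕ → ℝ),
    ∑ T : PlaneTree p q t r, C (treeProb lam rho t r w T) * X ^ treeWeight u v z t r T *
        C (treeErrorProb ε t r T) =
      C ε * offspring w u r (erasedBranchGF lam rho ε u v z t) := by
  induction t with
  | zero =>
    intro r w
    simp only [offspring, erasedBranchGF, one_pow, mul_one, treeErrorProb_zero]
    rw [← Finset.sum_mul, mul_comm]
    rfl
  | succ t ih =>
    intro r w
    let m : PlaneTree p q t 0 → ℝ[X] := fun T =>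
      X ^ z * (C (treeProb lam rho t 0 (edgeFrac lam) T) * X ^ treeWeight u v z t 0 T)
    -- `m'` also carries the probability that the subtree sends no erasure. Thus `∏ m - ∏ m'` is the
    -- contribution of a check node that sends an erasure.
    let m' : PlaneTree p q t 0 → ℝ[X] := fun T => m T * (1 - C (treeErrorProb ε t 0 T))
    have hm : ∑ T, m T = X ^ z * offspring (edgeFrac lam) u 0 (branchGF lam rho u v z t) := by
      rw [← sum_treeProb_weight lam rho u v z t 0, Finset.mul_sum]
    have hm' : ∑ T, m' T = X ^ z * (offspring (edgeFrac lam) u 0 (branchGF lam rho u v z t)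
        - C ε * offspring (edgeFrac lam) u 0 (erasedBranchGF lam rho ε u v z t)) := by
      rw [← sum_treeProb_weight lam rho u v z t 0, ← ih, ← Finset.sum_sub_distrib, Finset.mul_sum]
      refine Finset.sum_congr rfl fun T _ => ?_
      simp only [m, m']
      ring
    have h1 : ∀ (a : Fin p) (c : Fin (a + r) → Σ b : Fin q, (Fin b → PlaneTree p q t 0)),
        C (treeProb lam rho (t + 1) r w ⟨a, c⟩) * X ^ treeWeight u v z (t + 1) r ⟨a, c⟩ *
          C (treeErrorProb ε (t + 1) r ⟨a, c⟩) =
        C ε * (C (w (a + 1)) * X ^ u a * ∏ k, (C (edgeFrac rho ((c k).1 + 1)) * X ^ v (c k).1 *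
          (∏ l, m ((c k).2 l) - ∏ l, m' ((c k).2 l)))) := by
      intro a c
      have h2 : ∀ k, (∏ l, m ((c k).2 l) - ∏ l, m' ((c k).2 l)) = (∏ l, m ((c k).2 l)) *
          (1 - ∏ l, (1 - C (treeErrorProb ε t 0 ((c k).2 l)))) := by
        intro k
        simp only [m', Finset.prod_mul_distrib]
        ring
      simp only [h2]
      simp only [m, treeErrorProb_succ, treeProb, treeWeight, pow_add, C_mul,
        ← Finset.prod_pow_eq_pow_sum, map_prod, Finset.prod_mul_distrib, C_sub, C_1]
      ring
    have h3 : ∀ (a : Fin p), ∑ c : Fin (a + r) → Σ b : Fin q, (Fin b → PlaneTree p q t 0),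
        ∏ k, (C (edgeFrac rho ((c k).1 + 1)) * X ^ v (c k).1 *
          (∏ l, m ((c k).2 l) - ∏ l, m' ((c k).2 l))) =
        (offspring (edgeFrac rho) v 0 (∑ T, m T) -
          offspring (edgeFrac rho) v 0 (∑ T, m' T)) ^ (a + r : ℕ) := by
      intro a
      rw [← Fintype.prod_sum (fun (_ : Fin (a + r))
        (c : Σ b : Fin q, (Fin b → PlaneTree p q t 0)) => C (edgeFrac rho (c.1 + 1)) * X ^ v c.1 *
          (∏ l, m (c.2 l) - ∏ l, m' (c.2 l))), Finset.prod_const, Finset.card_univ,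
        Fintype.card_fin]
      congr 1
      rw [Fintype.sum_sigma, offspring, offspring, ← Finset.sum_sub_distrib]
      refine Finset.sum_congr rfl fun b _ => ?_
      dsimp only
      rw [← Finset.mul_sum, Finset.sum_sub_distrib, ← Fintype.prod_sum (fun (_ : Fin b) T => m T),
        ← Fintype.prod_sum (fun (_ : Fin b) T => m' T), Finset.prod_const, Finset.prod_const,
        Finset.card_univ, Fintype.card_fin, add_zero, mul_sub]
    rw [erasedBranchGF, branchGF, ← hm', ← hm]
    refine (Fintype.sum_sigma _).trans ?_
    simp only [h1, ← Finset.mul_sum, h3]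
    rfl

end GeneratingFunctions

/-! ### Calculus of first and second derivatives of polynomials. -/

section Jets

lemma d1_mul (f g : ℝ[X]) (x : ℝ) :
    d1 (f * g) x = d1 f x * g.eval x + f.eval x * d1 g x := by
  simp [d1]

lemma d2_mul (f g : ℝ[X]) (x : ℝ) :
    d2 (f * g) x = d2 f x * g.eval x + 2 * d1 f x * d1 g x + f.eval x * d2 g x := by
  simp [d1, d2]; ring

lemma d1_comp (f g : ℝ[X]) (x : ℝ) : d1 (f.comp g) x = d1 f (g.eval x) * d1 g x := by
  simp [d1, derivative_comp, eval_comp]; ring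

lemma d2_comp (f g : ℝ[X]) (x : ℝ) :
    d2 (f.comp g) x = d2 f (g.eval x) * d1 g x ^ 2 + d1 f (g.eval x) * d2 g x := by
  simp [d1, d2, derivative_comp, eval_comp]; ring

lemma d1_add (f g : ℝ[X]) (x : ℝ) : d1 (f + g) x = d1 f x + d1 g x := by simp [d1]
lemma d2_add (f g : ℝ[X]) (x : ℝ) : d2 (f + g) x = d2 f x + d2 g x := by simp [d2]
lemma d1_sub (f g : ℝ[X]) (x : ℝ) : d1 (f - g) x = d1 f x - d1 g x := by simp [d1]
lemma d2_sub (f g : ℝ[X]) (x : ℝ) : d2 (f - g) x = d2 f x - d2 g x := by simp [d2]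
lemma d1_C (c x : ℝ) : d1 (C c) x = 0 := by simp [d1]
lemma d2_C (c x : ℝ) : d2 (C c) x = 0 := by simp [d2]
lemma d1_one (x : ℝ) : d1 1 x = 0 := by simp [d1]
lemma d2_one (x : ℝ) : d2 1 x = 0 := by simp [d2]
lemma d1_X (x : ℝ) : d1 X x = 1 := by simp [d1]
lemma d2_X (x : ℝ) : d2 X x = 0 := by simp [d2]

lemma d1_pow (f : ℝ[X]) (n : ℕ) (x : ℝ) :
    d1 (f ^ n) x = n * f.eval x ^ (n - 1) * d1 f x := by
  simp [d1, derivative_pow]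

lemma d2_sum {ι : Type*} (s : Finset ι) (f : ι → ℝ[X]) (x : ℝ) :
    d2 (∑ i ∈ s, f i) x = ∑ i ∈ s, d2 (f i) x := by
  simp [d2, eval_finsetSum]

/-- The second derivative at `1` reads off a second factorial moment from a weight generating
function. -/
lemma d2_C_mul_X_pow_mul_C (a b : ℝ) (n : ℕ) :
    d2 (C a * X ^ n * C b) 1 = a * ((n : ℝ) * ((n : ℝ) - 1) * b) := by
  rcases n with _ | n
  · simp [d2]
  · simp [d2, derivative_X_pow]; ring

end Jets

/-! ### Offspring generating functions in terms of the degree distributions. -/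

section Offspring

variable (P f : ℝ[X])

lemma offspring_zero :
    offspring (p := P.natDegree + 1) (edgeFrac P) (fun _ => 0) 0 f = P.comp f := by
  rw [comp, eval₂_eq_sum_range, offspring,
    Finset.sum_range (fun i => C (P.coeff i) * f ^ i)]
  simp [edgeFrac]

lemma offspring_one :
    offspring (p := P.natDegree + 1) (edgeFrac P) (fun _ => 1) 0 f = X * P.comp f := by
  rw [← offspring_zero, offspring, offspring, Finset.mul_sum]
  exact Finset.sum_congr rfl fun a _ => by ring

/-- On the marked type write `X = 1 + (X - 1)`: marking adds a term that vanishes at `1` but has a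
derivative there. The hypothesis `hw` covers degrees beyond the largest label. -/
lemma offspring_indicator {p : ℕ} (w : ℕ → ℝ) (r i : ℕ) (hw : p < i → w i = 0) (hi : 1 ≤ i) :
    offspring (p := p) w (fun a => if (a : ℕ) + 1 = i then 1 else 0) r f =
      offspring (p := p) w (fun _ => 0) r f + C (w i) * (X - 1) * f ^ (i - 1 + r) := by
  have h : ∀ a : Fin p, C (w (a + 1)) * X ^ (if (a : ℕ) + 1 = i then 1 else 0) * f ^ ((a : ℕ) + r) =
      C (w (a + 1)) * X ^ 0 * f ^ ((a : ℕ) + r) +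
        if (a : ℕ) + 1 = i then C (w i) * (X - 1) * f ^ (i - 1 + r) else 0 := by
    intro a
    split_ifs with h
    · subst h
      simp only [Nat.add_sub_cancel]
      ring
    · simp
  simp only [offspring, h, Finset.sum_add_distrib]
  congr 1
  by_cases hp : i ≤ p
  · rw [Finset.sum_eq_single (⟨i - 1, by omega⟩ : Fin p)]
    · rw [if_pos (by simp; omega)]
    · intro a _ ha
      rw [if_neg]
      rintro rfl
      exact ha (by simp)
    · simp
  · rw [hw (by omega)]
    simp

lemma edgeFrac_eq_zero {i : ℕ} (hi : P.natDegree + 1 < i) : edgeFrac P i = 0 :=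
  coeff_eq_zero_of_natDegree_lt (by omega)

lemma nodeFrac_eq_zero {i : ℕ} (hi : P.natDegree + 1 < i) : nodeFrac P i = 0 := by
  rw [nodeFrac, edgeFrac_eq_zero P hi]
  simp

lemma offspring_nodeFrac :
    offspring (p := P.natDegree + 1) (nodeFrac P) (fun _ => 0) 1 f = (nodePoly P).comp f := by
  rw [nodePoly, Polynomial.sum_comp, offspring, ← Finset.Ico_add_one_right_eq_Icc,
    Finset.sum_Ico_eq_sum_range, Nat.add_sub_cancel]
  refine Eq.trans ?_ (Fin.sum_univ_eq_sum_range
    (fun i => (C (nodeFrac P (1 + i)) * X ^ (1 + i)).comp f) _)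
  simp [add_comm]

end Offspring

/-! ### The recursions for the factorial moments. -/

section Moments

variable (lam rho : ℝ[X]) (ε : ℝ)

/-- The generating function of a weight over the erased trees gives its factorial moment. -/
lemma treeExp_weight (u : Fin (lam.natDegree + 1) → ℕ) (v : Fin (rho.natDegree + 1) → ℕ) (z t : ℕ) :
    treeExp lam rho t (fun T => (treeWeight u v z t 1 T : ℝ) *
      ((treeWeight u v z t 1 T : ℝ) - 1) * treeErrorProb ε t 1 T) =
    ε * d2 (offspring (nodeFrac lam) u 1 (erasedBranchGF lam rho ε u v z t)) 1 := by
  have h := congrArg (fun f => d2 f 1)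
    (sum_treeProb_weight_error lam rho ε u v z t 1 (nodeFrac lam))
  simp only [d2_sum, d2_C_mul_X_pow_mul_C] at h
  rw [treeExp, h]
  simp [d2_mul, d1_C, d2_C]

lemma offspring_edgeFrac_indicator (P f : ℝ[X]) {i : ℕ} (hi : 1 ≤ i) :
    offspring (p := P.natDegree + 1) (edgeFrac P) (fun a => if (a : ℕ) + 1 = i then 1 else 0) 0 f =
      P.comp f + C (edgeFrac P i) * (X - 1) * f ^ (i - 1) := by
  rw [offspring_indicator _ _ _ _ (edgeFrac_eq_zero P) hi, offspring_zero, add_zero]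

lemma offspring_nodeFrac_indicator (P f : ℝ[X]) {i : ℕ} (hi : 1 ≤ i) :
    offspring (p := P.natDegree + 1) (nodeFrac P) (fun a => if (a : ℕ) + 1 = i then 1 else 0) 1 f =
      (nodePoly P).comp f + C (nodeFrac P i) * (X - 1) * f ^ i := by
  rw [offspring_indicator _ _ _ _ (nodeFrac_eq_zero P) hi, offspring_nodeFrac, Nat.sub_add_cancel hi]

/-- For the edge weight the branches satisfy `f(t+1) = X ρ(X λ(f(t)))`; this is differentiated twice
at `1`. -/
lemma branchGF_edges (hlam : lam.eval 1 = 1) (hrho : rho.eval 1 = 1) (t : ℕ) :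
    let f := branchGF lam rho (fun _ : Fin (lam.natDegree + 1) => 0)
      (fun _ : Fin (rho.natDegree + 1) => 1) 1 t
    f.eval 1 = 1 ∧ d1 f 1 = fK1 lam rho t ∧ d2 f 1 = fK2 lam rho t := by
  induction t with
  | zero => simp [branchGF, fK1, fK2, d1_one, d2_one]
  | succ t ih =>
    obtain ⟨h0, h1, h2⟩ := ih
    simp only [branchGF, offspring_zero, offspring_one, pow_one, d1_mul, d2_mul, d1_X, d2_X, eval_X,
      eval_mul, eval_comp, d1_comp, d2_comp, h0, h1, h2, hlam, hrho, fK1, fK2, gK1, mul_one,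
      Nat.add_sub_cancel]
    refine ⟨trivial, by ring1, by ring1⟩

/-- Here `F(t+1) = f(t+1) - X ρ(X (λ(f(t)) - ε λ(F(t))))`. At `1` the argument of `ρ` is `1 - Q`,
with `Q` from density evolution. -/
lemma erasedBranchGF_edges (hlam : lam.eval 1 = 1) (hrho : rho.eval 1 = 1) (t : ℕ) :
    let f := erasedBranchGF lam rho ε (fun _ : Fin (lam.natDegree + 1) => 0)
      (fun _ : Fin (rho.natDegree + 1) => 1) 1 t
    f.eval 1 = deP lam rho ε t ∧ d1 f 1 = FK1 lam rho ε t ∧ d2 f 1 = FK2 lam rho ε t := by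
  induction t with
  | zero => simp [erasedBranchGF, deP, FK1, FK2, d1_one, d2_one]
  | succ t ih =>
    obtain ⟨h0, h1, h2⟩ := ih
    obtain ⟨b0, b1, b2⟩ := branchGF_edges lam rho hlam hrho t
    obtain ⟨c0, c1, c2⟩ := branchGF_edges lam rho hlam hrho (t + 1)
    simp only [erasedBranchGF, eval_sub, d1_sub, d2_sub, c0, c1, c2]
    simp only [offspring_zero, offspring_one, pow_one, d1_mul, d2_mul, d1_X, d2_X, eval_X,
      eval_mul, eval_comp, d1_comp, d2_comp, eval_sub, d1_sub, d2_sub, h0, h1, h2, b0, b1, b2,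
      hlam, mul_one, one_mul, d1_C, d2_C, eval_C, deP, deQ, FK1, FK2, GK1, gK1, gK2, Nat.add_sub_cancel]
    refine ⟨trivial, by ring1, by ring1⟩

/-- Marking variable nodes of degree `i` gives `f(t+1) = ρ(λ(f) + λ_i (X - 1) f^(i-1))` with `f =
f(t)`. -/
lemma branchGF_var (hlam : lam.eval 1 = 1) (hrho : rho.eval 1 = 1) {i : ℕ} (hi : 1 ≤ i) (t : ℕ) :
    let f := branchGF lam rho (fun a : Fin (lam.natDegree + 1) => if (a : ℕ) + 1 = i then 1 else 0)
      (fun _ : Fin (rho.natDegree + 1) => 0) 0 t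
    f.eval 1 = 1 ∧ d1 f 1 = fV1 lam rho i t ∧ d2 f 1 = fV2 lam rho i t := by
  induction t with
  | zero => simp [branchGF, fV1, fV2, d1_one, d2_one]
  | succ t ih =>
    obtain ⟨h0, h1, h2⟩ := ih
    simp only [branchGF, offspring_zero, offspring_edgeFrac_indicator _ _ hi, pow_zero, one_mul,
      d1_mul, d2_mul, d1_X, d2_X, eval_X, eval_mul, eval_comp, d1_comp, d2_comp, d1_add, d2_add,
      eval_add, eval_sub, eval_pow, eval_C, d1_C, d2_C, d1_sub, d2_sub, d1_one, d2_one, d1_pow,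
      eval_one, h0, h1, h2, hlam, hrho, fV1, fV2, gV1, mul_one, one_pow, Nat.add_sub_cancel,
      Nat.cast_sub hi, Nat.cast_one, sub_self, mul_zero, zero_mul, add_zero, zero_add, sub_zero]
    refine ⟨trivial, trivial, by ring1⟩

lemma erasedBranchGF_var (hlam : lam.eval 1 = 1) (hrho : rho.eval 1 = 1) {i : ℕ} (hi : 1 ≤ i)
    (t : ℕ) :
    let f := erasedBranchGF lam rho ε
      (fun a : Fin (lam.natDegree + 1) => if (a : ℕ) + 1 = i then 1 else 0)
      (fun _ : Fin (rho.natDegree + 1) => 0) 0 t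
    f.eval 1 = deP lam rho ε t ∧ d1 f 1 = FV1 lam rho ε i t ∧ d2 f 1 = FV2 lam rho ε i t := by
  induction t with
  | zero => simp [erasedBranchGF, deP, FV1, FV2, d1_one, d2_one]
  | succ t ih =>
    obtain ⟨h0, h1, h2⟩ := ih
    obtain ⟨b0, b1, b2⟩ := branchGF_var lam rho hlam hrho hi t
    obtain ⟨c0, c1, c2⟩ := branchGF_var lam rho hlam hrho hi (t + 1)
    simp only [erasedBranchGF, eval_sub, d1_sub, d2_sub, c0, c1, c2]
    -- `Nat.sub_sub` matches the exponent `i - 1 - 1` with `i - 2`. For `i = 1` its truncation is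
    -- harmless, as the factor `i - 1` vanishes.
    simp only [offspring_zero, offspring_edgeFrac_indicator _ _ hi, pow_zero, one_mul,
      d1_mul, d2_mul, d1_X, d2_X, eval_X, eval_mul, eval_comp, d1_comp, d2_comp, d1_add, d2_add,
      eval_add, eval_sub, eval_pow, eval_C, d1_C, d2_C, d1_sub, d2_sub, d1_one, d2_one, d1_pow,
      eval_one, h0, h1, h2, b0, b1, b2, hlam, mul_one, one_pow, Nat.add_sub_cancel,
      Nat.cast_sub hi, Nat.cast_one, sub_self, mul_zero, zero_mul, add_zero, zero_add, sub_zero,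
      deP, deQ, FV1, FV2, GV1, gV1, gV2, Nat.sub_sub]
    refine ⟨trivial, by ring1, by ring1⟩

/-- Marking check nodes acts outside: `f(t+1) = ρ(λ(f)) + ρ_j (X - 1) λ(f)^(j-1)` with `f = f(t)`.
-/
lemma branchGF_check (hlam : lam.eval 1 = 1) (hrho : rho.eval 1 = 1) {j : ℕ} (hj : 1 ≤ j) (t : ℕ) :
    let f := branchGF lam rho (fun _ : Fin (lam.natDegree + 1) => 0)
      (fun b : Fin (rho.natDegree + 1) => if (b : ℕ) + 1 = j then 1 else 0) 0 t
    f.eval 1 = 1 ∧ d1 f 1 = fC1 lam rho j t ∧ d2 f 1 = fC2 lam rho j t := by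
  induction t with
  | zero => simp [branchGF, fC1, fC2, d1_one, d2_one]
  | succ t ih =>
    obtain ⟨h0, h1, h2⟩ := ih
    simp only [branchGF, offspring_zero, offspring_edgeFrac_indicator _ _ hj, pow_zero, one_mul,
      d1_mul, d2_mul, d1_X, d2_X, eval_X, eval_mul, eval_comp, d1_comp, d2_comp, d1_add, d2_add,
      eval_add, eval_sub, eval_pow, eval_C, d1_C, d2_C, d1_sub, d2_sub, d1_one, d2_one, d1_pow,
      eval_one, h0, h1, h2, hlam, hrho, fC1, fC2, gC1, mul_one, one_pow, Nat.add_sub_cancel,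
      Nat.cast_sub hj, Nat.cast_one, sub_self, mul_zero, zero_mul, add_zero, zero_add, sub_zero]
    refine ⟨trivial, trivial, by ring1⟩

/-- With `y = λ(f) - ε λ(F)` at depth `t`, the recursion is `F(t+1) = f(t+1) - ρ(y) - ρ_j (X - 1)
y^(j-1)`. -/
lemma erasedBranchGF_check (hlam : lam.eval 1 = 1) (hrho : rho.eval 1 = 1) {j : ℕ} (hj : 1 ≤ j)
    (t : ℕ) :
    let f := erasedBranchGF lam rho ε (fun _ : Fin (lam.natDegree + 1) => 0)
      (fun b : Fin (rho.natDegree + 1) => if (b : ℕ) + 1 = j then 1 else 0) 0 t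
    f.eval 1 = deP lam rho ε t ∧ d1 f 1 = FC1 lam rho ε j t ∧ d2 f 1 = FC2 lam rho ε j t := by
  induction t with
  | zero => simp [erasedBranchGF, deP, FC1, FC2, d1_one, d2_one]
  | succ t ih =>
    obtain ⟨h0, h1, h2⟩ := ih
    obtain ⟨b0, b1, b2⟩ := branchGF_check lam rho hlam hrho hj t
    obtain ⟨c0, c1, c2⟩ := branchGF_check lam rho hlam hrho hj (t + 1)
    simp only [erasedBranchGF, eval_sub, d1_sub, d2_sub, c0, c1, c2]
    simp only [offspring_zero, offspring_edgeFrac_indicator _ _ hj, pow_zero, one_mul,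
      d1_mul, d2_mul, d1_X, d2_X, eval_X, eval_mul, eval_comp, d1_comp, d2_comp, d1_add, d2_add,
      eval_add, eval_sub, eval_pow, eval_C, d1_C, d2_C, d1_sub, d2_sub, d1_one, d2_one, d1_pow,
      eval_one, h0, h1, h2, b0, b1, b2, hlam, mul_one, Nat.add_sub_cancel,
      Nat.cast_sub hj, Nat.cast_one, sub_self, mul_zero, zero_mul, add_zero, zero_add, sub_zero,
      deP, deQ, FC1, FC2, GC1, gC1, gC2, Nat.sub_sub]
    refine ⟨trivial, by ring1, by ring1⟩

theorem expK_eq (hlam : lam.eval 1 = 1) (hrho : rho.eval 1 = 1) (t : ℕ) :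
    expK lam rho ε t = ε * d2 (nodePoly lam) (deP lam rho ε t) * FK1 lam rho ε t ^ 2
        + ε * d1 (nodePoly lam) (deP lam rho ε t) * FK2 lam rho ε t := by
  obtain ⟨h0, h1, h2⟩ := erasedBranchGF_edges lam rho ε hlam hrho t
  simp only [expK, numEdges_eq_treeWeight, treeExp_weight, offspring_nodeFrac, d2_comp, h0, h1, h2]
  ring

/-- The root may be marked itself. This adds `L_i (X - 1) F^i` to the generating function, and its
second derivative at `1` is the third term, up to the factor `ε`. -/
theorem expV_eq (hlam : lam.eval 1 = 1) (hrho : rho.eval 1 = 1) (t : ℕ) {i : ℕ} (hi : 1 ≤ i) :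
    expV lam rho ε t i = ε * d2 (nodePoly lam) (deP lam rho ε t) * FV1 lam rho ε i t ^ 2
        + ε * d1 (nodePoly lam) (deP lam rho ε t) * FV2 lam rho ε i t
        + 2 * ε * nodeFrac lam i * i * deP lam rho ε t ^ (i - 1) * FV1 lam rho ε i t := by
  obtain ⟨h0, h1, h2⟩ := erasedBranchGF_var lam rho ε hlam hrho hi t
  simp only [expV, numVar_eq_treeWeight, treeExp_weight, offspring_nodeFrac_indicator _ _ hi,
    d2_add, d2_comp, d2_mul, d1_mul, d1_C, d2_C, d1_sub, d2_sub, d1_X, d2_X, d1_one, d2_one,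
    d1_pow, eval_mul, eval_sub, eval_X, eval_one, eval_C, h0, h1, h2]
  ring

theorem expC_eq (hlam : lam.eval 1 = 1) (hrho : rho.eval 1 = 1) (t : ℕ) {j : ℕ} (hj : 1 ≤ j) :
    expC lam rho ε t j = ε * d2 (nodePoly lam) (deP lam rho ε t) * FC1 lam rho ε j t ^ 2
        + ε * d1 (nodePoly lam) (deP lam rho ε t) * FC2 lam rho ε j t := by
  obtain ⟨h0, h1, h2⟩ := erasedBranchGF_check lam rho ε hlam hrho hj t
  simp only [expC, numCheck_eq_treeWeight, treeExp_weight, offspring_nodeFrac, d2_comp, h0, h1, h2]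
  ring

end Moments

/-! ### Tree probabilities as products over node types. -/

section TreeProbability

variable {p q : ℕ} (lam rho : ℝ[X])

/-- With the edge perspective law also at the top, all nodes are treated alike. -/
lemma treeProb_eq_prod (t : ℕ) : ∀ (r : ℕ) (T : PlaneTree p q t r),
    treeProb lam rho t r (edgeFrac lam) T =
      (∏ x, edgeFrac lam (varType t r T x + 1)) * ∏ y, edgeFrac rho (checkType t r T y + 1) := by
  induction t with
  | zero =>
    intro r (T : Fin p)
    change _ = (∏ x : Unit, _) * ∏ y : Empty, _
    rw [Fintype.prod_unique, Fintype.prod_empty, mul_one]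
    rfl
  | succ t ih =>
    rintro r ⟨a, c⟩
    change _ = (∏ x : Option (Σ k : Fin (a + r), Σ l : Fin (c k).1, TreeVar t 0 ((c k).2 l)), _) *
      ∏ y : (Σ k : Fin (a + r), Option (Σ l : Fin (c k).1, TreeCheck t 0 ((c k).2 l))), _
    rw [Fintype.prod_option, Fintype.prod_sigma, Fintype.prod_sigma]
    simp only [Fintype.prod_sigma, Fintype.prod_option, treeProb, ih, Finset.prod_mul_distrib]
    simp only [varType, checkType]
    ring

/-- The probability of a tree in terms of the numbers of its nodes. -/
lemma treeProb_eq_prod_pow (t r : ℕ) (T : PlaneTree p q t r) :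
    treeProb lam rho t r (edgeFrac lam) T =
      (∏ a : Fin p, edgeFrac lam (a + 1) ^ numVar (a + 1) t r T) *
        ∏ b : Fin q, edgeFrac rho (b + 1) ^ numCheck (b + 1) t r T := by
  rw [treeProb_eq_prod]
  congr 1
  · rw [← Finset.prod_fiberwise' Finset.univ (varType t r T) (fun a => edgeFrac lam (a + 1))]
    refine Finset.prod_congr rfl fun a _ => ?_
    rw [Finset.prod_const, ← card_varType, Fintype.card_subtype]
  · rw [← Finset.prod_fiberwise' Finset.univ (checkType t r T) (fun b => edgeFrac rho (b + 1))]
    refine Finset.prod_congr rfl fun b _ => ?_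
    rw [Finset.prod_const, ← card_checkType, Fintype.card_subtype]

/-- Changing the degree distribution of the top. -/
lemma treeProb_mul (w : ℕ → ℝ) (κ : ℕ → ℝ) (w' : ℕ → ℝ) (h : ∀ i, w' (i + 1) = w (i + 1) * κ i) :
    ∀ (t r : ℕ) (T : PlaneTree p q t r),
    treeProb lam rho t r w' T =
      treeProb lam rho t r w T * κ (varType t r T (treeRoot t r T))
  | 0, _, _ => h _
  | t + 1, r, ⟨a, c⟩ => by
    simp only [treeProb, h]
    change _ = _ * κ a
    ring

end TreeProbability

/-! ### The correction factor of a tree and its derivative at zero. -/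

section Corrections

/-- The correction for drawing without replacement: `∏ (1 - k c h)` over `k < V`. -/
def fallingCorr (V : ℕ) (c h : ℝ) : ℝ := ∏ k ∈ Finset.range V, (1 - k * c * h)

lemma fallingCorr_zero (V : ℕ) (c : ℝ) : fallingCorr V c 0 = 1 := by simp [fallingCorr]

/-- For `V > N` both sides vanish, the product because of its factor with `k = N`. -/
lemma cast_descFactorial_eq_prod (N V : ℕ) :
    (N.descFactorial V : ℝ) = ∏ k ∈ Finset.range V, ((N : ℝ) - k) := by
  induction V with
  | zero => simp
  | succ V ih =>
    rw [Finset.prod_range_succ, ← ih, Nat.descFactorial_succ, Nat.cast_mul]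
    rcases le_or_gt V N with h | h
    · rw [Nat.cast_sub h, mul_comm]
    · rw [Nat.descFactorial_of_lt h]; simp

/-- `N d = E l` counts the sockets at nodes of one type. Taking `E l` out of `(N - k) d` leaves `1 -
k (d / l) / E`. If `l = 0` there are no such nodes, and both sides vanish unless `V = 0`. -/
lemma descFactorial_mul_pow (N V d : ℕ) (hd : d ≠ 0) {E l : ℝ} (hE : E ≠ 0)
    (h : (N : ℝ) * d = E * l) :
    (N.descFactorial V : ℝ) * d ^ V = E ^ V * l ^ V * fallingCorr V (d / l) (1 / E) := by
  have hd' : (d : ℝ) ≠ 0 := Nat.cast_ne_zero.2 hd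
  by_cases hl : l = 0
  · subst hl
    have hN : N = 0 := by simpa [hd] using h
    subst hN
    cases V with
    | zero => simp [fallingCorr]
    | succ V => simp
  · rw [cast_descFactorial_eq_prod, fallingCorr, ← mul_pow, ← Finset.card_range V,
      ← Finset.prod_const, ← Finset.prod_const, Finset.card_range, ← Finset.prod_mul_distrib,
      ← Finset.prod_mul_distrib]
    refine Finset.prod_congr rfl fun k _ => ?_
    rw [sub_mul, h]
    field_simp

lemma hasDerivAt_fallingCorr (V : ℕ) (c : ℝ) :
    HasDerivAt (fallingCorr V c) (-(c * ((V : ℝ) * ((V : ℝ) - 1) / 2))) 0 := by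
  induction V with
  | zero =>
    have : fallingCorr 0 c = fun _ => 1 := by funext h; simp [fallingCorr]
    rw [this]
    simpa using hasDerivAt_const (0 : ℝ) (1 : ℝ)
  | succ V ih =>
    have h1 : fallingCorr (V + 1) c = fun h => fallingCorr V c h * (1 - V * c * h) := by
      funext h; rw [fallingCorr, Finset.prod_range_succ]; rfl
    have h2 : HasDerivAt (fun h : ℝ => 1 - V * c * h) (-(V * c)) 0 := by
      simpa using ((hasDerivAt_id (0 : ℝ)).const_mul (V * c)).const_sub 1
    rw [h1]
    refine (ih.mul h2).congr_deriv ?_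
    rw [fallingCorr_zero]
    push_cast
    ring

/-- A product of functions with value one has the sum of the derivatives as its derivative. -/
lemma hasDerivAt_prod_of_eq_one {ι : Type*} (s : Finset ι) (f : ι → ℝ → ℝ) (f' : ι → ℝ) (x : ℝ)
    (h1 : ∀ i ∈ s, f i x = 1) (hf : ∀ i ∈ s, HasDerivAt (f i) (f' i) x) :
    HasDerivAt (fun y => ∏ i ∈ s, f i y) (∑ i ∈ s, f' i) x := by
  refine (HasDerivAt.fun_finsetProd hf).congr_deriv ?_
  refine Finset.sum_congr rfl fun i hi => ?_
  rw [Finset.prod_eq_one fun j hj => h1 j (Finset.mem_of_mem_erase hj), one_smul]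

variable {p q : ℕ} (lam rho : ℝ[X])

/-- The ratio of the probabilities of a tree in the ensemble with `1 / h` edges and in the tree
ensemble. -/
def treeCorr {t r : ℕ} (T : PlaneTree p q t r) (h : ℝ) : ℝ :=
  (∏ a : Fin p, fallingCorr (numVar (a + 1) t r T) ((a + 1 : ℕ) / edgeFrac lam (a + 1)) h) *
  (∏ b : Fin q, fallingCorr (numCheck (b + 1) t r T) ((b + 1 : ℕ) / edgeFrac rho (b + 1)) h) /
  fallingCorr (numEdges t r T) 1 h

lemma treeCorr_zero {t r : ℕ} (T : PlaneTree p q t r) : treeCorr lam rho T 0 = 1 := by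
  simp [treeCorr, fallingCorr_zero]

/-- The derivative of `treeCorr` at zero. -/
def treeCorrDeriv {t r : ℕ} (T : PlaneTree p q t r) : ℝ :=
  1 / 2 * ((numEdges t r T : ℝ) * ((numEdges t r T : ℝ) - 1)
    - ∑ a : Fin p, ((a + 1 : ℕ) : ℝ) / edgeFrac lam (a + 1) *
      ((numVar (a + 1) t r T : ℝ) * ((numVar (a + 1) t r T : ℝ) - 1))
    - ∑ b : Fin q, ((b + 1 : ℕ) : ℝ) / edgeFrac rho (b + 1) *
      ((numCheck (b + 1) t r T : ℝ) * ((numCheck (b + 1) t r T : ℝ) - 1)))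

lemma hasDerivAt_treeCorr {t r : ℕ} (T : PlaneTree p q t r) :
    HasDerivAt (treeCorr lam rho T) (treeCorrDeriv lam rho T) 0 := by
  have hV := hasDerivAt_prod_of_eq_one Finset.univ (fun a : Fin p =>
    fallingCorr (numVar (a + 1) t r T) ((a + 1 : ℕ) / edgeFrac lam (a + 1))) _ 0
    (fun a _ => fallingCorr_zero _ _) (fun a _ => hasDerivAt_fallingCorr _ _)
  have hC := hasDerivAt_prod_of_eq_one Finset.univ (fun b : Fin q =>
    fallingCorr (numCheck (b + 1) t r T) ((b + 1 : ℕ) / edgeFrac rho (b + 1))) _ 0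
    (fun a _ => fallingCorr_zero _ _) (fun a _ => hasDerivAt_fallingCorr _ _)
  have hK := hasDerivAt_fallingCorr (numEdges t r T) 1
  refine ((hV.mul hC).div hK (by rw [fallingCorr_zero]; exact one_ne_zero)).congr_deriv ?_
  simp only [fallingCorr_zero, Finset.prod_const_one, Pi.mul_apply, treeCorrDeriv,
    Finset.sum_neg_distrib, ← mul_div_assoc, ← Finset.sum_div]
  ring

/-- The number of labelings of a tree in an ensemble with `E` edges. -/
lemma numLabels_eq {N : Fin p → ℕ} {M : Fin q → ℕ} {E : ℝ} (hE : E ≠ 0)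
    (hN : ∀ a : Fin p, (N a : ℝ) * (a + 1 : ℕ) = E * edgeFrac lam (a + 1))
    (hM : ∀ b : Fin q, (M b : ℝ) * (b + 1 : ℕ) = E * edgeFrac rho (b + 1))
    {t r : ℕ} (T : PlaneTree p q t r) :
    (numLabels N M T : ℝ) = E ^ (numEdges t r T + 1) * treeProb lam rho t r (edgeFrac lam) T *
      ((∏ a : Fin p, fallingCorr (numVar (a + 1) t r T) ((a + 1 : ℕ) / edgeFrac lam (a + 1))
        (1 / E)) *
      (∏ b : Fin q, fallingCorr (numCheck (b + 1) t r T) ((b + 1 : ℕ) / edgeFrac rho (b + 1))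
        (1 / E))) := by
  have h1 : ∀ a : Fin p, ((((N a).descFactorial (numVar (a + 1) t r T) *
      (a + 1) ^ numVar (a + 1) t r T : ℕ)) : ℝ) = _ := fun a => by
    rw [Nat.cast_mul, Nat.cast_pow, descFactorial_mul_pow _ _ _ (Nat.succ_ne_zero _) hE (hN a)]
  have h2 : ∀ b : Fin q, ((((M b).descFactorial (numCheck (b + 1) t r T) *
      (b + 1) ^ numCheck (b + 1) t r T : ℕ)) : ℝ) = _ := fun b => by
    rw [Nat.cast_mul, Nat.cast_pow, descFactorial_mul_pow _ _ _ (Nat.succ_ne_zero _) hE (hM b)]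
  -- Every node contributes one factor `E`, and there is one node more than edges.
  rw [numLabels, Nat.cast_mul, Nat.cast_prod, Nat.cast_prod, Finset.prod_congr rfl fun a _ => h1 a,
    Finset.prod_congr rfl fun b _ => h2 b, ← sum_numVar_add_sum_numCheck, treeProb_eq_prod_pow]
  simp only [Finset.prod_mul_distrib, Finset.prod_pow_eq_pow_sum, pow_add]
  ring

end Corrections

/-! ### Node and socket numbers at admissible block lengths. -/

section Frequencies

variable {lam rho : ℝ[X]}

lemma IsDegreeDist.sum_coeff {P : ℝ[X]} (h : IsDegreeDist P) :
    ∑ a : Fin (P.natDegree + 1), edgeFrac P (a + 1) = 1 := by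
  have := h.sum_one
  rw [eval_eq_sum_range, ← Fin.sum_univ_eq_sum_range (fun i => P.coeff i * 1 ^ i)] at this
  simpa [edgeFrac] using this

lemma sum_Icc_one_eq_sum_fin (n : ℕ) (f : ℕ → ℝ) :
    ∑ i ∈ Finset.Icc 1 n, f i = ∑ a : Fin n, f (a + 1) := by
  rw [← Finset.Ico_add_one_right_eq_Icc, Finset.sum_Ico_eq_sum_range, Nat.add_sub_cancel]
  refine Eq.trans ?_ (Fin.sum_univ_eq_sum_range (fun i => f (i + 1)) _).symm
  exact Finset.sum_congr rfl fun i _ => by rw [add_comm]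

/-- The normalization of the node perspective distribution. -/
def invSum (P : ℝ[X]) : ℝ := ∑ k ∈ Finset.Icc 1 (P.natDegree + 1), edgeFrac P k / k

lemma IsDegreeDist.invSum_pos {P : ℝ[X]} (h : IsDegreeDist P) : 0 < invSum P := by
  have hnn : ∀ a : Fin (P.natDegree + 1), 0 ≤ edgeFrac P (a + 1) / ((a : ℕ) + 1 : ℕ) := fun a =>
    div_nonneg (h.nonneg _) (Nat.cast_nonneg _)
  rw [invSum, sum_Icc_one_eq_sum_fin]
  refine lt_of_le_of_ne (Finset.sum_nonneg fun a _ => hnn a) fun h0 => ?_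
  have h1 := (Finset.sum_eq_zero_iff_of_nonneg fun a _ => hnn a).1 h0.symm
  have h2 := h.sum_coeff
  rw [Finset.sum_eq_zero] at h2
  · exact zero_ne_one h2
  · intro a ha
    have := h1 a ha
    rw [div_eq_zero_iff] at this
    refine this.resolve_right (Nat.cast_ne_zero.2 (Nat.succ_ne_zero _))

lemma IsDegreeDist.d1_nodePoly {P : ℝ[X]} (h : IsDegreeDist P) :
    d1 (nodePoly P) 1 = 1 / invSum P := by
  have h1 : d1 (nodePoly P) 1 = ∑ i ∈ Finset.Icc 1 (P.natDegree + 1), nodeFrac P i * i := by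
    simp [d1, nodePoly, eval_finsetSum, derivative_X_pow]
  rw [h1, sum_Icc_one_eq_sum_fin, ← h.sum_coeff, Finset.sum_div]
  refine Finset.sum_congr rfl fun a _ => ?_
  have : ((((a : ℕ) + 1 : ℕ)) : ℝ) ≠ 0 := Nat.cast_ne_zero.2 (Nat.succ_ne_zero _)
  rw [nodeFrac, ← invSum]
  have := h.invSum_pos.ne'
  field_simp

lemma IsDegreeDist.nodeFrac_eq {P : ℝ[X]} (h : IsDegreeDist P) (i : ℕ) :
    nodeFrac P (i + 1) = edgeFrac P (i + 1) * (d1 (nodePoly P) 1 / (i + 1 : ℝ)) := by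
  rw [h.d1_nodePoly, nodeFrac, ← invSum]
  have := h.invSum_pos.ne'
  push_cast
  field_simp

lemma IsDegreeDist.sum_nodeFrac {P : ℝ[X]} (h : IsDegreeDist P) :
    ∑ a : Fin (P.natDegree + 1), nodeFrac P (a + 1) = 1 := by
  simp only [nodeFrac]
  rw [← Finset.sum_div, ← sum_Icc_one_eq_sum_fin (P.natDegree + 1) fun k => edgeFrac P k / k]
  exact div_self h.invSum_pos.ne'

lemma IsDegreeDist.d1_nodePoly_pos {P : ℝ[X]} (h : IsDegreeDist P) : 0 < d1 (nodePoly P) 1 := by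
  rw [h.d1_nodePoly]
  exact one_div_pos.2 h.invSum_pos

lemma Admissible.cast_var {n : ℕ} (h : Admissible lam rho n) (a : Fin (lam.natDegree + 1)) :
    (⌊numVarNodes lam n (a + 1)⌋₊ : ℝ) = numVarNodes lam n (a + 1) := by
  obtain ⟨m, hm⟩ := h.1 (a + 1) (by simp; omega)
  rw [hm, Nat.floor_natCast]

lemma Admissible.cast_check {n : ℕ} (h : Admissible lam rho n) (b : Fin (rho.natDegree + 1)) :
    (⌊numCheckNodes lam rho n (b + 1)⌋₊ : ℝ) = numCheckNodes lam rho n (b + 1) := by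
  obtain ⟨m, hm⟩ := h.2 (b + 1) (by simp; omega)
  rw [hm, Nat.floor_natCast]

lemma Admissible.var_mul (hlam : IsDegreeDist lam) {n : ℕ} (h : Admissible lam rho n)
    (a : Fin (lam.natDegree + 1)) :
    (⌊numVarNodes lam n (a + 1)⌋₊ : ℝ) * (a + 1 : ℕ) =
      n * d1 (nodePoly lam) 1 * edgeFrac lam (a + 1) := by
  rw [h.cast_var, numVarNodes, hlam.nodeFrac_eq]
  push_cast
  field_simp

lemma Admissible.check_mul {n : ℕ} (h : Admissible lam rho n)
    (b : Fin (rho.natDegree + 1)) :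
    (⌊numCheckNodes lam rho n (b + 1)⌋₊ : ℝ) * (b + 1 : ℕ) =
      n * d1 (nodePoly lam) 1 * edgeFrac rho (b + 1) := by
  rw [h.cast_check, numCheckNodes]
  push_cast
  field_simp

lemma card_socket {p : ℕ} (N : Fin p → ℕ) :
    Fintype.card (Socket (typedDeg N)) = ∑ a : Fin p, N a * (a + 1) := by
  simp only [Fintype.card_sigma, Fintype.card_fin, Fintype.sum_sigma, typedDeg, Finset.sum_const,
    Finset.card_univ, smul_eq_mul]

lemma Admissible.card_varSocket (hlam : IsDegreeDist lam) {n : ℕ} (h : Admissible lam rho n) :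
    (Fintype.card (Socket (typedDeg fun a : Fin (lam.natDegree + 1) =>
      ⌊numVarNodes lam n (a + 1)⌋₊)) : ℝ) = n * d1 (nodePoly lam) 1 := by
  rw [card_socket, Nat.cast_sum]
  simp only [Nat.cast_mul, h.var_mul hlam]
  rw [← Finset.mul_sum, hlam.sum_coeff, mul_one]

lemma Admissible.card_checkSocket (hrho : IsDegreeDist rho) {n : ℕ} (h : Admissible lam rho n) :
    (Fintype.card (Socket (typedDeg fun b : Fin (rho.natDegree + 1) =>
      ⌊numCheckNodes lam rho n (b + 1)⌋₊)) : ℝ) = n * d1 (nodePoly lam) 1 := by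
  rw [card_socket, Nat.cast_sum]
  simp only [Nat.cast_mul, h.check_mul]
  rw [← Finset.mul_sum, hrho.sum_coeff, mul_one]

lemma Admissible.card_varNode (hlam : IsDegreeDist lam) {n : ℕ} (h : Admissible lam rho n) :
    Fintype.card (VarNode lam n) = n := by
  rw [← Nat.cast_inj (R := ℝ), Fintype.card_sigma, Nat.cast_sum]
  simp only [Fintype.card_fin, h.cast_var]
  simp only [numVarNodes]
  rw [← Finset.mul_sum, hlam.sum_nodeFrac, mul_one]

lemma exists_natCast_of_den_dvd {q : ℚ} (hq : 0 ≤ q) {n : ℕ} (h : q.den ∣ n) :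
    ∃ m : ℕ, (n : ℝ) * q = m := by
  obtain ⟨c, rfl⟩ := h
  refine ⟨q.num.toNat * c, ?_⟩
  have h1 : ((q.num.toNat : ℤ) : ℝ) = q.num := by
    rw [Int.toNat_of_nonneg (Rat.num_nonneg.2 hq)]
  have h2 : (q.den : ℝ) * q = q.num := by
    have := Rat.den_mul_eq_num q
    exact_mod_cast this
  rw [Nat.cast_mul, Nat.cast_mul, mul_right_comm, h2, ← h1]
  norm_cast

/-- Membership in the subfield of rationals passes to the node fractions by closure under
arithmetic. -/
lemma edgeFrac_mem_range (hlam : IsDegreeDist lam) (i : ℕ) :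
    edgeFrac lam i ∈ (algebraMap ℚ ℝ).fieldRange := by
  obtain ⟨q, hq⟩ := hlam.rational (i - 1)
  exact ⟨q, by rw [edgeFrac, hq]; rfl⟩

/-- There are infinitely many admissible block lengths. -/
lemma blocklengths_neBot (hlam : IsDegreeDist lam) (hrho : IsDegreeDist rho) :
    (blocklengths lam rho).NeBot := by
  have hS : invSum lam ∈ (algebraMap ℚ ℝ).fieldRange :=
    sum_mem fun k _ => div_mem (edgeFrac_mem_range hlam k) (natCast_mem _ k)
  have hV : ∀ i, ∃ q : ℚ, (q : ℝ) = nodeFrac lam i := fun i =>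
    div_mem (div_mem (edgeFrac_mem_range hlam i) (natCast_mem _ i)) hS
  have hC : ∀ j, ∃ q : ℚ, (q : ℝ) = d1 (nodePoly lam) 1 * edgeFrac rho j / j := fun j => by
    rw [hlam.d1_nodePoly]
    exact div_mem (mul_mem (div_mem (one_mem _) hS) (edgeFrac_mem_range hrho j)) (natCast_mem _ j)
  choose v hv using hV
  choose c hc using hC
  have hv0 : ∀ i, 0 ≤ v i := fun i => by
    rw [← Rat.cast_nonneg (K := ℝ), hv]
    exact div_nonneg (div_nonneg (hlam.nonneg _) (Nat.cast_nonneg _)) hlam.invSum_pos.le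
  have hc0 : ∀ j, 0 ≤ c j := fun j => by
    rw [← Rat.cast_nonneg (K := ℝ), hc]
    exact div_nonneg (mul_nonneg hlam.d1_nodePoly_pos.le (hrho.nonneg _)) (Nat.cast_nonneg _)
  rw [blocklengths, ← frequently_mem_iff_neBot, frequently_atTop]
  intro n
  -- A common denominator of all the node densities; its positive multiples are admissible.
  let D := (∏ i ∈ Finset.Icc 1 (lam.natDegree + 1), (v i).den) *
    ∏ j ∈ Finset.Icc 1 (rho.natDegree + 1), (c j).den
  have hD : 0 < D := Nat.mul_pos (Finset.prod_pos fun i _ => (v i).den_pos)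
    (Finset.prod_pos fun j _ => (c j).den_pos)
  refine ⟨D * n, Nat.le_mul_of_pos_left n hD, fun i hi => ?_, fun j hj => ?_⟩
  · rw [numVarNodes, ← hv]
    exact exists_natCast_of_den_dvd (hv0 i)
      (((Finset.dvd_prod_of_mem _ hi).trans (dvd_mul_right _ _)).trans (dvd_mul_right _ _))
  · have : numCheckNodes lam rho (D * n) j = ((D * n : ℕ) : ℝ) * c j := by
      rw [numCheckNodes, hc]; ring
    rw [this]
    exact exists_natCast_of_den_dvd (hc0 j)
      (((Finset.dvd_prod_of_mem (fun j => (c j).den) hj).trans (dvd_mul_left _ _)).trans (dvd_mul_right _ _))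

end Frequencies

/-! ### Exact ensemble formula, limits and first order terms. -/

section Limits

variable {lam rho : ℝ[X]}

/-- The expectation of a function of the computation tree over the roots with a cycle-free
neighborhood. -/
theorem ensembleExp_cycleFree (hlam : IsDegreeDist lam) (hrho : IsDegreeDist rho) {n : ℕ}
    (hn : 0 < n) (hadm : Admissible lam rho n) {t : ℕ}
    (hE : ∀ T : EnsembleTree lam rho t, (numEdges t 1 T : ℝ) ≤ n * d1 (nodePoly lam) 1)
    (g : Ensemble lam rho n → VarNode lam n → ℝ) (h : EnsembleTree lam rho t → ℝ)
    (hgh : ∀ (π : Ensemble lam rho n) (T : EnsembleTree lam rho t)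
      (X : VarLabel (fun a : Fin (lam.natDegree + 1) => ⌊numVarNodes lam n (a + 1)⌋₊) t 1 T)
      (Y : CheckLabel (fun b : Fin (rho.natDegree + 1) => ⌊numCheckNodes lam rho n (b + 1)⌋₊)
        t 1 T),
      Consistent π X Y → Function.Injective (fun x => (varSocket X x).1) →
      g π (varSocket X (treeRoot t 1 T)).1 = h T) :
    ensembleExp lam rho n (fun π v => if CycleFree π t v then g π v else 0) =
      ∑ T : EnsembleTree lam rho t, treeProb lam rho t 1 (nodeFrac lam) T * h T *
        treeCorr lam rho T (1 / (n * d1 (nodePoly lam) 1)) := by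
  let N : Fin (lam.natDegree + 1) → ℕ := fun a => ⌊numVarNodes lam n (a + 1)⌋₊
  let M : Fin (rho.natDegree + 1) → ℕ := fun b => ⌊numCheckNodes lam rho n (b + 1)⌋₊
  have hV : (Fintype.card (Socket (typedDeg N)) : ℝ) = n * d1 (nodePoly lam) 1 :=
    hadm.card_varSocket hlam
  have hcard : Fintype.card (Socket (typedDeg N)) = Fintype.card (Socket (typedDeg M)) := by
    rw [← Nat.cast_inj (R := ℝ), hV]
    exact (hadm.card_checkSocket hrho).symm
  have hsum := sum_cycleFree hcard g h hgh
  have hens : Fintype.card (Ensemble lam rho n) =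
      (Fintype.card (Socket (typedDeg N))).factorial :=
    Fintype.card_equiv (Fintype.equivOfCardEq hcard)
  have hn' : (n : ℝ) ≠ 0 := Nat.cast_ne_zero.2 hn.ne'
  have hd := hlam.d1_nodePoly_pos.ne'
  set d := d1 (nodePoly lam) 1 with hd_def
  have hE0 : (n : ℝ) * d ≠ 0 := mul_ne_zero hn' hd
  have hdesc := fun (T : EnsembleTree lam rho t) => descFactorial_mul_pow
    (Fintype.card (Socket (typedDeg N))) (numEdges t 1 T) 1 one_ne_zero (l := 1) hE0
    (by rw [hV]; simp)
  rw [ensembleExp, hens]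
  refine (congrArg (· / _) hsum).trans ?_
  rw [Finset.sum_div]
  refine Finset.sum_congr rfl fun T _ => ?_
  have hK : numEdges t 1 T ≤ Fintype.card (Socket (typedDeg N)) := by
    rw [← Nat.cast_le (α := ℝ), hV]
    exact hE T
  have hfac : (((Fintype.card (Socket (typedDeg N)) - numEdges t 1 T).factorial : ℕ) : ℝ) *
      ((Fintype.card (Socket (typedDeg N))).descFactorial (numEdges t 1 T) : ℕ) =
      ((Fintype.card (Socket (typedDeg N))).factorial : ℕ) := by
    exact_mod_cast Nat.factorial_mul_descFactorial hK
  have hdpos : (((Fintype.card (Socket (typedDeg N))).descFactorial (numEdges t 1 T) : ℕ) : ℝ) ≠ 0 :=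
    Nat.cast_ne_zero.2 (Nat.descFactorial_pos.2 hK).ne'
  have hfpos : (((Fintype.card (Socket (typedDeg N)) - numEdges t 1 T).factorial : ℕ) : ℝ) ≠ 0 :=
    Nat.cast_ne_zero.2 (Nat.factorial_ne_zero _)
  have hdT := hdesc T
  simp only [Nat.cast_one, one_pow, mul_one, div_one] at hdT
  have hcorr : fallingCorr (numEdges t 1 T) 1 (1 / (n * d)) ≠ 0 := by
    intro h0
    rw [h0, mul_zero] at hdT
    exact hdpos hdT
  -- After cancellation one factor `E` remains over `n`, which is `L'(1)`. With the division by the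
  -- root degree it turns `λ_i` at the root into `L_i`.
  rw [← hfac, hdT, numLabels_eq lam rho hE0 (hadm.var_mul hlam) hadm.check_mul T,
    treeProb_mul lam rho (edgeFrac lam) (fun i => d / (i + 1 : ℝ)) (nodeFrac lam)
      (fun i => hlam.nodeFrac_eq i), treeCorr, pow_succ]
  have hr : ((varType t 1 T (treeRoot t 1 T) : ℕ) : ℝ) + 1 ≠ 0 := Nat.cast_add_one_ne_zero _
  field_simp

lemma patternProb_nonneg {A : Type} [Fintype A] {ε : ℝ} (hε : ε ∈ Set.Icc (0 : ℝ) 1)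
    (e : A → Bool) : 0 ≤ patternProb ε e :=
  Finset.prod_nonneg fun x _ => by
    split_ifs
    · exact hε.1
    · exact sub_nonneg.2 hε.2

lemma graphErrorProb_nonneg {V K : Type} [Fintype V] {dV : V → ℕ} {dC : K → ℕ}
    (π : Socket dV ≃ Socket dC) {ε : ℝ} (hε : ε ∈ Set.Icc (0 : ℝ) 1) (t : ℕ) (v : V) :
    0 ≤ graphErrorProb π ε t v :=
  Finset.sum_nonneg fun e _ => mul_nonneg (patternProb_nonneg hε e) (by split_ifs <;> norm_num)

lemma graphErrorProb_le_one {V K : Type} [Fintype V] {dV : V → ℕ} {dC : K → ℕ}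
    (π : Socket dV ≃ Socket dC) {ε : ℝ} (hε : ε ∈ Set.Icc (0 : ℝ) 1) (t : ℕ) (v : V) :
    graphErrorProb π ε t v ≤ 1 := by
  rw [← sum_patternProb (A := V) ε]
  exact Finset.sum_le_sum fun e _ => mul_le_of_le_one_right (patternProb_nonneg hε e)
    (by split_ifs <;> norm_num)

/-- The bit error probability and its cycle-free part differ by at most the probability that the
neighborhood has a cycle. -/
lemma bitErrorProb_sub_le (hlam : IsDegreeDist lam) (hrho : IsDegreeDist rho) {ε : ℝ}
    (hε : ε ∈ Set.Icc (0 : ℝ) 1) (t : ℕ) {n : ℕ} (hn : 0 < n) (hadm : Admissible lam rho n) :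
    0 ≤ bitErrorProb lam rho ε t n - cycleFreeErrorProb lam rho ε t n ∧
    bitErrorProb lam rho ε t n - cycleFreeErrorProb lam rho ε t n ≤
      1 - ensembleExp lam rho n (fun π v => if CycleFree π t v then 1 else 0) := by
  have hcard : Fintype.card (Ensemble lam rho n) ≠ 0 := by
    have : Fintype.card (Socket (varDeg lam n)) = Fintype.card (Socket (checkDeg lam rho n)) := by
      rw [← Nat.cast_inj (R := ℝ)]
      exact (hadm.card_varSocket hlam).trans (hadm.card_checkSocket hrho).symm
    rw [Fintype.card_equiv (Fintype.equivOfCardEq this)]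
    exact Nat.factorial_ne_zero _
  have hden : (0 : ℝ) < Fintype.card (Ensemble lam rho n) * n := by positivity
  have h1 : (1 : ℝ) = ensembleExp lam rho n fun _ _ => 1 := by
    rw [ensembleExp, eq_div_iff hden.ne']
    simp only [Finset.sum_const, Finset.card_univ, hadm.card_varNode hlam, nsmul_eq_mul, mul_one,
      one_mul]
  rw [bitErrorProb, cycleFreeErrorProb]
  constructor
  · rw [ensembleExp, ensembleExp, ← sub_div]
    refine div_nonneg ?_ hden.le
    simp only [← Finset.sum_sub_distrib]
    refine Finset.sum_nonneg fun π _ => Finset.sum_nonneg fun v _ => ?_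
    split_ifs
    · simp
    · simpa using graphErrorProb_nonneg π hε t v
  · nth_rw 1 [h1]
    simp only [ensembleExp, ← sub_div, ← Finset.sum_sub_distrib]
    refine div_le_div_of_nonneg_right ?_ hden.le
    refine Finset.sum_le_sum fun π _ => Finset.sum_le_sum fun v _ => ?_
    split_ifs
    · simp
    · simpa using graphErrorProb_le_one π hε t v

/-- The probabilities of the trees add up to one. -/
lemma sum_treeProb (hlam : IsDegreeDist lam) (hrho : IsDegreeDist rho) (t : ℕ) :
    ∑ T : EnsembleTree lam rho t, treeProb lam rho t 1 (nodeFrac lam) T = 1 := by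
  have h := congrArg (eval 1) (sum_treeProb_weight lam rho
    (fun _ : Fin (lam.natDegree + 1) => 0) (fun _ : Fin (rho.natDegree + 1) => 1) 1 t 1
    (nodeFrac lam))
  simp only [eval_finsetSum, eval_mul, eval_C, eval_pow, eval_X, one_pow, mul_one] at h
  rw [h, offspring, eval_finsetSum]
  simp [(branchGF_edges lam rho hlam.sum_one hrho.sum_one t).1, hlam.sum_nodeFrac]

/-- `K ≤ E` keeps `E - K` free of truncation and the falling factorial of `E` nonzero. It holds
eventually for all trees at once because they are finitely many. -/
lemma eventually_blocklengths (hlam : IsDegreeDist lam) (t : ℕ) :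
    ∀ᶠ n in blocklengths lam rho, 0 < n ∧ Admissible lam rho n ∧
      ∀ T : EnsembleTree lam rho t, (numEdges t 1 T : ℝ) ≤ n * d1 (nodePoly lam) 1 := by
  have h1 : Tendsto (fun n : ℕ => (n : ℝ) * d1 (nodePoly lam) 1) atTop atTop :=
    tendsto_natCast_atTop_atTop.atTop_mul_const hlam.d1_nodePoly_pos
  have h2 : ∀ᶠ n : ℕ in atTop, ∀ T : EnsembleTree lam rho t,
      (numEdges t 1 T : ℝ) ≤ n * d1 (nodePoly lam) 1 :=
    eventually_all.2 fun T => h1.eventually_ge_atTop _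
  filter_upwards [inf_le_left (a := atTop) (eventually_gt_atTop 0), inf_le_left (a := atTop) h2,
    inf_le_right (a := (atTop : Filter ℕ)) (mem_principal_self {n | Admissible lam rho n})]
    with n a b c using ⟨a, c, b⟩

lemma tendsto_inv_edges (hlam : IsDegreeDist lam) :
    Tendsto (fun n : ℕ => 1 / ((n : ℝ) * d1 (nodePoly lam) 1)) (blocklengths lam rho)
      (𝓝[≠] 0) := by
  rw [tendsto_nhdsWithin_iff]
  constructor
  · have h1 : Tendsto (fun n : ℕ => (n : ℝ) * d1 (nodePoly lam) 1) atTop atTop :=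
      tendsto_natCast_atTop_atTop.atTop_mul_const hlam.d1_nodePoly_pos
    simp only [one_div]
    exact h1.inv_tendsto_atTop.mono_left inf_le_left
  · filter_upwards [inf_le_left (a := atTop) (eventually_gt_atTop 0)] with n hn
    exact one_div_ne_zero (mul_ne_zero (Nat.cast_ne_zero.2 (ne_of_gt hn))
      hlam.d1_nodePoly_pos.ne')

lemma tendsto_treeCorr (hlam : IsDegreeDist lam) {p q t r : ℕ} (T : PlaneTree p q t r) :
    Tendsto (fun n : ℕ => treeCorr lam rho T (1 / ((n : ℝ) * d1 (nodePoly lam) 1)))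
      (blocklengths lam rho) (𝓝 1) := by
  have h := (hasDerivAt_treeCorr lam rho T).continuousAt.tendsto
  rw [treeCorr_zero] at h
  exact h.comp ((tendsto_inv_edges hlam).mono_right nhdsWithin_le_nhds)

/-- With `h = 1 / (n L'(1))` the expression is the slope of `treeCorr` between `0` and `h`, divided
by `L'(1)`. -/
lemma tendsto_mul_treeCorr_sub_one (hlam : IsDegreeDist lam) {p q t r : ℕ}
    (T : PlaneTree p q t r) :
    Tendsto (fun n : ℕ => (n : ℝ) * (treeCorr lam rho T (1 / (n * d1 (nodePoly lam) 1)) - 1))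
      (blocklengths lam rho) (𝓝 (treeCorrDeriv lam rho T / d1 (nodePoly lam) 1)) := by
  have h := ((hasDerivAt_iff_tendsto_slope.1 (hasDerivAt_treeCorr lam rho T)).comp
    (tendsto_inv_edges (rho := rho) hlam)).div_const (d1 (nodePoly lam) 1)
  refine h.congr fun n => ?_
  have hd := hlam.d1_nodePoly_pos.ne'
  simp only [Function.comp_apply, slope_def_field, treeCorr_zero, sub_zero]
  rw [div_div_eq_mul_div, div_one]
  field_simp

lemma cycleFreeErrorProb_eq (hlam : IsDegreeDist lam) (hrho : IsDegreeDist rho) (ε : ℝ) (t : ℕ) :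
    ∀ᶠ n in blocklengths lam rho, cycleFreeErrorProb lam rho ε t n =
      ∑ T : EnsembleTree lam rho t, treeProb lam rho t 1 (nodeFrac lam) T * treeErrorProb ε t 1 T *
        treeCorr lam rho T (1 / (n * d1 (nodePoly lam) 1)) := by
  filter_upwards [eventually_blocklengths hlam t] with n ⟨hn, hadm, hE⟩
  exact ensembleExp_cycleFree hlam hrho hn hadm hE _ _
    fun π T X Y hXY hX => hXY.graphErrorProb_eq ε hX

lemma tendsto_cycleFreeErrorProb (hlam : IsDegreeDist lam) (hrho : IsDegreeDist rho) (ε : ℝ)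
    (t : ℕ) : Tendsto (fun n => cycleFreeErrorProb lam rho ε t n) (blocklengths lam rho)
      (𝓝 (treeExp lam rho t (treeErrorProb ε t 1))) := by
  refine Tendsto.congr' (EventuallyEq.symm (cycleFreeErrorProb_eq hlam hrho ε t)) ?_
  refine tendsto_finsetSum _ fun T _ => ?_
  simpa using (tendsto_treeCorr hlam T).const_mul
    (treeProb lam rho t 1 (nodeFrac lam) T * treeErrorProb ε t 1 T)

/-- The exact formula is applied to the constant `1`. The tree probabilities already sum to one, so
no mass is left for neighborhoods with cycles. -/
lemma tendsto_cycleFreeProb (hlam : IsDegreeDist lam) (hrho : IsDegreeDist rho) (t : ℕ) :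
    Tendsto (fun n => ensembleExp lam rho n fun π v => if CycleFree π t v then 1 else 0)
      (blocklengths lam rho) (𝓝 1) := by
  have h : ∀ᶠ n in blocklengths lam rho,
      ensembleExp lam rho n (fun π v => if CycleFree π t v then 1 else 0) =
      ∑ T : EnsembleTree lam rho t, treeProb lam rho t 1 (nodeFrac lam) T * 1 *
        treeCorr lam rho T (1 / (n * d1 (nodePoly lam) 1)) := by
    filter_upwards [eventually_blocklengths hlam t] with n ⟨hn, hadm, hE⟩
    exact ensembleExp_cycleFree hlam hrho hn hadm hE (fun _ _ => 1) (fun _ => 1)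
      fun π T X Y _ _ => rfl
  refine Tendsto.congr' (EventuallyEq.symm h) ?_
  have h2 := tendsto_finsetSum (Finset.univ : Finset (EnsembleTree lam rho t)) fun T _ =>
    (tendsto_treeCorr (rho := rho) hlam T).const_mul (treeProb lam rho t 1 (nodeFrac lam) T * 1)
  simpa only [mul_one, sum_treeProb hlam hrho t] using h2

/-- The bit error probability tends to the erasure probability of the root of a random tree. -/
theorem tendsto_bitErrorProb (hlam : IsDegreeDist lam) (hrho : IsDegreeDist rho) {ε : ℝ}
    (hε : ε ∈ Set.Icc (0 : ℝ) 1) (t : ℕ) :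
    Tendsto (fun n => bitErrorProb lam rho ε t n) (blocklengths lam rho)
      (𝓝 (treeExp lam rho t (treeErrorProb ε t 1))) := by
  have h1 : Tendsto (fun n => bitErrorProb lam rho ε t n - cycleFreeErrorProb lam rho ε t n)
      (blocklengths lam rho) (𝓝 0) := by
    have h2 := (tendsto_cycleFreeProb hlam hrho t).const_sub 1
    rw [sub_self] at h2
    refine tendsto_of_tendsto_of_tendsto_of_le_of_le' tendsto_const_nhds h2 ?_ ?_
    · filter_upwards [eventually_blocklengths hlam t] with n ⟨hn, hadm, _⟩
      exact (bitErrorProb_sub_le hlam hrho hε t hn hadm).1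
    · filter_upwards [eventually_blocklengths hlam t] with n ⟨hn, hadm, _⟩
      exact (bitErrorProb_sub_le hlam hrho hε t hn hadm).2
  simpa using h1.add (tendsto_cycleFreeErrorProb hlam hrho ε t)

/-- Degrees of zero frequency drop out, because division by zero gives zero. -/
lemma sum_support_eq_sum_fin (P : ℝ[X]) (f : ℕ → ℝ) :
    ∑ a ∈ P.support, ((a + 1 : ℕ) : ℝ) / edgeFrac P (a + 1) * f (a + 1) =
      ∑ a : Fin (P.natDegree + 1), ((a + 1 : ℕ) : ℝ) / edgeFrac P (a + 1) * f (a + 1) := by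
  rw [Fin.sum_univ_eq_sum_range
    (fun a : ℕ => ((a + 1 : ℕ) : ℝ) / edgeFrac P (a + 1) * f (a + 1)) (P.natDegree + 1)]
  refine Finset.sum_subset P.supp_subset_range_natDegree_succ fun a _ ha => ?_
  have : edgeFrac P (a + 1) = 0 := notMem_support_iff.1 ha
  rw [this, div_zero, zero_mul]

lemma treeExp_treeCorrDeriv (ε : ℝ) (t : ℕ) :
    ∑ T : EnsembleTree lam rho t, treeProb lam rho t 1 (nodeFrac lam) T * treeErrorProb ε t 1 T *
      treeCorrDeriv lam rho T = 1 / 2 * (expK lam rho ε t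
        - ∑ a ∈ lam.support, ((a + 1 : ℕ) : ℝ) / edgeFrac lam (a + 1) * expV lam rho ε t (a + 1)
        - ∑ b ∈ rho.support, ((b + 1 : ℕ) : ℝ) / edgeFrac rho (b + 1) *
            expC lam rho ε t (b + 1)) := by
  rw [sum_support_eq_sum_fin lam (expV lam rho ε t), sum_support_eq_sum_fin rho (expC lam rho ε t)]
  simp only [expK, expV, expC, treeExp, Finset.mul_sum]
  rw [Finset.sum_comm (s := (Finset.univ : Finset (Fin (lam.natDegree + 1)))),
    Finset.sum_comm (s := (Finset.univ : Finset (Fin (rho.natDegree + 1)))),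
    ← Finset.sum_sub_distrib, ← Finset.sum_sub_distrib, Finset.mul_sum]
  refine Finset.sum_congr rfl fun T _ => ?_
  rw [treeCorrDeriv]
  have h1 : ∀ (m : ℕ) (x y : Fin m → ℝ) (c : ℝ), ∑ i, x i * (c * (y i * treeErrorProb ε t 1 T)) =
      c * treeErrorProb ε t 1 T * ∑ i, x i * y i := by
    intro m x y c
    rw [Finset.mul_sum]
    exact Finset.sum_congr rfl fun i _ => by ring
  rw [h1 (lam.natDegree + 1) _ (fun a => (numVar (a + 1) t 1 T : ℝ) *
      ((numVar (a + 1) t 1 T : ℝ) - 1)),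
    h1 (rho.natDegree + 1) _ (fun b => (numCheck (b + 1) t 1 T : ℝ) *
      ((numCheck (b + 1) t 1 T : ℝ) - 1))]
  ring

/-- The first order behavior of the cycle-free part of the bit error probability. -/
theorem tendsto_mul_cycleFreeErrorProb_sub (hlam : IsDegreeDist lam) (hrho : IsDegreeDist rho)
    (ε : ℝ) (t : ℕ) :
    Tendsto (fun n : ℕ => (n : ℝ) *
        (cycleFreeErrorProb lam rho ε t n - treeExp lam rho t (treeErrorProb ε t 1)))
      (blocklengths lam rho) (𝓝 (1 / (2 * d1 (nodePoly lam) 1) *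
      (expK lam rho ε t
        - ∑ a ∈ lam.support, ((a + 1 : ℕ) : ℝ) / edgeFrac lam (a + 1) * expV lam rho ε t (a + 1)
        - ∑ b ∈ rho.support, ((b + 1 : ℕ) : ℝ) / edgeFrac rho (b + 1) *
            expC lam rho ε t (b + 1)))) := by
  have h1 : Tendsto (fun n : ℕ => ∑ T : EnsembleTree lam rho t,
      treeProb lam rho t 1 (nodeFrac lam) T * treeErrorProb ε t 1 T *
        ((n : ℝ) * (treeCorr lam rho T (1 / (n * d1 (nodePoly lam) 1)) - 1)))
      (blocklengths lam rho) (𝓝 (∑ T : EnsembleTree lam rho t,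
      treeProb lam rho t 1 (nodeFrac lam) T * treeErrorProb ε t 1 T *
        (treeCorrDeriv lam rho T / d1 (nodePoly lam) 1))) :=
    tendsto_finsetSum _ fun T _ => (tendsto_mul_treeCorr_sub_one hlam T).const_mul _
  have h2 : ∑ T : EnsembleTree lam rho t,
      treeProb lam rho t 1 (nodeFrac lam) T * treeErrorProb ε t 1 T *
        (treeCorrDeriv lam rho T / d1 (nodePoly lam) 1) = 1 / (2 * d1 (nodePoly lam) 1) *
      (expK lam rho ε t
        - ∑ a ∈ lam.support, ((a + 1 : ℕ) : ℝ) / edgeFrac lam (a + 1) * expV lam rho ε t (a + 1)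
        - ∑ b ∈ rho.support, ((b + 1 : ℕ) : ℝ) / edgeFrac rho (b + 1) *
            expC lam rho ε t (b + 1)) := by
    simp only [← mul_div_assoc]
    rw [← Finset.sum_div, treeExp_treeCorrDeriv]
    have := hlam.d1_nodePoly_pos.ne'
    field_simp
  rw [h2] at h1
  refine h1.congr' ?_
  filter_upwards [cycleFreeErrorProb_eq hlam hrho ε t] with n hn
  rw [hn, treeExp, ← Finset.sum_sub_distrib, Finset.mul_sum]
  exact Finset.sum_congr rfl fun T _ => by ring

end Limits

end LDPC

end

open LDPC
theorem theorem1 (lam rho : ℝ[X]) (hlam : IsDegreeDist lam) (hrho : IsDegreeDist rho)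
    (ε : ℝ) (hε : ε ∈ Set.Icc (0 : ℝ) 1) (t : ℕ) :
    -- the limits that define `P_b(∞, ε, t)` and `β(ε, t)` exist
    Tendsto (fun n => bitErrorProb lam rho ε t n) (blocklengths lam rho)
      (𝓝 (limBitErrorProb lam rho ε t)) ∧
    Tendsto (fun n => betaSeq lam rho ε t n) (blocklengths lam rho) (𝓝 (beta lam rho ε t)) ∧
    -- the sums run over the degrees `i = a + 1` with `λ_i ≠ 0` and `j = b + 1` with `ρ_j ≠ 0`
    beta lam rho ε t = 1 / (2 * d1 (nodePoly lam) 1) *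
      (expK lam rho ε t
        - ∑ a ∈ lam.support, ((a + 1 : ℕ) : ℝ) / edgeFrac lam (a + 1) * expV lam rho ε t (a + 1)
        - ∑ b ∈ rho.support, ((b + 1 : ℕ) : ℝ) / edgeFrac rho (b + 1) * expC lam rho ε t (b + 1)) ∧
    expK lam rho ε t =
      ε * d2 (nodePoly lam) (deP lam rho ε t) * FK1 lam rho ε t ^ 2
        + ε * d1 (nodePoly lam) (deP lam rho ε t) * FK2 lam rho ε t ∧
    (∀ i : ℕ, 1 ≤ i → expV lam rho ε t i =
      ε * d2 (nodePoly lam) (deP lam rho ε t) * FV1 lam rho ε i t ^ 2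
        + ε * d1 (nodePoly lam) (deP lam rho ε t) * FV2 lam rho ε i t
        + 2 * ε * nodeFrac lam i * i * deP lam rho ε t ^ (i - 1) * FV1 lam rho ε i t) ∧
    ∀ j : ℕ, 1 ≤ j → expC lam rho ε t j =
      ε * d2 (nodePoly lam) (deP lam rho ε t) * FC1 lam rho ε j t ^ 2
        + ε * d1 (nodePoly lam) (deP lam rho ε t) * FC2 lam rho ε j t := by
  -- A limit determines `limUnder` only along a proper filter; this is where rationality of the
  -- coefficients enters.
  have := blocklengths_neBot hlam hrho
  have h1 := tendsto_bitErrorProb hlam hrho hε t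
  have hlim : limBitErrorProb lam rho ε t = treeExp lam rho t (treeErrorProb ε t 1) := h1.limUnder_eq
  have h2 := tendsto_mul_cycleFreeErrorProb_sub hlam hrho ε t
  rw [← hlim] at h1 h2
  have hbeta : beta lam rho ε t = _ := h2.limUnder_eq
  refine ⟨h1, ?_, hbeta, expK_eq lam rho ε hlam.sum_one hrho.sum_one t,
    fun i hi => expV_eq lam rho ε hlam.sum_one hrho.sum_one t hi,
    fun j hj => expC_eq lam rho ε hlam.sum_one hrho.sum_one t hj⟩
  rw [hbeta]
  exact h2
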